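/- Let $N\ge 1$, let $S^N$ be the unit sphere of $\mathbb R^{N+1}$ with surface measure $\sigma$, and let $\Delta_S$ be its Laplace–Beltrami operator. For $k=0,1,2,\dots$ put $\lambda_k=k(k+N-1)$ (the distinct eigenvalues of $-\Delta_S$ in increasing order), let $H_k$ be the eigenspace of $-\Delta_S$ for $\lambda_k$ (the spherical harmonics of degree $k$), let $a_k=\dim H_k$, and let $Y^{(k)}_1,\dots,Y^{(k)}_{a_k}$ be an arbitrary real orthonormal basis of $H_k$ in $L_2(S^N,\sigma)$. For an integrable (real- or complex-valued) function $f$ on $S^N$ let $$Y_k(f,x)=\sum_{j=1}^{a_k}Y^{(k)}_j(x)\int_{S^N}f(y)\,Y^{(k)}_j(y)\,d\sigma(y),$$ so that $\sum_k Y_k(f,x)$ is the Fourier–Laplace series of $f$, and let its Riesz means of order $s$ be $$E^s_\lambda f(x)=\sum_{\lambda_k<\lambda}\Bigl(1-\frac{\lambda_k}{\lambda}\Bigr)^{s}Y_k(f,x)\quad(\lambda>0),\qquad E^s_n f(x)=\sum_{k=0}^{n}\Bigl(1-\frac{\lambda_k}{\lambda_n}\Bigr)^{s}Y_k(f,x)\quad(n\ge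 1).$$ Theorem. Let $1\le p\le 2$, let $f\in L_p(S^N)$, and let $s$ be a real number with $s>(N-1)\left(\frac1p-\frac12\right)$. Then for almost every $x\in S^N$ one has $E^s_\lambda f(x)\to f(x)$ as the real parameter $\lambda\to\infty$, and $E^s_n f(x)\to f(x)$ as the integer $n\to\infty$. -/

import Mathlib

open Filter Topology MeasureTheory
open scoped ContDiff

namespace FourierLaplace

/-- The Euclidean space `ℝ^(N+1)`. -/
abbrev Ambient (N : ℕ) : Type := EuclideanSpace ℝ (Fin (N + 1))

/-- The unit sphere `S^N` of `ℝ^(N+1)`. -/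
abbrev USphere (N : ℕ) : Type := Metric.sphere (0 : Ambient N) 1

/-- The surface measure of `S^N`. -/
noncomputable def surfaceMeasure (N : ℕ) : Measure (USphere N) :=
  (volume : Measure (Ambient N)).toSphere

/-- The extension of a function on `S^N` to `ℝ^(N+1)` that is constant along the open rays from the
origin: `y ↦ g (y / ‖y‖)` for `y ≠ 0` (and the value `0` at the origin, which plays no role). -/
noncomputable def radialExt {N : ℕ} (g : USphere N → ℝ) (y : Ambient N) : ℝ :=
  open Classical in
  if h : y = 0 then 0 else g ⟨‖y‖⁻¹ • y, by
    rw [mem_sphere_zero_iff_norm, norm_smul, norm_inv, norm_norm,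
      inv_mul_cancel₀ (norm_ne_zero_iff.mpr h)]⟩

/-- A function on `S^N` is smooth if its radial extension is smooth off the origin. -/
def SmoothOnSphere {N : ℕ} (g : USphere N → ℝ) : Prop :=
  ContDiffOn ℝ ∞ (radialExt g) {0}ᶜ

/-- The Laplace–Beltrami operator `Δ_S` of `S^N` (on smooth functions): the restriction to the
sphere of the Euclidean Laplacian of the radial extension. -/
noncomputable def laplaceBeltrami {N : ℕ} (g : USphere N → ℝ) (x : USphere N) : ℝ :=
  Laplacian.laplacian (radialExt g) (x : Ambient N)

/-- `λ_k = k (k + N - 1)`, the `k`-th eigenvalue of `-Δ_S` on `S^N`. -/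
def eigval (N k : ℕ) : ℝ := (k : ℝ) * ((k : ℝ) + (N : ℝ) - 1)

theorem radialExt_add {N : ℕ} (g h : USphere N → ℝ) :
    radialExt (g + h) = radialExt g + radialExt h := by
  funext y
  by_cases hy : y = 0 <;> simp [radialExt, hy]

theorem radialExt_smul {N : ℕ} (c : ℝ) (g : USphere N → ℝ) :
    radialExt (c • g) = c • radialExt g := by
  funext y
  by_cases hy : y = 0 <;> simp [radialExt, hy]

theorem radialExt_zero {N : ℕ} : radialExt (0 : USphere N → ℝ) = 0 := by
  funext y
  by_cases hy : y = 0 <;> simp [radialExt, hy]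

theorem SmoothOnSphere.contDiffAt {N : ℕ} {g : USphere N → ℝ} (hg : SmoothOnSphere g)
    (x : USphere N) : ContDiffAt ℝ 2 (radialExt g) (x : Ambient N) := by
  have hx : (x : Ambient N) ≠ 0 := by
    intro h
    have := mem_sphere_zero_iff_norm.mp x.2
    simp [h] at this
  have h1 : ContDiffAt ℝ ∞ (radialExt g) (x : Ambient N) :=
    ContDiffOn.contDiffAt hg (isOpen_compl_singleton.mem_nhds hx)
  exact h1.of_le (WithTop.coe_le_coe.mpr le_top)

/-- `H_k`, the space of spherical harmonics of degree `k` on `S^N`: the eigenspace of `-Δ_S` for the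
eigenvalue `λ_k`. -/
noncomputable def sphericalHarmonics (N k : ℕ) : Submodule ℝ (USphere N → ℝ) where
  carrier := {g | SmoothOnSphere g ∧ ∀ x, -laplaceBeltrami g x = eigval N k * g x}
  add_mem' := by
    rintro g h ⟨hg, hg'⟩ ⟨hh, hh'⟩
    refine ⟨?_, fun x => ?_⟩
    · unfold SmoothOnSphere
      rw [radialExt_add]
      exact ContDiffOn.add hg hh
    · have h1 := hg' x
      have h2 := hh' x
      unfold laplaceBeltrami at *
      rw [radialExt_add, (hg.contDiffAt x).laplacian_add (hh.contDiffAt x), Pi.add_apply]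
      linarith
  zero_mem' := by
    refine ⟨?_, fun x => ?_⟩
    · unfold SmoothOnSphere
      rw [radialExt_zero]
      exact contDiffOn_const
    · have h0 : Laplacian.laplacian (0 : Ambient N → ℝ) (x : Ambient N) = 0 := by
        have := InnerProductSpace.laplacian_smul (0 : ℝ)
          (f := (0 : Ambient N → ℝ)) (x := (x : Ambient N)) contDiffAt_const
        simpa using this
      unfold laplaceBeltrami
      rw [radialExt_zero, h0]
      simp
  smul_mem' := by
    rintro c g ⟨hg, hg'⟩
    refine ⟨?_, fun x => ?_⟩
    · unfold SmoothOnSphere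
      rw [radialExt_smul]
      exact ContDiffOn.const_smul c hg
    · have h1 := hg' x
      unfold laplaceBeltrami at *
      rw [radialExt_smul, InnerProductSpace.laplacian_smul c (hg.contDiffAt x), Pi.smul_apply,
        smul_eq_mul, smul_eq_mul]
      linear_combination c * h1

/-- `a_k`, the dimension of `H_k`. -/
noncomputable def harmonicDim (N k : ℕ) : ℕ := Module.finrank ℝ (sphericalHarmonics N k)

/-- `Y k 1, …, Y k a_k` are elements of `H_k`, orthonormal in `L₂(S^N)`, for every `k`. As their
number is the dimension of `H_k`, they form an orthonormal basis of it. -/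
structure IsHarmonicSystem (N : ℕ) (Y : (k : ℕ) → Fin (harmonicDim N k) → USphere N → ℝ) :
    Prop where
  mem : ∀ k j, Y k j ∈ sphericalHarmonics N k
  orthonormal : ∀ k i j,
    ∫ y, Y k i y * Y k j y ∂(surfaceMeasure N) = if i = j then 1 else 0

/-- `Y_k(f, x)`, the `k`-th term of the Fourier–Laplace series of `f` at `x`. -/
noncomputable def seriesTerm {𝕜 : Type*} [RCLike 𝕜] {N : ℕ}
    (Y : (k : ℕ) → Fin (harmonicDim N k) → USphere N → ℝ)
    (f : USphere N → 𝕜) (k : ℕ) (x : USphere N) : 𝕜 :=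
  ∑ j, (Y k j x : 𝕜) * ∫ y, f y * (Y k j y : 𝕜) ∂(surfaceMeasure N)

/-- The indices `k` with `λ_k < l`. -/
noncomputable def indicesBelow (N : ℕ) (l : ℝ) : Finset ℕ :=
  open Classical in (Finset.range ⌈l⌉₊).filter (fun k => eigval N k < l)

/-- The cut-off at `⌈l⌉` in `indicesBelow` loses no index. -/
theorem mem_indicesBelow {N : ℕ} (hN : 1 ≤ N) {l : ℝ} (hl : 0 < l) {k : ℕ} :
    k ∈ indicesBelow N l ↔ eigval N k < l := by
  have hN' : (1 : ℝ) ≤ N := by exact_mod_cast hN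
  simp only [indicesBelow, Finset.mem_filter, Finset.mem_range, and_iff_right_iff_imp]
  intro h
  rw [Nat.lt_ceil]
  rcases Nat.eq_zero_or_pos k with rfl | hk
  · simpa using hl
  · have hk' : (1 : ℝ) ≤ k := by exact_mod_cast hk
    unfold eigval at h
    nlinarith

/-- The Riesz mean of order `s` with real parameter `l`:
`E_l^s f(x) = ∑_{λ_k < l} (1 - λ_k / l)^s Y_k(f, x)`. -/
noncomputable def rieszMean {𝕜 : Type*} [RCLike 𝕜] {N : ℕ}
    (Y : (k : ℕ) → Fin (harmonicDim N k) → USphere N → ℝ)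
    (s l : ℝ) (f : USphere N → 𝕜) (x : USphere N) : 𝕜 :=
  ∑ k ∈ indicesBelow N l, (((1 - eigval N k / l) ^ s : ℝ) : 𝕜) * seriesTerm Y f k x

/-- The Riesz mean of order `s` with integer parameter `n`:
`E_n^s f(x) = ∑_{k = 0}^n (1 - λ_k / λ_n)^s Y_k(f, x)`, for `n ≥ 1`. -/
noncomputable def rieszMeanNat {𝕜 : Type*} [RCLike 𝕜] {N : ℕ}
    (Y : (k : ℕ) → Fin (harmonicDim N k) → USphere N → ℝ)
    (s : ℝ) (n : ℕ) (f : USphere N → 𝕜) (x : USphere N) : 𝕜 :=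
  ∑ k ∈ Finset.range (n + 1),
    (((1 - eigval N k / eigval N n) ^ s : ℝ) : 𝕜) * seriesTerm Y f k x

end FourierLaplace

/-! Write N = n + 1, ν = n/2 and κ = n(1/p − 1/2). Convergence is evident for finite sums of
spherical harmonics, and these are dense in L_p, so everything rests on a weak type (p, p) bound for
the maximal function sup over l ≥ 1 of |E^s_l f| (`exists_weakType_rieszMean`). The discrete means
are the continuous ones at l = λ_n, because s > 0 makes the last term vanish.

For the maximal bound, (1 − λ/l)^s is cut dyadically according to the distance from the edge λ = l.
The j-th piece is 2^(−js) ψ(2^j (1 − λ/l)), used for 4^j up to about l; what then remains touches at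
most six eigenvalues and is controlled by single terms of the series (`abs_rieszMean_le`). For fixed
j, the supremum of the piece over l has weak type (1, 1) with constant O(2^(jν)), by a kernel
estimate and the Hardy–Littlewood theorem (`exists_abs_bandSum_le`), and weak type (2, 2) with
constant O(1), by a Sobolev inequality in l and Bessel's inequality (`exists_weakType_two_bandSum`).
Interpolation gives weak type (p, p) with constant O(2^(jν(2−p))) = O(2^(jκp)), and the weights
2^(−js) make the pieces summable as soon as s > κ.

The kernel estimate (`multiplier_kernel_bound`) needs no asymptotic formula. The zonal functions
Z_k^ν satisfy |Z_k^ν(cos t)| ≤ C (k+1)^ν (sin t)^(−ν), by a Sonin energy argument (`zonal_decay`).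
Summation by parts rewrites ∑ F(k) Z_k^ν as ∑ F_M(k) Z_k^(ν+M), where F_M(k) is a constant times the
M-th divided difference of F at the eigenvalues λ_k, λ_(k+2), …, λ_(k+2M). Since F is a smooth
function of λ, the mean value property of divided differences gives |F_M| ≤ C (2^j/l)^M, and each
step gains a factor (h sin t)^(−1) with h = √l/2^j.

Spherical harmonics enter only as eigenfunctions. Zonal functions are eigenfunctions, eigenspaces
are orthogonal by Green's formula, and the generating function of the zonal functions is the Poisson
kernel, an approximate identity. Applied to an element of H_k, the Poisson series keeps one term, so
the zonal function reproduces H_k (`integral_zonal_mul_of_mem`). Finite dimension, the addition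
theorem and uniform density of harmonic sums follow. -/

namespace FourierLaplace

/-! ### Gegenbauer polynomials and zonal functions: identities. -/

/-- Gegenbauer polynomials with a shifted index: `gegen μ (k + 1) = C_k^{(μ)}`, `gegen μ 0 = 0`. -/
noncomputable def gegen (μ : ℝ) : ℕ → ℝ → ℝ
  | 0, _ => 0
  | 1, _ => 1
  | (k + 2), x =>
    (2 * (k + μ) * x * gegen μ (k + 1) x - (k + 2 * μ - 1) * gegen μ k x) / (k + 1)

/-- The zonal polynomial of degree `k` in dimension `2 ν + 2`, normalised so that its product with
the reciprocal of the total mass of the sphere is the reproducing kernel. -/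
noncomputable def zonal (ν : ℝ) : ℕ → ℝ → ℝ
  | 0, _ => 1
  | (k + 1), x => gegen (ν + 1) (k + 2) x - gegen (ν + 1) k x

theorem gegen_zero (μ x : ℝ) : gegen μ 0 x = 0 := by simp [gegen]

theorem gegen_one (μ x : ℝ) : gegen μ 1 x = 1 := by simp [gegen]

theorem zonal_zero (ν x : ℝ) : zonal ν 0 x = 1 := by simp [zonal]

theorem zonal_succ (ν : ℝ) (k : ℕ) (x : ℝ) :
    zonal ν (k + 1) x = gegen (ν + 1) (k + 2) x - gegen (ν + 1) k x := by simp [zonal]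

theorem gegen_rec (μ : ℝ) (k : ℕ) (x : ℝ) :
    (k + 1) * gegen μ (k + 2) x =
      2 * (k + μ) * x * gegen μ (k + 1) x - (k + 2 * μ - 1) * gegen μ k x := by
  rw [gegen]
  have : (k + 1 : ℝ) ≠ 0 := by positivity
  field_simp

/-- The basic contiguous relation between the parameters μ and μ + 1. `gegen_raise`, `gegen_raise'`
and `gegen_sq` are linear consequences of it and of the three-term recurrence. -/
theorem gegen_lower (μ : ℝ) (k : ℕ) (x : ℝ) :
    (k + 1) * gegen μ (k + 2) x = 2 * μ * (x * gegen (μ + 1) (k + 1) x - gegen (μ + 1) k x) := by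
  induction k using Nat.twoStepInduction with
  | zero => have := gegen_rec μ 0 x; simp [gegen_zero, gegen_one] at this ⊢; linarith
  | one =>
    have h1 := gegen_rec μ 0 x
    have h2 := gegen_rec μ 1 x
    have h3 := gegen_rec (μ + 1) 0 x
    simp [gegen_zero, gegen_one] at h1 h2 h3 ⊢
    rw [h1] at h2
    rw [h3]
    linarith
  | more k ih1 ih2 =>
    have r1 := gegen_rec μ (k + 2) x
    have r2 := gegen_rec (μ + 1) (k + 1) x
    have r3 := gegen_rec (μ + 1) k x
    have k1 : (k + 1 : ℝ) ≠ 0 := by positivity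
    have k2 : (k + 2 : ℝ) ≠ 0 := by positivity
    have k3 : (k + 3 : ℝ) ≠ 0 := by positivity
    push_cast at *
    simp only [show k + 2 + 2 = k + 4 from rfl, show k + 2 + 1 = k + 3 from rfl,
      show k + 1 + 1 = k + 2 from rfl] at *
    have e2 : gegen μ (k + 2) x = 2 * μ * (x * gegen (μ + 1) (k + 1) x - gegen (μ + 1) k x) / (k + 1) := by
      field_simp; linarith
    have e3 : gegen μ (k + 3) x = 2 * μ * (x * gegen (μ + 1) (k + 2) x - gegen (μ + 1) (k + 1) x) / (k + 2) := by
      field_simp; linarith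
    have a3 : gegen (μ + 1) (k + 3) x = (2 * (k + 1 + (μ + 1)) * x * gegen (μ + 1) (k + 2) x - (k + 1 + 2 * (μ + 1) - 1) * gegen (μ + 1) (k + 1) x) / (k + 2) := by
      field_simp; linarith
    have a2 : gegen (μ + 1) (k + 2) x = (2 * (k + (μ + 1)) * x * gegen (μ + 1) (k + 1) x - (k + 2 * (μ + 1) - 1) * gegen (μ + 1) k x) / (k + 1) := by
      field_simp; linarith
    have : ((k : ℝ) + 2 + 1) * gegen μ (k + 4) x = 2 * (k + 2 + μ) * x * gegen μ (k + 3) x - (k + 2 + 2 * μ - 1) * gegen μ (k + 2) x := r1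
    rw [this, e3, e2, a3, a2]
    field_simp
    ring

theorem gegen_raise (μ : ℝ) (k : ℕ) (x : ℝ) :
    (k + 1 + μ) * gegen μ (k + 2) x = μ * (gegen (μ + 1) (k + 2) x - gegen (μ + 1) k x) := by
  have h1 := gegen_lower μ k x
  have h2 := gegen_rec (μ + 1) k x
  have k1 : (k + 1 : ℝ) ≠ 0 := by positivity
  apply mul_left_cancel₀ k1
  linear_combination (k + 1 + μ) * h1 - μ * h2

theorem gegen_raise' (μ : ℝ) (k : ℕ) (x : ℝ) :
    (k + 2 * μ) * gegen μ (k + 1) x = 2 * μ * (gegen (μ + 1) (k + 1) x - x * gegen (μ + 1) k x) := by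
  rcases k with _ | k
  · simp [gegen_zero, gegen_one]
  · have h1 := gegen_lower μ k x
    have h2 := gegen_raise μ k x
    push_cast
    linear_combination 2 * h2 - h1

theorem gegen_sq (μ : ℝ) (k : ℕ) (x : ℝ) :
    2 * μ * (1 - x ^ 2) * gegen (μ + 1) k x =
      x * (k + 2 * μ) * gegen μ (k + 1) x - (k + 1) * gegen μ (k + 2) x := by
  linear_combination gegen_lower μ k x - x * gegen_raise' μ k x

theorem hasDerivAt_gegen (μ : ℝ) (k : ℕ) (x : ℝ) :
    HasDerivAt (gegen μ (k + 1)) (2 * μ * gegen (μ + 1) k x) x := by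
  induction k using Nat.twoStepInduction with
  | zero =>
    simp only [gegen_zero, mul_zero]
    exact (hasDerivAt_const x (1 : ℝ)).congr_of_eventuallyEq (.of_forall fun y => gegen_one μ y)
  | one =>
    have : gegen μ (1 + 1) = fun y => 2 * μ * y := by
      funext y
      have := gegen_rec μ 0 y
      simp [gegen_zero, gegen_one] at this ⊢; linarith
    rw [this, gegen_one]
    simpa using (hasDerivAt_id x).const_mul (2 * μ)
  | more k ih1 ih2 =>
    have h : gegen μ (k + 2 + 1) = fun y =>
        (2 * ((k + 1 : ℕ) + μ) * y * gegen μ (k + 1 + 1) y - ((k + 1 : ℕ) + 2 * μ - 1) * gegen μ (k + 1) y)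
          / ((k + 1 : ℕ) + 1) := by
      funext y; rw [gegen]
    rw [h]
    have := ((((hasDerivAt_id x).const_mul (2 * ((k + 1 : ℕ) + μ))).mul ih2).sub
      (ih1.const_mul ((k + 1 : ℕ) + 2 * μ - 1))).div_const ((k + 1 : ℕ) + 1 : ℝ)
    refine this.congr_deriv ?_
    have k1 : (k + 1 + 1 : ℝ) ≠ 0 := by positivity
    have h1 := gegen_raise μ k x
    have h2 := gegen_rec (μ + 1) k x
    push_cast
    simp only [id, show k + 1 + 1 = k + 2 from rfl]
    rw [div_eq_iff k1]
    linear_combination 2 * h1 - 2 * μ * h2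

/-- Since `zonal ν` is a difference of Gegenbauer polynomials of parameter ν + 1, and these are
multiples of `zonal (ν + 1)`, an Abel summation raises ν by one. -/
theorem mul_zonal_succ (ν : ℝ) (k : ℕ) (x : ℝ) :
    (ν + 1) * zonal (ν + 1) k x = (k + 1 + ν) * gegen (ν + 1) (k + 1) x := by
  rcases k with _ | k
  · simp [zonal_zero, gegen_one]; ring
  · have := gegen_raise (ν + 1) k x
    rw [zonal_succ, ← this]; push_cast; ring

theorem hasDerivAt_zonal (ν : ℝ) (k : ℕ) (x : ℝ) :
    HasDerivAt (zonal ν (k + 1)) (2 * (ν + 1) * zonal (ν + 1) k x) x := by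
  have h0 : zonal ν (k + 1) = fun y => gegen (ν + 1) (k + 1 + 1) y - gegen (ν + 1) k y := by
    funext y; rw [zonal_succ]
  rw [h0]
  rcases k with _ | k
  · have := (hasDerivAt_gegen (ν + 1) 1 x)
    simp only [gegen_zero, sub_zero]
    refine this.congr_deriv ?_
    rw [gegen_one, zonal_zero]
  · refine ((hasDerivAt_gegen (ν + 1) (k + 2) x).sub (hasDerivAt_gegen (ν + 1) k x)).congr_deriv ?_
    rw [zonal_succ]
    ring

/-- The Gegenbauer equation (1 − x²)Z'' − (2ν + 1)xZ' + λZ = 0, with Z' and Z'' in closed form. -/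
theorem zonal_ode (ν : ℝ) (k : ℕ) (x : ℝ) :
    (1 - x ^ 2) * (2 * (k + 1 + ν) * (2 * (ν + 1) * gegen (ν + 2) k x))
      - (2 * ν + 1) * x * (2 * (k + 1 + ν) * gegen (ν + 1) (k + 1) x)
      + (k + 1) * (k + 1 + 2 * ν) * zonal ν (k + 1) x = 0 := by
  have h1 := gegen_sq (ν + 1) k x
  have h2 := gegen_rec (ν + 1) k x
  rw [zonal_succ]
  rw [show ν + 2 = ν + 1 + 1 by ring]
  linear_combination (2 * (k + 1 + ν)) * h1 - (k + 1) * h2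

theorem hasDerivAt_zonal' (ν : ℝ) (k : ℕ) (x : ℝ) :
    HasDerivAt (zonal ν (k + 1)) (2 * (k + 1 + ν) * gegen (ν + 1) (k + 1) x) x := by
  refine (hasDerivAt_zonal ν k x).congr_deriv ?_
  rw [mul_assoc, mul_zonal_succ, mul_assoc]

theorem hasDerivAt_zonal_deriv (ν : ℝ) (k : ℕ) (x : ℝ) :
    HasDerivAt (fun x => 2 * (k + 1 + ν) * gegen (ν + 1) (k + 1) x)
      (2 * (k + 1 + ν) * (2 * (ν + 1) * gegen (ν + 2) k x)) x := by
  have := (hasDerivAt_gegen (ν + 1) k x).const_mul (2 * (k + 1 + ν))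
  rwa [show ν + 1 + 1 = ν + 2 by ring] at this

theorem contDiff_gegen (μ : ℝ) (k : ℕ) : ContDiff ℝ ∞ (gegen μ k) := by
  induction k using Nat.twoStepInduction with
  | zero => simpa [funext (gegen_zero μ)] using contDiff_const
  | one => simpa [funext (gegen_one μ)] using contDiff_const
  | more k ih1 ih2 =>
    have h : gegen μ (k + 2) = fun y =>
        (2 * (k + μ) * y * gegen μ (k + 1) y - (k + 2 * μ - 1) * gegen μ k y) / (k + 1) := by
      funext y; rw [gegen]
    rw [h]
    fun_prop

theorem contDiff_zonal (ν : ℝ) (k : ℕ) : ContDiff ℝ ∞ (zonal ν k) := by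
  rcases k with _ | k
  · simpa [funext (zonal_zero ν)] using contDiff_const
  · rw [funext (zonal_succ ν k)]
    exact (contDiff_gegen _ _).sub (contDiff_gegen _ _)

theorem gegen_neg (μ : ℝ) (k : ℕ) (x : ℝ) : gegen μ k (-x) = (-1) ^ (k + 1) * gegen μ k x := by
  induction k using Nat.twoStepInduction with
  | zero => simp [gegen_zero]
  | one => simp [gegen_one]
  | more k ih1 ih2 =>
    rw [gegen, gegen, ih1, ih2]
    ring

theorem zonal_neg (ν : ℝ) (k : ℕ) (x : ℝ) : zonal ν k (-x) = (-1) ^ k * zonal ν k x := by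
  rcases k with _ | k
  · simp [zonal_zero]
  · rw [zonal_succ, zonal_succ, gegen_neg, gegen_neg]; ring

/-! ### Uniform bounds for the zonal functions. -/

theorem abs_zonal_le_abs_one {ν : ℝ} (hν : 0 ≤ ν) (k : ℕ) {x : ℝ} (hx : |x| ≤ 1) :
    |zonal ν k x| ≤ |zonal ν k 1| := by
  rcases k with _ | k
  · simp [zonal_zero]
  wlog h0 : 0 ≤ x generalizing x
  · have := this (x := -x) (by rwa [abs_neg]) (by linarith)
    rw [zonal_neg] at this
    simpa [abs_mul] using this
  have hx1 : x ≤ 1 := (abs_le.mp hx).2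
  set L : ℝ := (k + 1) * (k + 1 + 2 * ν) with hL
  have hLpos : 0 < L := by positivity
  let D : ℝ → ℝ := fun x => 2 * (k + 1 + ν) * gegen (ν + 1) (k + 1) x
  -- A Sonin function: by the differential equation F' = 4νxZ'²/L, which is nonnegative on [0, 1].
  -- Moreover F ≥ Z², with equality at 1.
  let F : ℝ → ℝ := fun x => zonal ν (k + 1) x ^ 2 + (1 - x ^ 2) * D x ^ 2 / L
  have hF : ∀ y, HasDerivAt F (4 * ν * y * D y ^ 2 / L) y := by
    intro y
    have d1 := (hasDerivAt_zonal' ν k y).fun_pow 2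
    have d2 := (((hasDerivAt_const y (1 : ℝ)).fun_sub ((hasDerivAt_id y).fun_pow 2)).fun_mul
      ((hasDerivAt_zonal_deriv ν k y).fun_pow 2)).div_const L
    refine (d1.fun_add d2).congr_deriv ?_
    have ode := zonal_ode ν k y
    simp only [D, id, Nat.cast_ofNat]
    rw [eq_div_iff hLpos.ne', add_mul, div_mul_cancel₀ _ hLpos.ne']
    linear_combination (4 * (k + 1 + ν) * gegen (ν + 1) (k + 1) y) * ode
      + (4 * (k + 1 + ν) * gegen (ν + 1) (k + 1) y * zonal ν (k + 1) y) * hL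
  have hmono : MonotoneOn F (Set.Icc 0 1) := by
    apply monotoneOn_of_deriv_nonneg (convex_Icc 0 1)
    · exact fun y _ => (hF y).continuousAt.continuousWithinAt
    · exact fun y _ => (hF y).differentiableAt.differentiableWithinAt
    · intro y hy
      rw [interior_Icc] at hy
      rw [(hF y).deriv]
      have := hy.1
      positivity
  have h1 := hmono ⟨h0, hx1⟩ ⟨zero_le_one, le_rfl⟩ hx1
  have h2 : F 1 = zonal ν (k + 1) 1 ^ 2 := by simp [F]
  have h3 : zonal ν (k + 1) x ^ 2 ≤ F x := by
    have : 0 ≤ (1 - x ^ 2) * D x ^ 2 / L := by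
      have : x ^ 2 ≤ 1 := by nlinarith
      have : 0 ≤ 1 - x ^ 2 := by linarith
      positivity
    simp only [F]; linarith
  exact sq_le_sq.mp (h3.trans (h1.trans h2.le))

theorem gegen_at_one_rec (μ : ℝ) (k : ℕ) :
    (k + 1) * gegen μ (k + 2) 1 = (k + 2 * μ) * gegen μ (k + 1) 1 := by
  induction k with
  | zero => have := gegen_rec μ 0 1; simp [gegen_zero, gegen_one] at this ⊢; linarith
  | succ k ih =>
    have := gegen_rec μ (k + 1) 1
    push_cast at *
    simp only [show k + 1 + 2 = k + 3 from rfl, show k + 1 + 1 = k + 2 from rfl] at *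
    linear_combination this + ih

/-- The value is the binomial coefficient of k + n over n. The ratio of consecutive values is 1 +
n/(k+1), at most ((k+2)/(k+1))^n by Bernoulli's inequality, and the product of these bounds
telescopes. -/
theorem gegen_at_one_bound (n : ℕ) (k : ℕ) :
    0 ≤ gegen (((n + 1 : ℕ) : ℝ) / 2) (k + 1) 1 ∧
      gegen (((n + 1 : ℕ) : ℝ) / 2) (k + 1) 1 ≤ (k + 1 : ℝ) ^ n := by
  induction k with
  | zero => simp [gegen_one]
  | succ k ih =>
    have h := gegen_at_one_rec (((n + 1 : ℕ) : ℝ) / 2) k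
    have hk : (0 : ℝ) < k + 1 := by positivity
    have e : gegen (((n + 1 : ℕ) : ℝ) / 2) (k + 1 + 1) 1
        = (k + n + 1) / (k + 1) * gegen (((n + 1 : ℕ) : ℝ) / 2) (k + 1) 1 := by
      push_cast at *
      simp only [show k + 1 + 1 = k + 2 from rfl] at *
      field_simp
      linear_combination h
    rw [e]
    have hpos : (0 : ℝ) ≤ (k + n + 1) / (k + 1) := by positivity
    refine ⟨mul_nonneg hpos ih.1, ?_⟩
    have b := one_add_mul_le_pow (a := 1 / ((k : ℝ) + 1)) (by
      have : 0 < 1 / ((k : ℝ) + 1) := by positivity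
      linarith) n
    have e2 : (k + n + 1 : ℝ) / (k + 1) = 1 + n * (1 / (k + 1)) := by field_simp; ring
    have e3 : (1 + 1 / ((k : ℝ) + 1)) = (k + 1 + 1) / (k + 1) := by field_simp
    calc _ ≤ ((k + 1 + 1) / (k + 1) : ℝ) ^ n * (k + 1 : ℝ) ^ n := by
          rw [e2]; rw [e3] at b
          exact mul_le_mul b ih.2 ih.1 (by positivity)
      _ = _ := by rw [← mul_pow]; push_cast; congr 1; field_simp

theorem zonal_at_one_bound (n : ℕ) : ∃ A : ℝ, 0 < A ∧ ∀ k : ℕ,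
    |zonal ((n : ℝ) / 2) k 1| ≤ A * (k + 1 : ℝ) ^ n := by
  rcases n with _ | n
  -- The case ν = 0 (the circle) is separate, as the formula used below divides by ν; here the
  -- values at 1 are 1 and 2.
  · refine ⟨2, by norm_num, fun k => ?_⟩
    rcases k with _ | k
    · simp [zonal_zero]
    · have h : ∀ j : ℕ, gegen 1 j 1 = j := by
        intro j
        induction j using Nat.twoStepInduction with
        | zero => simp [gegen_zero]
        | one => simp [gegen_one]
        | more j h1 h2 =>
          rw [gegen, h1, h2]; push_cast
          have : (j + 1 : ℝ) ≠ 0 := by positivity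
          field_simp; ring
      simp [zonal_succ, h]
  · refine ⟨2, by norm_num, fun k => ?_⟩
    rcases k with _ | k
    · simp [zonal_zero]
    · set ν : ℝ := ((n + 1 : ℕ) : ℝ) / 2 with hν
      have hν0 : 1 / 2 ≤ ν := by rw [hν]; push_cast; linarith [(n.cast_nonneg : (0 : ℝ) ≤ n)]
      have h := gegen_raise ν k 1
      rw [← zonal_succ] at h
      have e : zonal ν (k + 1) 1 = (k + 1 + ν) / ν * gegen ν (k + 2) 1 := by
        field_simp; linarith
      obtain ⟨b1, b2⟩ := gegen_at_one_bound n (k + 1)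
      rw [← hν] at b1 b2
      have hpos : 0 ≤ (k + 1 + ν) / ν := by positivity
      rw [e, abs_of_nonneg (mul_nonneg hpos b1)]
      have h3 : (k + 1 + ν) / ν ≤ 2 * (k + 1 + 1) := by
        rw [div_le_iff₀ (by linarith)]
        nlinarith [(k.cast_nonneg : (0 : ℝ) ≤ k)]
      push_cast at *
      calc _ ≤ (2 * (k + 1 + 1)) * (k + 1 + 1 : ℝ) ^ n := mul_le_mul h3 b2 b1 (by positivity)
        _ = _ := by ring

theorem zonal_sup_bound (n : ℕ) : ∃ A : ℝ, 0 < A ∧ ∀ (k : ℕ) (x : ℝ), |x| ≤ 1 →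
    |zonal ((n : ℝ) / 2) k x| ≤ A * (k + 1 : ℝ) ^ n := by
  obtain ⟨A, hA, h⟩ := zonal_at_one_bound n
  exact ⟨A, hA, fun k x hx => (abs_zonal_le_abs_one (by positivity) k hx).trans (h k)⟩

/-! ### Decay away from the poles. -/

theorem sonin_energy_le {ν κ : ℝ} (hκ : 0 < κ) {u v : ℝ → ℝ}
    (hu : ∀ t ∈ Set.Ioo 0 Real.pi, HasDerivAt u (v t) t)
    (hv : ∀ t ∈ Set.Ioo 0 Real.pi,
      HasDerivAt v ((ν * (ν - 1) / Real.sin t ^ 2 - κ ^ 2) * u t) t)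
    {a t : ℝ} (ha : 0 < a) (hat : a ≤ t) (ht : t < Real.pi)
    (hsa : 1 / κ ≤ Real.sin a) (hst : 1 / κ ≤ Real.sin t) :
    v t ^ 2 + κ ^ 2 * u t ^ 2 ≤
      (v a ^ 2 + κ ^ 2 * u a ^ 2) * Real.exp (2 * |ν * (ν - 1)|) := by
  set c : ℝ := |ν * (ν - 1)| with hc
  have hc0 : 0 ≤ c := abs_nonneg _
  let E : ℝ → ℝ := fun t => v t ^ 2 + κ ^ 2 * u t ^ 2
  -- The energy E = v² + κ²u² has E' = 2ν(ν−1)uv/sin², and |E'| ≤ c/(κ sin²)·E because 2κ|uv| ≤ E.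
  -- As cot' = −1/sin², the exponential is an integrating factor that makes W nonincreasing; where
  -- sin ≥ 1/κ its exponent lies in [−c, c].
  let W : ℝ → ℝ := fun t => E t * Real.exp (c / κ * (Real.cos t / Real.sin t))
  have hW : ∀ t ∈ Set.Ioo 0 Real.pi, HasDerivAt W
      ((2 * (ν * (ν - 1)) / Real.sin t ^ 2 * (u t * v t) - c / κ / Real.sin t ^ 2 * E t) *
        Real.exp (c / κ * (Real.cos t / Real.sin t))) t := by
    intro t ht
    have hs : 0 < Real.sin t := Real.sin_pos_of_mem_Ioo ht
    have hE := ((hv t ht).fun_pow 2).fun_add (((hu t ht).fun_pow 2).const_mul (κ ^ 2))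
    have hx := ((((Real.hasDerivAt_cos t).fun_div (Real.hasDerivAt_sin t) hs.ne').const_mul
      (c / κ))).exp
    refine (hE.fun_mul hx).congr_deriv ?_
    have h2 : -Real.sin t * Real.sin t - Real.cos t * Real.cos t = -1 := by
      nlinarith [Real.sin_sq_add_cos_sq t]
    rw [h2]
    simp only [E]
    field_simp
    push_cast
    ring
  have hanti : AntitoneOn W (Set.Ioo 0 Real.pi) := by
    apply antitoneOn_of_deriv_nonpos (convex_Ioo _ _)
    · exact fun y hy => (hW y hy).continuousAt.continuousWithinAt
    · rw [interior_Ioo]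
      exact fun y hy => (hW y hy).differentiableAt.differentiableWithinAt
    · rw [interior_Ioo]
      intro y hy
      rw [(hW y hy).deriv]
      apply mul_nonpos_of_nonpos_of_nonneg _ (Real.exp_pos _).le
      have hs : 0 < Real.sin y := Real.sin_pos_of_mem_Ioo hy
      have h1 : 2 * (ν * (ν - 1)) * (u y * v y) ≤ c / κ * E y := by
        have h3 : (ν * (ν - 1)) * (u y * v y) ≤ c * |u y * v y| := by
          rw [hc, ← abs_mul]; exact le_abs_self _
        have h4 : 2 * κ * |u y * v y| ≤ E y := by
          rw [abs_mul]
          simp only [E]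
          nlinarith [sq_nonneg (|v y| - κ * |u y|), sq_abs (u y), sq_abs (v y)]
        rw [div_mul_eq_mul_div, le_div_iff₀ hκ]
        nlinarith
      have : 2 * (ν * (ν - 1)) / Real.sin y ^ 2 * (u y * v y) - c / κ / Real.sin y ^ 2 * E y
          = (2 * (ν * (ν - 1)) * (u y * v y) - c / κ * E y) / Real.sin y ^ 2 := by
        field_simp
      rw [this]
      exact div_nonpos_of_nonpos_of_nonneg (by linarith) (by positivity)
  have ha' : a ∈ Set.Ioo 0 Real.pi := ⟨ha, hat.trans_lt ht⟩
  have ht' : t ∈ Set.Ioo 0 Real.pi := ⟨ha.trans_le hat, ht⟩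
  have h := hanti ha' ht' hat
  have hcot : ∀ y, 1 / κ ≤ Real.sin y → |c / κ * (Real.cos y / Real.sin y)| ≤ c := by
    intro y hy
    have hs : 0 < Real.sin y := lt_of_lt_of_le (by positivity) hy
    rw [abs_mul, abs_of_nonneg (div_nonneg hc0 hκ.le), abs_div, abs_of_pos hs]
    have h1 : |Real.cos y| / Real.sin y ≤ κ := by
      rw [div_le_iff₀ hs]
      rw [div_le_iff₀ hκ] at hy
      linarith [Real.abs_cos_le_one y]
    calc c / κ * (|Real.cos y| / Real.sin y) ≤ c / κ * κ := by gcongr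
      _ = c := by field_simp
  have e1 : E t * Real.exp (-c) ≤ W t := by
    simp only [W]
    have := (abs_le.mp (hcot t hst)).1
    have hE0 : 0 ≤ E t := by simp only [E]; positivity
    gcongr
  have e2 : W a ≤ E a * Real.exp c := by
    simp only [W]
    have := (abs_le.mp (hcot a hsa)).2
    have hE0 : 0 ≤ E a := by simp only [E]; positivity
    gcongr
  have e3 := e1.trans (h.trans e2)
  calc E t = E t * Real.exp (-c) * Real.exp c := by rw [mul_assoc, ← Real.exp_add]; simp
    _ ≤ E a * Real.exp c * Real.exp c := by gcongr
    _ = E a * Real.exp (2 * c) := by rw [mul_assoc, ← Real.exp_add]; ring_nf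

theorem hasDerivAt_weighted_zonal (ν : ℝ) (k : ℕ) : ∀ y ∈ Set.Ioo 0 Real.pi,
    HasDerivAt (fun y => Real.sin y ^ ν * zonal ν (k + 1) (Real.cos y))
      (ν * Real.sin y ^ (ν - 1) * Real.cos y * zonal ν (k + 1) (Real.cos y)
        - Real.sin y ^ (ν + 1) * (2 * ((k + 1 + ν) * gegen (ν + 1) (k + 1) (Real.cos y)))) y := by
  intro y hy
  have hs : 0 < Real.sin y := Real.sin_pos_of_mem_Ioo hy
  have h1 := (Real.hasDerivAt_sin y).rpow_const (p := ν) (Or.inl hs.ne')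
  have h2 := (hasDerivAt_zonal' ν k (Real.cos y)).comp y (Real.hasDerivAt_cos y)
  refine (h1.fun_mul h2).congr_deriv ?_
  simp only [Function.comp]
  rw [Real.rpow_add_one hs.ne']
  ring

/-- Liouville normal form: the weight sin^ν removes the first-order term, so u(y) = sin^ν y · Z(cos
y) solves u'' = (ν(ν−1)/sin² − (k+1+ν)²)u. -/
theorem hasDerivAt_weighted_zonal_deriv (ν : ℝ) (k : ℕ) : ∀ y ∈ Set.Ioo 0 Real.pi,
    HasDerivAt (fun y => ν * Real.sin y ^ (ν - 1) * Real.cos y * zonal ν (k + 1) (Real.cos y)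
        - Real.sin y ^ (ν + 1) * (2 * ((k + 1 + ν) * gegen (ν + 1) (k + 1) (Real.cos y))))
      ((ν * (ν - 1) / Real.sin y ^ 2 - (k + 1 + ν) ^ 2) *
        (Real.sin y ^ ν * zonal ν (k + 1) (Real.cos y))) y := by
  intro y hy
  have hs : 0 < Real.sin y := Real.sin_pos_of_mem_Ioo hy
  have h1 := (Real.hasDerivAt_sin y).rpow_const (p := ν - 1) (Or.inl hs.ne')
  have h1' := (Real.hasDerivAt_sin y).rpow_const (p := ν + 1) (Or.inl hs.ne')
  have h2 := (hasDerivAt_zonal' ν k (Real.cos y)).comp y (Real.hasDerivAt_cos y)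
  have h3 := (hasDerivAt_zonal_deriv ν k (Real.cos y)).comp y (Real.hasDerivAt_cos y)
  have h4 := (((h1.const_mul ν).fun_mul (Real.hasDerivAt_cos y)).fun_mul h2).fun_sub (h1'.fun_mul h3)
  simp only [Function.comp] at h4
  simp only [← mul_assoc] at h4 ⊢
  refine h4.congr_deriv ?_
  have ode := zonal_ode ν k (Real.cos y)
  have hcs : Real.cos y ^ 2 = 1 - Real.sin y ^ 2 := by
    nlinarith [Real.sin_sq_add_cos_sq y]
  have p1 : Real.sin y ^ (ν - 1 - 1) = Real.sin y ^ ν / Real.sin y ^ 2 := by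
    rw [show ν - 1 - 1 = ν - 2 by ring, Real.rpow_sub hs, Real.rpow_two]
  have p2 : Real.sin y ^ (ν - 1) = Real.sin y ^ ν / Real.sin y := Real.rpow_sub_one hs.ne' ν
  have p3 : Real.sin y ^ (ν + 1) = Real.sin y ^ ν * Real.sin y := Real.rpow_add_one hs.ne' ν
  rw [add_sub_cancel_right, p1, p2, p3]
  clear h1 h1' h2 h3 h4 p1 p2 p3
  generalize Real.sin y ^ ν = S
  generalize zonal ν (k + 1) (Real.cos y) = Z at *
  generalize gegen (ν + 1) (k + 1) (Real.cos y) = G at *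
  generalize gegen (ν + 2) k (Real.cos y) = H at *
  generalize Real.cos y = co at *
  generalize Real.sin y = si at *
  field_simp
  linear_combination (S * si ^ 2) * ode +
    (S * si ^ 2 * 4 * (k + 1 + ν) * (ν + 1) * H + Z * ν * (ν - 1) * S) * hcs

set_option maxHeartbeats 1000000 in
/-- Pointwise decay away from the poles, by a Sonin-type energy argument. -/
theorem zonal_decay (n : ℕ) : ∃ C : ℝ, 0 < C ∧ ∀ (k : ℕ) (t : ℝ), 0 < t → t < Real.pi →
    |zonal ((n : ℝ) / 2) k (Real.cos t)| * Real.sin t ^ ((n : ℝ) / 2) ≤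
      C * (k + 1 : ℝ) ^ ((n : ℝ) / 2) := by
  obtain ⟨A, hA, hz⟩ := zonal_sup_bound n
  obtain ⟨A', hA', hz'⟩ := zonal_sup_bound (n + 2)
  set ν : ℝ := (n : ℝ) / 2 with hν
  have hν0 : 0 ≤ ν := by positivity
  have hν1 : ((n + 2 : ℕ) : ℝ) / 2 = ν + 1 := by rw [hν]; push_cast; ring
  have hn2 : ∀ y : ℝ, 0 ≤ y → y ^ n = (y ^ ν) ^ 2 := by
    intro y hy
    rw [← Real.rpow_natCast, ← Real.rpow_natCast, ← Real.rpow_mul hy, hν]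
    congr 1; push_cast; ring
  rw [hν1] at hz'
  set c : ℝ := |ν * (ν - 1)|
  -- κ^ν B majorises both |u| and |u'|/κ at the starting point t₀ below: the first summand serves u,
  -- the other two serve u'.
  set B : ℝ := A * 2 ^ n + ν * (A * 2 ^ n) + 2 * (ν + 1) * A' with hB
  have hBpos : 0 < B := by positivity
  set C₁ : ℝ := Real.sqrt (2 * B ^ 2 * Real.exp (2 * c)) + A * 2 ^ n with hC₁
  have hC₁pos : 0 < C₁ := by positivity
  refine ⟨C₁ * (1 + ν) ^ ν + A, by positivity, fun k t ht0 htpi => ?_⟩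
  have hst : 0 < Real.sin t := Real.sin_pos_of_mem_Ioo ⟨ht0, htpi⟩
  rcases k with _ | k
  · have h1 := hz 0 1 (by norm_num)
    have h2 : Real.sin t ^ ν ≤ 1 := Real.rpow_le_one hst.le (Real.sin_le_one t) hν0
    simp [zonal_zero] at h1 ⊢
    have : 0 < C₁ * (1 + ν) ^ ν := by positivity
    linarith
  set κ : ℝ := k + 1 + ν with hκdef
  have hk0 : (0 : ℝ) ≤ k := k.cast_nonneg
  have hκ1 : 1 ≤ κ := by linarith
  have hκ : 0 < κ := by linarith
  set a : ℝ := κ ^ ν with ha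
  have hapos : 0 < a := by positivity
  have hK1 : ((k + 1 : ℕ) + 1 : ℝ) ≤ 2 * κ := by push_cast; linarith
  have hK2 : κ ≤ (1 + ν) * ((k + 1 : ℕ) + 1 : ℝ) := by push_cast; nlinarith
  have haK : a ≤ (1 + ν) ^ ν * ((k + 1 : ℕ) + 1 : ℝ) ^ ν := by
    rw [← Real.mul_rpow (by positivity) (by positivity)]
    exact Real.rpow_le_rpow hκ.le hK2 hν0
  suffices hmain : |zonal ν (k + 1) (Real.cos t)| * Real.sin t ^ ν ≤ C₁ * a by
    refine hmain.trans ?_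
    calc C₁ * a ≤ C₁ * ((1 + ν) ^ ν * ((k + 1 : ℕ) + 1 : ℝ) ^ ν) := by gcongr
      _ ≤ _ := by
        have : 0 ≤ A * ((k + 1 : ℕ) + 1 : ℝ) ^ ν := by positivity
        linarith
  have hzb : ∀ y : ℝ, |zonal ν (k + 1) (Real.cos y)| ≤ A * 2 ^ n * a ^ 2 := by
    intro y
    refine (hz (k + 1) _ (Real.abs_cos_le_one y)).trans ?_
    rw [ha, ← hn2 κ hκ.le, mul_assoc, ← mul_pow]
    gcongr
  have hzb' : ∀ y : ℝ, |2 * (κ * gegen (ν + 1) (k + 1) (Real.cos y))| ≤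
      2 * (ν + 1) * A' * a ^ 2 * κ ^ 2 := by
    intro y
    have h1 := hz' k _ (Real.abs_cos_le_one y)
    rw [hκdef, ← mul_zonal_succ, ← mul_assoc, abs_mul, abs_of_pos (by positivity), ← hκdef]
    have h2 : (k + 1 : ℝ) ^ (n + 2) ≤ a ^ 2 * κ ^ 2 := by
      rw [ha, ← hn2 κ hκ.le, ← pow_add]
      gcongr; linarith
    calc 2 * (ν + 1) * |zonal (ν + 1) k (Real.cos y)|
        ≤ 2 * (ν + 1) * (A' * (k + 1 : ℝ) ^ (n + 2)) := by gcongr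
      _ ≤ 2 * (ν + 1) * (A' * (a ^ 2 * κ ^ 2)) := by gcongr
      _ = _ := by ring
  -- Close to the poles the uniform bound of order κ^(2ν), multiplied by sin^ν ≤ κ^(−ν), is enough.
  by_cases hcase : Real.sin t < 1 / κ
  · have h1 : Real.sin t ^ ν ≤ a⁻¹ := by
      rw [ha, ← Real.inv_rpow hκ.le, ← one_div]
      exact Real.rpow_le_rpow hst.le hcase.le hν0
    calc _ ≤ A * 2 ^ n * a ^ 2 * a⁻¹ := by
          gcongr
          exact hzb t
      _ = A * 2 ^ n * a := by field_simp
      _ ≤ C₁ * a := by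
          gcongr
          rw [hC₁]; linarith [Real.sqrt_nonneg (2 * B ^ 2 * Real.exp (2 * c))]
  push Not at hcase
  set u : ℝ → ℝ := fun y => Real.sin y ^ ν * zonal ν (k + 1) (Real.cos y) with hu_def
  set v : ℝ → ℝ := fun y => ν * Real.sin y ^ (ν - 1) * Real.cos y * zonal ν (k + 1) (Real.cos y)
    - Real.sin y ^ (ν + 1) * (2 * (κ * gegen (ν + 1) (k + 1) (Real.cos y))) with hv_def
  have hsin0 : Real.sin (Real.arcsin (1 / κ)) = 1 / κ :=
    Real.sin_arcsin (by have : 0 ≤ 1 / κ := by positivity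
                        linarith) (by rw [div_le_one hκ]; exact hκ1)
  -- The energy is started where sin t₀ = 1/κ. There the uniform bounds for Z and Z', of orders
  -- κ^(2ν) and κ^(2ν+2), yield u = O(κ^ν) and u' = O(κ^(ν+1)).
  set t₀ := Real.arcsin (1 / κ) with ht₀
  have ht₀pos : 0 < t₀ := Real.arcsin_pos.mpr (by positivity)
  have ht₀t : t₀ ≤ t := by
    rcases lt_or_ge t (Real.pi / 2) with h | h
    · rw [ht₀]
      exact (Real.arcsin_le_iff_le_sin' ⟨by linarith [Real.pi_pos], h⟩).mpr hcase
    · exact (Real.arcsin_le_pi_div_two _).trans h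
  have hE : v t ^ 2 + κ ^ 2 * u t ^ 2 ≤
      (v t₀ ^ 2 + κ ^ 2 * u t₀ ^ 2) * Real.exp (2 * |ν * (ν - 1)|) :=
    sonin_energy_le hκ (hasDerivAt_weighted_zonal ν k)
      (hasDerivAt_weighted_zonal_deriv ν k) ht₀pos ht₀t htpi hsin0.ge hcase
  have hsν : Real.sin t₀ ^ ν = a⁻¹ := by rw [hsin0, one_div, Real.inv_rpow hκ.le]
  have hsp : 0 < Real.sin t₀ := by rw [hsin0]; positivity
  have bu : |u t₀| ≤ B * a := by
    simp only [u]
    rw [abs_mul, hsν, abs_of_pos (by positivity)]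
    calc a⁻¹ * |zonal ν (k + 1) (Real.cos t₀)| ≤ a⁻¹ * (A * 2 ^ n * a ^ 2) := by
          gcongr; exact hzb t₀
      _ = A * 2 ^ n * a := by field_simp
      _ ≤ B * a := by
          gcongr
          have : 0 ≤ ν * (A * 2 ^ n) + 2 * (ν + 1) * A' := by positivity
          rw [hB]; linarith
  have bv : |v t₀| ≤ B * a * κ := by
    simp only [v]
    have p2 : Real.sin t₀ ^ (ν - 1) = a⁻¹ * κ := by
      rw [Real.rpow_sub_one hsp.ne', hsν, hsin0]; field_simp
    have p3 : Real.sin t₀ ^ (ν + 1) = a⁻¹ / κ := by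
      rw [Real.rpow_add_one hsp.ne', hsν, hsin0]; field_simp
    rw [p2, p3]
    refine (abs_sub _ _).trans ?_
    rw [abs_mul, abs_mul, abs_mul (a⁻¹ / κ), abs_of_nonneg (show 0 ≤ ν * (a⁻¹ * κ) by positivity),
      abs_of_nonneg (show 0 ≤ a⁻¹ / κ by positivity)]
    calc _ ≤ ν * (a⁻¹ * κ) * 1 * (A * 2 ^ n * a ^ 2) + a⁻¹ / κ * (2 * (ν + 1) * A' * a ^ 2 * κ ^ 2) := by
          gcongr
          · exact Real.abs_cos_le_one _
          · exact hzb t₀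
          · exact hzb' t₀
      _ = (ν * (A * 2 ^ n) + 2 * (ν + 1) * A') * a * κ := by field_simp
      _ ≤ B * a * κ := by
          gcongr
          have : 0 ≤ A * 2 ^ n := by positivity
          rw [hB]; linarith
  have bu2 : u t₀ ^ 2 ≤ (B * a) ^ 2 := sq_le_sq' (abs_le.mp bu).1 (abs_le.mp bu).2
  have bv2 : v t₀ ^ 2 ≤ (B * a * κ) ^ 2 := sq_le_sq' (abs_le.mp bv).1 (abs_le.mp bv).2
  have hfin : u t ^ 2 ≤ (2 * B ^ 2 * Real.exp (2 * c)) * a ^ 2 := by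
    have h1 : κ ^ 2 * u t ^ 2 ≤ κ ^ 2 * ((2 * B ^ 2 * Real.exp (2 * c)) * a ^ 2) := by
      calc κ ^ 2 * u t ^ 2 ≤ v t ^ 2 + κ ^ 2 * u t ^ 2 := by linarith [sq_nonneg (v t)]
        _ ≤ _ := hE
        _ ≤ ((B * a * κ) ^ 2 + κ ^ 2 * (B * a) ^ 2) * Real.exp (2 * c) := by gcongr
        _ = _ := by ring
    exact le_of_mul_le_mul_left h1 (by positivity)
  have habs : |u t| ≤ Real.sqrt (2 * B ^ 2 * Real.exp (2 * c)) * a := by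
    rw [← Real.sqrt_sq hapos.le, ← Real.sqrt_mul (by positivity)]
    exact Real.abs_le_sqrt hfin
  calc |zonal ν (k + 1) (Real.cos t)| * Real.sin t ^ ν = |u t| := by
        simp only [u]; rw [abs_mul, abs_of_pos (show 0 < Real.sin t ^ ν by positivity), mul_comm]
    _ ≤ _ := habs
    _ ≤ C₁ * a := by
        gcongr
        rw [hC₁]
        have : 0 ≤ A * 2 ^ n := by positivity
        linarith

/-! ### Divided differences -/

/-- Rolle's theorem iterated: the derivative has a zero strictly between consecutive zeros. -/
theorem exists_iteratedDeriv_eq_zero (m : ℕ) : ∀ (g : ℝ → ℝ) (x : ℕ → ℝ), ContDiff ℝ ∞ g →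
    (∀ i < m, x i < x (i + 1)) → (∀ i ≤ m, g (x i) = 0) → ∃ ξ, iteratedDeriv m g ξ = 0 := by
  induction m with
  | zero => exact fun g x _ _ h => ⟨x 0, by simpa using h 0 le_rfl⟩
  | succ m ih =>
    intro g x hg hx h0
    have hr : ∀ i, ∃ c, i ≤ m → c ∈ Set.Ioo (x i) (x (i + 1)) ∧ deriv g c = 0 := by
      intro i
      by_cases hi : i ≤ m
      · obtain ⟨c, hc⟩ := exists_deriv_eq_zero (hx i (by omega)) hg.continuous.continuousOn
          ((h0 i (by omega)).trans (h0 (i + 1) (by omega)).symm)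
        exact ⟨c, fun _ => hc⟩
      · exact ⟨0, fun h => absurd h hi⟩
    choose c hc using hr
    have hg' : ContDiff ℝ ∞ (deriv g) := by
      have := (contDiff_infty_iff_deriv (𝕜 := ℝ)).mp hg
      exact this.2
    obtain ⟨ξ, hξ⟩ := ih (deriv g) c hg' (fun i hi =>
      (hc i (by omega)).1.2.trans (hc (i + 1) (by omega)).1.1) (fun i hi => (hc i hi).2)
    exact ⟨ξ, by rw [iteratedDeriv_succ']; exact hξ⟩

theorem iteratedDeriv_polynomial (P : Polynomial ℝ) (m : ℕ) :
    iteratedDeriv m (fun w => P.eval w) = fun w => (Polynomial.derivative^[m] P).eval w := by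
  induction m with
  | zero => simp
  | succ m ih =>
    rw [iteratedDeriv_succ, ih]
    funext w
    rw [Polynomial.deriv, Function.iterate_succ_apply']

theorem iteratedDeriv_polynomial_of_natDegree_le {P : Polynomial ℝ} {m : ℕ}
    (hP : P.natDegree ≤ m) (w : ℝ) :
    iteratedDeriv m (fun w => P.eval w) w = m.factorial * P.coeff m := by
  rw [iteratedDeriv_polynomial]
  have h : Polynomial.derivative^[m] P = Polynomial.C (m.factorial * P.coeff m) := by
    have h1 : (Polynomial.derivative^[m] P).natDegree ≤ 0 :=
      (Polynomial.natDegree_iterate_derivative P m).trans (by omega)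
    rw [Polynomial.eq_C_of_natDegree_le_zero h1, Polynomial.coeff_iterate_derivative]
    simp [Nat.descFactorial_self]
  simp only [h, Polynomial.eval_C]

/-- The mean value property of the leading coefficient of an interpolation polynomial. -/
theorem exists_coeff_eq_iteratedDeriv {g : ℝ → ℝ} (hg : ContDiff ℝ ∞ g) {P : Polynomial ℝ}
    {m : ℕ} (hP : P.natDegree ≤ m) {x : ℕ → ℝ} (hx : ∀ i < m, x i < x (i + 1))
    (h : ∀ i ≤ m, P.eval (x i) = g (x i)) :
    ∃ ξ, m.factorial * P.coeff m = iteratedDeriv m g ξ := by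
  have hPc : ContDiff ℝ ∞ (fun w => P.eval w) := by
    simpa using P.contDiff_aeval (𝕜 := ℝ) (n := ∞)
  obtain ⟨ξ, hξ⟩ := exists_iteratedDeriv_eq_zero m (g - fun w => P.eval w) x (hg.sub hPc) hx
    (fun i hi => by simp [h i hi])
  refine ⟨ξ, ?_⟩
  rw [iteratedDeriv_sub (hg.contDiffAt.of_le (mod_cast le_top))
    (hPc.contDiffAt.of_le (mod_cast le_top)), iteratedDeriv_polynomial_of_natDegree_le hP] at hξ
  linarith

/-! ### Raising the dimension by summation by parts -/

/-- The multiplier in dimension parameter `ν + m` with the same kernel as `F` in parameter `ν`. -/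
noncomputable def raiseMul (ν : ℝ) (F : ℕ → ℝ) : ℕ → ℕ → ℝ
  | 0, k => F k
  | (m + 1), k => (ν + m + 1) * (raiseMul ν F m k - raiseMul ν F m (k + 2)) / (k + 1 + (ν + m))

theorem raiseMul_zero_eq (ν : ℝ) (F : ℕ → ℝ) (k : ℕ) : raiseMul ν F 0 k = F k := by
  simp [raiseMul]

theorem raiseMul_succ (ν : ℝ) (F : ℕ → ℝ) (m k : ℕ) : raiseMul ν F (m + 1) k =
    (ν + m + 1) * (raiseMul ν F m k - raiseMul ν F m (k + 2)) / (k + 1 + (ν + m)) := by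
  simp [raiseMul]

/-- The raised multiplier at k involves only F(k), F(k+2), …, F(k+2m), so a short support of F stays
short up to m + 1 shifts. -/
theorem raiseMul_ne_zero {ν : ℝ} {F : ℕ → ℝ} {m k : ℕ} (h : raiseMul ν F m k ≠ 0) :
    ∃ i ≤ m, F (k + 2 * i) ≠ 0 := by
  induction m generalizing k with
  | zero => exact ⟨0, le_rfl, by simpa [raiseMul_zero_eq] using h⟩
  | succ m ih =>
    rw [raiseMul_succ] at h
    by_cases h1 : raiseMul ν F m k = 0
    · have h2 : raiseMul ν F m (k + 2) ≠ 0 := fun h2 => h (by simp [h1, h2])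
      obtain ⟨i, hi, h3⟩ := ih h2
      exact ⟨i + 1, by omega, by rwa [show k + 2 * (i + 1) = k + 2 + 2 * i by ring]⟩
    · obtain ⟨i, hi, h3⟩ := ih h1
      exact ⟨i, by omega, h3⟩

theorem raiseMul_eq_zero {ν : ℝ} {F : ℕ → ℝ} {K : ℕ} (hF : ∀ k ≥ K, F k = 0) (m : ℕ) :
    ∀ k ≥ K, raiseMul ν F m k = 0 := by
  intro k hk
  by_contra h
  obtain ⟨i, _, h⟩ := raiseMul_ne_zero h
  exact h (hF _ (by omega))

/-- Abel summation with step two: `zonal ν k` is the difference of the Gegenbauer polynomials of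
parameter ν + 1 and degrees k and k − 2, and the vanishing of F from K on removes the boundary
terms. -/
theorem sum_mul_zonal_raise {ν : ℝ} (hν : 0 ≤ ν) {F : ℕ → ℝ} {K : ℕ} (hF : ∀ k ≥ K, F k = 0)
    (x : ℝ) : ∑ k ∈ Finset.range K, F k * zonal ν k x =
      ∑ k ∈ Finset.range K, ((ν + 1) * (F k - F (k + 2)) / (k + 1 + ν)) * zonal (ν + 1) k x := by
  have h1 : ∀ k : ℕ, ((ν + 1) * (F k - F (k + 2)) / (k + 1 + ν)) * zonal (ν + 1) k x =
      F k * gegen (ν + 1) (k + 1) x - F (k + 2) * gegen (ν + 1) (k + 1) x := by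
    intro k
    have := mul_zonal_succ ν k x
    have h : (0 : ℝ) < k + 1 + ν := by positivity
    field_simp
    linear_combination (F k - F (k + 2)) * this
  rw [Finset.sum_congr rfl fun k _ => h1 k, Finset.sum_sub_distrib]
  have h2 : ∀ K, ∑ k ∈ Finset.range K, F k * zonal ν k x =
      ∑ k ∈ Finset.range K, F k * gegen (ν + 1) (k + 1) x -
        ∑ k ∈ Finset.range (K - 1), F (k + 1) * gegen (ν + 1) k x := by
    intro K
    rcases K with _ | K
    · simp
    induction K with
    | zero => simp [zonal_zero, gegen_one]
    | succ K ih =>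
      rw [Finset.sum_range_succ, ih, Finset.sum_range_succ (fun k => F k * _) (K + 1),
        Nat.add_sub_cancel, Nat.add_sub_cancel,
        Finset.sum_range_succ (fun k => F (k + 1) * _) K, zonal_succ]
      ring
  rw [h2]
  congr 1
  rcases K with _ | _ | K
  · simp
  · simp [hF (0 + 2) (by omega)]
  · simp only [Nat.add_sub_cancel]
    rw [Finset.sum_range_succ', Finset.sum_range_succ _ (K + 1), Finset.sum_range_succ _ K]
    rw [hF (K + 2) (by omega), hF (K + 1 + 2) (by omega)]
    simp [gegen_zero]

theorem sum_mul_zonal_raiseMul {ν : ℝ} (hν : 0 ≤ ν) {F : ℕ → ℝ} {K : ℕ} (hF : ∀ k ≥ K, F k = 0)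
    (m : ℕ) (x : ℝ) : ∑ k ∈ Finset.range K, F k * zonal ν k x =
      ∑ k ∈ Finset.range K, raiseMul ν F m k * zonal (ν + m) k x := by
  induction m with
  | zero => simp [raiseMul_zero_eq]
  | succ m ih =>
    rw [ih, sum_mul_zonal_raise (by positivity) (raiseMul_eq_zero hF m)]
    refine Finset.sum_congr rfl fun k _ => ?_
    rw [raiseMul_succ]
    push_cast
    rw [add_assoc ν]

/-- The constants relating `raiseMul` to divided differences. -/
noncomputable def raiseConst (ν : ℝ) : ℕ → ℝ
  | 0 => 1
  | (m + 1) => -4 * (m + 1) * (ν + m + 1) * raiseConst ν m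

/-- Neville's recursion for interpolation at the nodes (k+2i)(k+2i+2ν). The distance from the first
to the last of m + 2 nodes is 4(m+1)(k+1+ν+m), which contains exactly the denominator in
`raiseMul_succ`; hence the raised multiplier is a fixed multiple of a divided difference. -/
theorem exists_interpolation {ν : ℝ} (hν : 0 ≤ ν) (F : ℕ → ℝ) (m : ℕ) : ∀ k : ℕ,
    ∃ P : Polynomial ℝ, P.natDegree ≤ m ∧ raiseMul ν F m k = raiseConst ν m * P.coeff m ∧
      ∀ i ≤ m, P.eval (((k + 2 * i : ℕ) : ℝ) * ((k + 2 * i : ℕ) + 2 * ν)) = F (k + 2 * i) := by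
  induction m with
  | zero =>
    intro k
    refine ⟨Polynomial.C (F k), by simp, by simp [raiseMul_zero_eq, raiseConst], ?_⟩
    intro i hi
    obtain rfl : i = 0 := by omega
    simp
  | succ m ih =>
    intro k
    obtain ⟨P, hPd, hPc, hPe⟩ := ih k
    obtain ⟨Q, hQd, hQc, hQe⟩ := ih (k + 2)
    set a : ℝ := (k : ℝ) * (k + 2 * ν) with ha
    set b : ℝ := ((k + 2 * (m + 1) : ℕ) : ℝ) * ((k + 2 * (m + 1) : ℕ) + 2 * ν) with hb
    have hba : b - a = 4 * (m + 1) * (k + 1 + (ν + m)) := by rw [ha, hb]; push_cast; ring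
    have hpos : 0 < b - a := by rw [hba]; positivity
    refine ⟨Polynomial.C (b - a)⁻¹ * ((Polynomial.X - Polynomial.C a) * Q -
      (Polynomial.X - Polynomial.C b) * P), ?_, ?_, ?_⟩
    · refine (Polynomial.natDegree_C_mul_le _ _).trans ((Polynomial.natDegree_sub_le _ _).trans ?_)
      refine max_le ?_ ?_
      · refine Polynomial.natDegree_mul_le.trans ?_
        rw [Polynomial.natDegree_X_sub_C]; omega
      · refine Polynomial.natDegree_mul_le.trans ?_
        rw [Polynomial.natDegree_X_sub_C]; omega
    · have hP0 : P.coeff (m + 1) = 0 :=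
        Polynomial.coeff_eq_zero_of_natDegree_lt (Nat.lt_succ_of_le hPd)
      have hQ0 : Q.coeff (m + 1) = 0 :=
        Polynomial.coeff_eq_zero_of_natDegree_lt (Nat.lt_succ_of_le hQd)
      rw [Polynomial.coeff_C_mul, Polynomial.coeff_sub, Polynomial.coeff_X_sub_C_mul,
        Polynomial.coeff_X_sub_C_mul, hP0, hQ0, raiseMul_succ, hPc, hQc, hba, raiseConst]
      have h1 : (0 : ℝ) < k + 1 + (ν + m) := by positivity
      have h2 : (0 : ℝ) < m + 1 := by positivity
      field_simp
      ring
    · intro i hi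
      simp only [Polynomial.eval_mul, Polynomial.eval_C, Polynomial.eval_sub, Polynomial.eval_X]
      set x : ℝ := ((k + 2 * i : ℕ) : ℝ) * ((k + 2 * i : ℕ) + 2 * ν) with hx
      have hP' : i ≤ m → P.eval x = F (k + 2 * i) := hPe i
      have hQ' : 1 ≤ i → Q.eval x = F (k + 2 * i) := by
        intro h1
        have := hQe (i - 1) (by omega)
        rw [show k + 2 + 2 * (i - 1) = k + 2 * i by omega] at this
        exact this
      rcases Nat.eq_zero_or_pos i with h0 | h0
      · have hxa : x = a := by rw [hx, ha, h0]; simp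
        rw [hP' (by omega), hxa]
        field_simp
        ring
      · rcases Nat.lt_or_ge m i with h1 | h1
        · have hxb : x = b := by rw [hx, hb, show i = m + 1 by omega]
          rw [hQ' h0, hxb]
          field_simp
          ring
        · rw [hP' h1, hQ' h0]
          field_simp
          ring

/-- The leading coefficient of the interpolation polynomial is g^(m)(ξ)/m!. Differentiation is in
the eigenvalue variable, which is why the bound does not depend on k. -/
theorem abs_raiseMul_le {ν : ℝ} (hν : 0 ≤ ν) {g : ℝ → ℝ} (hg : ContDiff ℝ ∞ g) {m : ℕ} {B : ℝ}
    (hB : ∀ w, |iteratedDeriv m g w| ≤ B) (k : ℕ) :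
    |raiseMul ν (fun k => g (k * (k + 2 * ν))) m k| ≤ |raiseConst ν m| * B := by
  obtain ⟨P, hP, hc, he⟩ := exists_interpolation hν (fun k => g (k * (k + 2 * ν))) m k
  obtain ⟨ξ, hξ⟩ := exists_coeff_eq_iteratedDeriv hg hP
    (x := fun i => ((k + 2 * i : ℕ) : ℝ) * ((k + 2 * i : ℕ) + 2 * ν)) (fun i _ => by
      push_cast
      have : (0 : ℝ) ≤ k := k.cast_nonneg
      have : (0 : ℝ) ≤ i := i.cast_nonneg
      nlinarith) he
  rw [hc, abs_mul]
  refine mul_le_mul_of_nonneg_left ?_ (abs_nonneg _)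
  have h1 : |(m.factorial : ℝ) * P.coeff m| ≤ B := by rw [hξ]; exact hB ξ
  rw [abs_mul, Nat.abs_cast] at h1
  have h2 : (1 : ℝ) ≤ m.factorial := mod_cast m.factorial_pos
  nlinarith [abs_nonneg (P.coeff m)]

/-! ### Counting eigenvalues -/

/-- For two indices a ≤ k in the window, (k − a)(k + a + n) is the difference of their eigenvalues,
at most 2l/2^j, while k + a + n ≥ √l when j ≥ 2. So k − a ≤ 2√l/2^j, and 4^j ≤ l absorbs the extra 1
in the count. -/
theorem exists_card_bound {n j : ℕ} {l : ℝ} (hl : (4 : ℝ) ^ j ≤ l) :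
    ∃ S : Finset ℕ, (S.card : ℝ) ≤ 3 * (Real.sqrt l / 2 ^ j) ∧
      ∀ k : ℕ, l * (1 - 2 / 2 ^ j) ≤ (k : ℝ) * (k + n) → (k : ℝ) * (k + n) < l → k ∈ S := by
  have hl0 : 0 < l := lt_of_lt_of_le (by positivity) hl
  set R := Real.sqrt l with hR
  have hR2 : R ^ 2 = l := Real.sq_sqrt hl0.le
  have hR0 : 0 < R := Real.sqrt_pos.mpr hl0
  set q : ℝ := 2 ^ j with hq
  have hq1 : 1 ≤ q := one_le_pow₀ (by norm_num)
  have hq4 : (4 : ℝ) ^ j = q ^ 2 := by rw [hq, ← pow_mul, mul_comm, pow_mul]; norm_num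
  have hqR : q ≤ R := by
    rw [hq4, ← hR2] at hl
    exact (sq_le_sq₀ (by positivity) hR0.le).mp hl
  have hh1 : 1 ≤ R / q := (one_le_div (by positivity)).mpr hqR
  classical
  by_cases hne : ∃ k : ℕ, l * (1 - 2 / q) ≤ (k : ℝ) * (k + n) ∧ (k : ℝ) * (k + n) < l
  swap
  · refine ⟨∅, by simp; positivity, fun k h1 h2 => absurd ⟨k, h1, h2⟩ hne⟩
  set a := Nat.find hne with ha
  have hamin : ∀ k : ℕ, l * (1 - 2 / q) ≤ (k : ℝ) * (k + n) → (k : ℝ) * (k + n) < l → a ≤ k :=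
    fun k h1 h2 => Nat.find_min' hne ⟨h1, h2⟩
  obtain ⟨ha1, ha2⟩ : l * (1 - 2 / q) ≤ (a : ℝ) * (a + n) ∧ (a : ℝ) * (a + n) < l := Nat.find_spec hne
  refine ⟨Finset.Icc a (a + ⌊2 * (R / q)⌋₊), ?_, fun k h1 h2 => ?_⟩
  · rw [Nat.card_Icc]
    have : (⌊2 * (R / q)⌋₊ : ℝ) ≤ 2 * (R / q) := Nat.floor_le (by positivity)
    rw [show a + ⌊2 * (R / q)⌋₊ + 1 - a = ⌊2 * (R / q)⌋₊ + 1 by omega]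
    push_cast
    linarith
  · have hak := hamin k h1 h2
    rw [Finset.mem_Icc]
    refine ⟨hak, ?_⟩
    suffices h : k - a ≤ ⌊2 * (R / q)⌋₊ by omega
    apply Nat.le_floor
    push_cast [hak]
    have ha0 : (0 : ℝ) ≤ a := a.cast_nonneg
    have hn0 : (0 : ℝ) ≤ n := n.cast_nonneg
    have hk0 : (0 : ℝ) ≤ k := k.cast_nonneg
    have hak' : (a : ℝ) ≤ k := mod_cast hak
    have hkR : (k : ℝ) < R := by
      by_contra hcon
      push Not at hcon
      nlinarith
    -- For j < 2 the lower end of the window carries no information, but k < √l ≤ 2√l/2^j already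
    -- suffices.
    rcases lt_or_ge j 2 with hj | hj
    · have hq2 : q ≤ 2 := by
        interval_cases j <;> simp [hq]
      have : R ≤ 2 * (R / q) := by
        rw [mul_div_assoc', le_div_iff₀ (by positivity)]; nlinarith
      linarith
    · have hq2 : 4 ≤ q := by
        calc (4 : ℝ) = 2 ^ 2 := by norm_num
          _ ≤ 2 ^ j := pow_le_pow_right₀ (by norm_num) hj
      have e1 : l * (1 - 2 / q) = R ^ 2 - 2 * R * (R / q) := by rw [← hR2]; field_simp
      rw [e1] at ha1 h1
      set h := R / q with hh
      have hhq : R = h * q := by rw [hh]; field_simp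
      have hhR : 4 * h ≤ R := by rw [hhq]; nlinarith
      -- If k + a + n < R, then a(a+n) ≤ (a + n/2)² < R²/4, against a(a+n) ≥ R² − 2Rh ≥ R²/2.
      have hbig : R ≤ k + a + n := by
        by_contra hcon
        push Not at hcon
        have h5 : (a : ℝ) * (a + n) ≤ ((2 * a + n) / 2) ^ 2 := by nlinarith
        have h6 : ((2 * a + n) / 2 : ℝ) ^ 2 < (R / 2) ^ 2 := by
          have : (0 : ℝ) ≤ (2 * a + n) / 2 := by positivity
          nlinarith
        nlinarith
      have h7 : ((k : ℝ) - a) * (k + a + n) ≤ 2 * R * h := by nlinarith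
      by_contra hcon
      push Not at hcon
      nlinarith

/-! ### Kernels of dyadic multipliers. -/

theorem zonal_decay_sqrt (n : ℕ) : ∃ C : ℝ, 0 < C ∧ ∀ (k : ℕ) (x : ℝ), |x| < 1 →
    |zonal ((n : ℝ) / 2) k x| * Real.sqrt (1 - x ^ 2) ^ ((n : ℝ) / 2) ≤
      C * (k + 1 : ℝ) ^ ((n : ℝ) / 2) := by
  obtain ⟨C, hC, h⟩ := zonal_decay n
  refine ⟨C, hC, fun k x hx => ?_⟩
  have hx' := abs_lt.mp hx
  have h1 := h k (Real.arccos x) (Real.arccos_pos.mpr hx'.2) (by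
    rcases (Real.arccos_le_pi x).lt_or_eq with h | h
    · exact h
    · rw [Real.arccos_eq_pi] at h; linarith)
  rwa [Real.cos_arccos hx'.1.le hx'.2.le, Real.sin_arccos] at h1

theorem exists_bound_iteratedDeriv {ψ : ℝ → ℝ} (hψ : ContDiff ℝ ∞ ψ) (hc : HasCompactSupport ψ)
    (m : ℕ) : ∃ B : ℝ, 0 < B ∧ ∀ w, |iteratedDeriv m ψ w| ≤ B := by
  have h1 : Continuous (iteratedFDeriv ℝ m ψ) := hψ.continuous_iteratedFDeriv (mod_cast le_top)
  obtain ⟨B, hB⟩ := h1.bounded_above_of_compact_support (hc.iteratedFDeriv m)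
  refine ⟨max B 1, by positivity, fun w => ?_⟩
  rw [← Real.norm_eq_abs, ← norm_iteratedFDeriv_eq_norm_iteratedDeriv]
  exact (hB w).trans (le_max_left _ _)

theorem iteratedDeriv_dilate {ψ : ℝ → ℝ} (hψ : ContDiff ℝ ∞ ψ) (m : ℕ) (q l w : ℝ) :
    |iteratedDeriv m (fun w => ψ (q * (1 - w / l))) w| =
      |q / l| ^ m * |iteratedDeriv m ψ (q * (1 - w / l))| := by
  have e : (fun w => ψ (q * (1 - w / l))) = fun w => (fun z => ψ (q - z)) (q / l * w) := by
    funext w; congr 1; ring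
  have hc : ContDiff ℝ ∞ (fun z => ψ (q - z)) := by fun_prop
  rw [e, iteratedDeriv_comp_const_mul (hc.of_le (mod_cast le_top)), iteratedDeriv_comp_const_sub]
  rw [abs_mul, abs_pow]
  simp only [smul_eq_mul, abs_mul, abs_pow, abs_neg, abs_one, one_pow, one_mul]
  congr 3; ring

/-- With h = √l/2^j, this says that the kernel is O(h √l^ν s^(−ν) (hs)^(−M)), where s = √(1 − x²).
After M summations by parts there are O(h) nonzero terms, each multiplier is O((2^j/l)^M), and each
zonal function is O((√l/s)^(ν+M)); the powers of 2^j and √l with exponent M cancel exactly against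
h^M. -/
theorem multiplier_kernel_bound (n M : ℕ) {ψ : ℝ → ℝ} (hψ : ContDiff ℝ ∞ ψ)
    (hsupp : ∀ w, ψ w ≠ 0 → 1 / 2 ≤ w ∧ w ≤ 2) :
    ∃ C : ℝ, 0 < C ∧ ∀ (j : ℕ) (l : ℝ), (4 : ℝ) ^ j ≤ l → ∀ K : ℕ,
      (∀ k ≥ K, ψ (2 ^ j * (1 - (k : ℝ) * (k + n) / l)) = 0) → ∀ x : ℝ, |x| < 1 →
      |∑ k ∈ Finset.range K, ψ (2 ^ j * (1 - (k : ℝ) * (k + n) / l)) * zonal ((n : ℝ) / 2) k x|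
        * Real.sqrt (1 - x ^ 2) ^ ((n : ℝ) / 2)
        * (Real.sqrt l / 2 ^ j * Real.sqrt (1 - x ^ 2)) ^ M ≤
      C * (Real.sqrt l / 2 ^ j) * Real.sqrt l ^ ((n : ℝ) / 2) := by
  have hcs : HasCompactSupport ψ := by
    refine HasCompactSupport.of_support_subset_isCompact (isCompact_Icc (a := 1 / 2) (b := 2)) ?_
    intro w hw
    exact hsupp w hw
  obtain ⟨B, hB, hBψ⟩ := exists_bound_iteratedDeriv hψ hcs M
  obtain ⟨C', hC', hz⟩ := zonal_decay_sqrt (n + 2 * M)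
  set ν : ℝ := (n : ℝ) / 2 with hν
  have hν0 : 0 ≤ ν := by positivity
  have hνM : ((n + 2 * M : ℕ) : ℝ) / 2 = ν + M := by rw [hν]; push_cast; ring
  have h2ν : 2 * ν = n := by rw [hν]; ring
  rw [hνM] at hz
  refine ⟨(M + 1) * 3 * ((|raiseConst ν M| + 1) * B) * (C' * 2 ^ (ν + M)), by positivity, ?_⟩
  intro j l hl K hK x hx
  obtain ⟨S, hScard, hS⟩ := exists_card_bound (n := n) hl
  have hl0 : 0 < l := lt_of_lt_of_le (by positivity) hl
  have hl1 : 1 ≤ l := le_trans (one_le_pow₀ (by norm_num)) hl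
  set R := Real.sqrt l with hR
  have hR2 : R ^ 2 = l := Real.sq_sqrt hl0.le
  have hR1 : 1 ≤ R := Real.one_le_sqrt.mpr hl1
  set q : ℝ := 2 ^ j with hq
  have hq0 : 0 < q := by positivity
  set s := Real.sqrt (1 - x ^ 2) with hs
  have hs0 : 0 < s := Real.sqrt_pos.mpr (by nlinarith [abs_lt.mp hx])
  set F : ℕ → ℝ := fun k => ψ (q * (1 - (k : ℝ) * (k + n) / l)) with hF
  have hFS : ∀ k, F k ≠ 0 → k ∈ S ∧ (k : ℝ) < R := by
    intro k hk
    obtain ⟨h1, h2⟩ := hsupp _ hk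
    have hlt : (k : ℝ) * (k + n) < l := by
      have : 0 < 1 - (k : ℝ) * (k + n) / l := by
        by_contra hcon
        push Not at hcon
        nlinarith
      rw [sub_pos, div_lt_one hl0] at this
      exact this
    refine ⟨hS k ?_ hlt, ?_⟩
    · have h3 : 1 - (k : ℝ) * (k + n) / l ≤ 2 / q := by
        rw [le_div_iff₀ hq0]; linarith
      have h4 : l * (1 - 2 / q) ≤ l * ((k : ℝ) * (k + n) / l) := by gcongr; linarith
      rwa [mul_div_cancel₀ _ hl0.ne'] at h4
    · by_contra hcon
      push Not at hcon
      have : (0 : ℝ) ≤ n := n.cast_nonneg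
      nlinarith
  classical
  -- T contains every index at which the raised multiplier is nonzero. Truncated subtraction does no
  -- harm, since only k with k + 2i in S matter.
  let T : Finset ℕ := (Finset.range (M + 1)).biUnion fun i => S.image (· - 2 * i)
  have hTcard : (T.card : ℝ) ≤ (M + 1) * (3 * (R / q)) := by
    have h1 : T.card ≤ (Finset.range (M + 1)).card * S.card :=
      Finset.card_biUnion_le_card_mul _ _ _ fun i _ => Finset.card_image_le
    rw [Finset.card_range] at h1
    calc (T.card : ℝ) ≤ ((M + 1) * S.card : ℕ) := mod_cast h1
      _ = (M + 1) * S.card := by push_cast; ring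
      _ ≤ _ := by gcongr
  have hterm : ∀ k, |raiseMul ν F M k * zonal (ν + M) k x| * s ^ (ν + M) ≤
      if k ∈ T then (|raiseConst ν M| * ((q / l) ^ M * B)) * (C' * (2 * R) ^ (ν + M)) else 0 := by
    intro k
    by_cases h0 : raiseMul ν F M k = 0
    · rw [h0, zero_mul, abs_zero, zero_mul]
      split_ifs <;> positivity
    · obtain ⟨i, hi, hFi⟩ := raiseMul_ne_zero h0
      obtain ⟨hiS, hiR⟩ := hFS _ hFi
      have hkT : k ∈ T := by
        rw [Finset.mem_biUnion]
        exact ⟨i, Finset.mem_range.mpr (by omega), Finset.mem_image.mpr ⟨_, hiS, by omega⟩⟩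
      rw [if_pos hkT, abs_mul, mul_assoc]
      have e1 : F = fun k : ℕ => (fun w => ψ (q * (1 - w / l))) (k * (k + 2 * ν)) := by
        funext k; simp only [hF, h2ν]
      have b1 : |raiseMul ν F M k| ≤ |raiseConst ν M| * ((q / l) ^ M * B) := by
        rw [e1]
        refine abs_raiseMul_le hν0 (g := fun w => ψ (q * (1 - w / l))) (by fun_prop) ?_ k
        intro w
        rw [iteratedDeriv_dilate hψ, abs_of_pos (div_pos hq0 hl0)]
        gcongr
        exact hBψ _
      have b2 : |zonal (ν + M) k x| * s ^ (ν + M) ≤ C' * (2 * R) ^ (ν + M) := by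
        refine (hz k x hx).trans ?_
        gcongr
        push_cast at hiR
        have : (0 : ℝ) ≤ i := i.cast_nonneg
        linarith
      exact mul_le_mul b1 b2 (by positivity) (by positivity)
  have hsum : |∑ k ∈ Finset.range K, F k * zonal ν k x| * s ^ (ν + M) ≤
      (M + 1) * (3 * (R / q)) * ((|raiseConst ν M| * ((q / l) ^ M * B)) * (C' * (2 * R) ^ (ν + M))) := by
    rw [sum_mul_zonal_raiseMul hν0 hK M]
    calc _ ≤ (∑ k ∈ Finset.range K, |raiseMul ν F M k * zonal (ν + M) k x|) * s ^ (ν + M) := by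
          gcongr; exact Finset.abs_sum_le_sum_abs _ _
      _ ≤ ∑ k ∈ Finset.range K, (if k ∈ T then
            (|raiseConst ν M| * ((q / l) ^ M * B)) * (C' * (2 * R) ^ (ν + M)) else 0) := by
          rw [Finset.sum_mul]; exact Finset.sum_le_sum fun k _ => hterm k
      _ ≤ T.card * ((|raiseConst ν M| * ((q / l) ^ M * B)) * (C' * (2 * R) ^ (ν + M))) := by
          rw [← Finset.sum_filter, Finset.sum_const, nsmul_eq_mul]
          gcongr
          intro k hk
          exact (Finset.mem_filter.mp hk).2
      _ ≤ _ := by gcongr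
  have e2 : s ^ (ν + M) = s ^ ν * s ^ M := Real.rpow_add_natCast hs0.ne' ν M
  have e3 : R ^ (ν + M) = R ^ ν * R ^ M := Real.rpow_add_natCast (by positivity) ν M
  rw [Real.mul_rpow (by norm_num) (by positivity), e3] at hsum
  rw [e2] at hsum
  calc _ = (|∑ k ∈ Finset.range K, F k * zonal ν k x| * (s ^ ν * s ^ M)) * (R / q) ^ M := by
        rw [mul_pow (R / q) s M]; ring
    _ ≤ _ := mul_le_mul_of_nonneg_right hsum (by positivity)
    _ = (M + 1) * 3 * (|raiseConst ν M| * B) * (C' * 2 ^ (ν + M)) * (R / q) * R ^ ν *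
          ((q / l) ^ M * R ^ M * (R / q) ^ M) := by ring
    _ = (M + 1) * 3 * (|raiseConst ν M| * B) * (C' * 2 ^ (ν + M)) * (R / q) * R ^ ν := by
        rw [← mul_pow, ← mul_pow, ← hR2]
        have : q / R ^ 2 * R * (R / q) = 1 := by field_simp
        rw [this, one_pow, mul_one]
    _ ≤ _ := by gcongr; linarith

/-! ### The Poisson kernel -/

theorem poisson_denom_pos {x r : ℝ} (hx : |x| ≤ 1) (hr : |r| < 1) : 0 < 1 - 2 * x * r + r ^ 2 := by
  have h1 : x * r ≤ |r| := by
    calc x * r ≤ |x * r| := le_abs_self _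
      _ = |x| * |r| := abs_mul _ _
      _ ≤ 1 * |r| := by gcongr
      _ = |r| := one_mul _
  nlinarith [sq_abs r]

/-- Polynomial growth of the coefficients permits termwise differentiation, and the three-term
recurrence turns into (1 − 2xy + y²)G' = 2μ(x − y)G for the sum G. Hence G(y)(1 − 2xy + y²)^μ is
constant, and it equals 1 at y = 0. -/
theorem hasSum_gegen (n : ℕ) {x r : ℝ} (hx : |x| ≤ 1) (hr : |r| < 1) :
    HasSum (fun k : ℕ => gegen ((n : ℝ) / 2 + 1) (k + 1) x * r ^ k)
      ((1 - 2 * x * r + r ^ 2) ^ (-((n : ℝ) / 2 + 1))) := by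
  obtain ⟨A, hA, hz⟩ := zonal_sup_bound (n + 2)
  set ν : ℝ := (n : ℝ) / 2 with hν
  have hν0 : 0 ≤ ν := by positivity
  have hν1 : ((n + 2 : ℕ) : ℝ) / 2 = ν + 1 := by rw [hν]; push_cast; ring
  rw [hν1] at hz
  set μ := ν + 1 with hμ
  set e : ℕ → ℝ := fun k => gegen μ k x with he
  have hb : ∀ k, |e (k + 1)| ≤ A * (k + 1 : ℝ) ^ (n + 2) := by
    intro k
    have h1 := mul_zonal_succ ν k x
    have h2 : |e (k + 1)| ≤ |zonal μ k x| := by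
      have h3 : μ * |zonal μ k x| = (k + 1 + ν) * |e (k + 1)| := by
        have h4 := congrArg abs h1
        rwa [abs_mul, abs_mul, abs_of_nonneg (show 0 ≤ ν + 1 by positivity),
          abs_of_nonneg (show 0 ≤ k + 1 + ν by positivity)] at h4
      have : (0 : ℝ) ≤ k := k.cast_nonneg
      nlinarith [abs_nonneg (e (k + 1)), abs_nonneg (zonal μ k x)]
    exact h2.trans (hz k x hx)
  obtain ⟨ρ, hρ1, hρ2⟩ := exists_between hr
  have hρ0 : 0 ≤ ρ := (abs_nonneg r).trans hρ1.le
  have hsumm : ∀ m : ℕ, Summable fun k : ℕ => ((k : ℝ) + 1) ^ m * ρ ^ k := by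
    intro m
    rcases hρ0.eq_or_lt with h0 | h0
    · exact absurd hρ1 (by rw [← h0]; exact not_lt.mpr (abs_nonneg r))
    have h1 := summable_pow_mul_geometric_of_norm_lt_one (R := ℝ) m
      (r := ρ) (by rwa [Real.norm_of_nonneg hρ0])
    have h2 := ((summable_nat_add_iff 1).mpr h1).mul_right ρ⁻¹
    refine h2.congr fun k => ?_
    push_cast; rw [pow_succ ρ]; field_simp
  have hsumG : ∀ y, |y| ≤ ρ → Summable fun k : ℕ => e (k + 1) * y ^ k := by
    intro y hy
    refine Summable.of_norm_bounded ((hsumm (n + 2)).mul_left A) fun k => ?_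
    rw [norm_mul, norm_pow, Real.norm_eq_abs, Real.norm_eq_abs, ← mul_assoc]
    gcongr
    exact hb k
  let G : ℝ → ℝ := fun y => ∑' k : ℕ, e (k + 1) * y ^ k
  let G' : ℝ → ℝ := fun y => ∑' k : ℕ, e (k + 1) * (k * y ^ (k - 1))
  have hsumG' : ∀ y ∈ Set.Ioo (-ρ) ρ, Summable fun k : ℕ => ((k : ℝ) + 1) * e (k + 2) * y ^ k := by
    intro y hy
    refine Summable.of_norm_bounded ((hsumm (n + 3)).mul_left (A * 2 ^ (n + 2))) fun k => ?_
    rw [norm_mul, norm_mul, norm_pow, Real.norm_eq_abs, Real.norm_eq_abs, Real.norm_eq_abs,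
      abs_of_nonneg (show (0 : ℝ) ≤ k + 1 by positivity)]
    have h1 := hb (k + 1)
    have h2 : A * ((k + 1 : ℕ) + 1 : ℝ) ^ (n + 2) ≤ A * 2 ^ (n + 2) * (k + 1 : ℝ) ^ (n + 2) := by
      rw [mul_assoc, ← mul_pow]
      gcongr
      push_cast
      linarith [(k.cast_nonneg : (0 : ℝ) ≤ k)]
    have h3 : |y| ≤ ρ := abs_le.mpr ⟨hy.1.le, hy.2.le⟩
    calc (k + 1 : ℝ) * |e (k + 2)| * |y| ^ k
        ≤ (k + 1) * (A * 2 ^ (n + 2) * (k + 1 : ℝ) ^ (n + 2)) * ρ ^ k := by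
          gcongr; exact h1.trans h2
      _ = _ := by ring
  have hG : ∀ y ∈ Set.Ioo (-ρ) ρ, HasDerivAt G (G' y) y := by
    intro y hy
    have hρpos : 0 < ρ := by linarith [hy.1, hy.2]
    refine hasDerivAt_tsum_of_isPreconnected (t := Set.Ioo (-ρ) ρ) (y₀ := 0)
      (g := fun k z => e (k + 1) * z ^ k) (g' := fun k z => e (k + 1) * (k * z ^ (k - 1)))
      (u := fun k : ℕ => A * (((k : ℝ) + 1) ^ (n + 3) * ρ ^ k) / ρ)
      (((hsumm (n + 3)).mul_left A).div_const ρ) isOpen_Ioo isPreconnected_Ioo ?_ ?_ ?_ ?_ hy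
    · intro k z _
      exact (hasDerivAt_pow k z).const_mul _
    · intro k z hz
      have h3 : |z| ≤ ρ := abs_le.mpr ⟨hz.1.le, hz.2.le⟩
      rw [norm_mul, norm_mul, norm_pow, Real.norm_eq_abs, Real.norm_eq_abs, Real.norm_eq_abs,
        Nat.abs_cast]
      rcases k with _ | k
      · simp; positivity
      · calc |e (k + 1 + 1)| * ((k + 1 : ℕ) * |z| ^ (k + 1 - 1))
            ≤ (A * ((k + 1 : ℕ) + 1 : ℝ) ^ (n + 2)) * (((k + 1 : ℕ) + 1 : ℝ) * ρ ^ k) := by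
              gcongr
              · exact hb (k + 1)
              · linarith
              · simpa using pow_le_pow_left₀ (abs_nonneg z) h3 k
          _ = _ := by rw [pow_succ ρ k]; field_simp; ring
    · exact ⟨by linarith, by linarith⟩
    · exact hsumG 0 (by simpa using hρ0)
  have hode : ∀ y ∈ Set.Ioo (-ρ) ρ,
      (1 - 2 * x * y + y ^ 2) * G' y = 2 * μ * (x - y) * G y := by
    intro y hy
    have h3 : |y| ≤ ρ := abs_le.mpr ⟨hy.1.le, hy.2.le⟩
    have s1 := hsumG' y hy
    have eG' : G' y = ∑' k : ℕ, ((k : ℝ) + 1) * e (k + 2) * y ^ k := by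
      have hs : Summable fun k : ℕ => e (k + 1) * (k * y ^ (k - 1)) := by
        rw [← summable_nat_add_iff 1]
        refine s1.congr fun k => ?_
        simp only [Nat.add_sub_cancel]; push_cast; ring
      simp only [G']
      rw [hs.tsum_eq_zero_add]
      simp only [Nat.cast_zero, zero_mul, mul_zero, zero_add]
      refine tsum_congr fun k => ?_
      simp only [Nat.add_sub_cancel]; push_cast; ring
    have hasG := (hsumG y h3).hasSum
    have hasG' := s1.hasSum
    rw [← eG'] at hasG'
    -- The value 0 of `gegen μ 0`, the polynomial of degree −1, makes the index shifts free of
    -- boundary terms.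
    have hA1 : HasSum (fun k : ℕ => e k * y ^ k) (y * G y) := by
      rw [← hasSum_nat_add_iff' 1]
      simp only [Finset.range_one, Finset.sum_singleton, he, gegen_zero, zero_mul, sub_zero]
      refine (hasG.mul_left y).congr_fun ?_
      intro k; simp only [he]; ring
    have hA2 : HasSum (fun k : ℕ => (k : ℝ) * e (k + 1) * y ^ k) (y * G' y) := by
      rw [← hasSum_nat_add_iff' 1]
      simp only [Finset.range_one, Finset.sum_singleton, Nat.cast_zero, zero_mul, sub_zero]
      refine (hasG'.mul_left y).congr_fun ?_
      intro k; push_cast; ring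
    have hA3 : HasSum (fun k : ℕ => ((k : ℝ) - 1) * e k * y ^ k) (y ^ 2 * G' y) := by
      rw [← hasSum_nat_add_iff' 1]
      simp only [Finset.range_one, Finset.sum_singleton, he, gegen_zero, mul_zero, zero_mul,
        sub_zero]
      rw [show y ^ 2 * G' y = y * (y * G' y) by ring]
      refine (hA2.mul_left y).congr_fun ?_
      intro k; simp only [he]; push_cast; ring
    have hA4 := (((hA2.add (hasG.mul_left μ)).mul_left (2 * x)).sub
      (hA3.add (hA1.mul_left (2 * μ))))
    have hA5 : HasSum (fun k : ℕ => ((k : ℝ) + 1) * e (k + 2) * y ^ k) _ := hA4.congr_fun (by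
      intro k
      have := gegen_rec μ k x
      simp only [he]
      rw [this]; ring)
    have := hasG'.unique hA5
    linear_combination this
  let H : ℝ → ℝ := fun y => G y * (1 - 2 * x * y + y ^ 2) ^ μ
  have hH : ∀ y ∈ Set.Ioo (-ρ) ρ, HasDerivAt H 0 y := by
    intro y hy
    have hy1 : |y| < 1 := (abs_lt.mpr ⟨hy.1, hy.2⟩).trans hρ2
    have hQ := poisson_denom_pos hx hy1
    have d1 : HasDerivAt (fun y => 1 - 2 * x * y + y ^ 2) (-(2 * x) + 2 * y) y := by
      have := (((hasDerivAt_id y).const_mul (2 * x)).const_sub 1).fun_add ((hasDerivAt_id y).fun_pow 2)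
      simpa using this
    have d2 := d1.rpow_const (p := μ) (Or.inl hQ.ne')
    refine ((hG y hy).fun_mul d2).congr_deriv ?_
    rw [Real.rpow_sub_one hQ.ne']
    have := hode y hy
    field_simp
    linear_combination ((1 - 2 * x * y + y ^ 2) ^ μ) * this
  have hrm : r ∈ Set.Ioo (-ρ) ρ := abs_lt.mp hρ1
  have h0m : (0 : ℝ) ∈ Set.Ioo (-ρ) ρ := ⟨by linarith [hrm.1, hrm.2], by linarith [hrm.1, hrm.2]⟩
  have hconst : H r = H 0 :=
    isOpen_Ioo.is_const_of_deriv_eq_zero isPreconnected_Ioo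
      (fun y hy => (hH y hy).differentiableAt.differentiableWithinAt)
      (fun y hy => (hH y hy).deriv) hrm h0m
  have hG0 : G 0 = 1 := by
    simp only [G]
    rw [tsum_eq_single 0 (by intro k hk; simp [hk])]
    simp [he, gegen_one]
  have hQ := poisson_denom_pos hx hr
  have hGr : G r = (1 - 2 * x * r + r ^ 2) ^ (-μ) := by
    simp only [H, hG0] at hconst
    rw [Real.rpow_neg hQ.le]
    refine eq_inv_of_mul_eq_one_left ?_
    rw [hconst]
    simp
  rw [← hGr]
  exact (hsumG r hρ1.le).hasSum

theorem hasSum_zonal (n : ℕ) {x r : ℝ} (hx : |x| ≤ 1) (hr : |r| < 1) :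
    HasSum (fun k : ℕ => zonal ((n : ℝ) / 2) k x * r ^ k)
      ((1 - r ^ 2) * (1 - 2 * x * r + r ^ 2) ^ (-((n : ℝ) / 2 + 1))) := by
  have hG := hasSum_gegen n hx hr
  set g := (1 - 2 * x * r + r ^ 2) ^ (-((n : ℝ) / 2 + 1))
  set ν : ℝ := (n : ℝ) / 2
  have h1 : HasSum (fun k : ℕ => gegen (ν + 1) k x * r ^ k) (r * g) := by
    rw [← hasSum_nat_add_iff' 1]
    simp only [Finset.range_one, Finset.sum_singleton, gegen_zero, zero_mul, sub_zero]
    refine (hG.mul_left r).congr_fun ?_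
    intro k; ring
  have h2 := (hasSum_nat_add_iff' 1).mpr hG
  rw [← hasSum_nat_add_iff' 1]
  simp only [Finset.range_one, Finset.sum_singleton, zonal_zero, gegen_one, pow_zero, mul_one,
    zero_add] at h2 ⊢
  have h3 := h2.sub (h1.mul_left r)
  rw [show (1 - r ^ 2) * g - 1 = g - 1 - r * (r * g) by ring]
  refine h3.congr_fun ?_
  intro k
  rw [zonal_succ]; ring

/-! ### Radial extensions and the surface measure. -/

theorem norm_coe_sphere {N : ℕ} (x : USphere N) : ‖(x : Ambient N)‖ = 1 :=
  mem_sphere_zero_iff_norm.mp x.2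

theorem coe_sphere_ne_zero {N : ℕ} (x : USphere N) : (x : Ambient N) ≠ 0 := by
  intro h
  have := norm_coe_sphere x
  simp [h] at this

theorem radialExt_coe {N : ℕ} (g : USphere N → ℝ) (x : USphere N) :
    radialExt g (x : Ambient N) = g x := by
  rw [radialExt, dif_neg (coe_sphere_ne_zero x)]
  congr 1
  ext1
  simp

theorem radialExt_smul_arg {N : ℕ} (g : USphere N → ℝ) {r : ℝ} (hr : 0 < r) (y : Ambient N) :
    radialExt g (r • y) = radialExt g y := by
  by_cases hy : y = 0
  · simp [hy]
  · rw [radialExt, dif_neg (smul_ne_zero hr.ne' hy), radialExt, dif_neg hy]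
    congr 1
    ext1
    simp only [norm_smul, Real.norm_of_nonneg hr.le, smul_smul]
    congr 1
    field_simp

theorem SmoothOnSphere.contDiffAt_infty {N : ℕ} {g : USphere N → ℝ} (hg : SmoothOnSphere g)
    {y : Ambient N} (hy : y ≠ 0) : ContDiffAt ℝ ∞ (radialExt g) y :=
  ContDiffOn.contDiffAt hg (isOpen_compl_singleton.mem_nhds hy)

theorem SmoothOnSphere.continuous {N : ℕ} {g : USphere N → ℝ} (hg : SmoothOnSphere g) :
    Continuous g := by
  have h : Continuous fun x : USphere N => radialExt g (x : Ambient N) :=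
    (ContDiffOn.continuousOn hg).comp_continuous continuous_subtype_val coe_sphere_ne_zero
  simpa only [radialExt_coe] using h

instance (N : ℕ) : IsFiniteMeasure (surfaceMeasure N) := by
  unfold surfaceMeasure; infer_instance

instance (N : ℕ) : (surfaceMeasure N).IsOpenPosMeasure := by
  unfold surfaceMeasure; infer_instance

theorem integrable_of_continuous {N : ℕ} {g : USphere N → ℝ} (hg : Continuous g) :
    Integrable g (surfaceMeasure N) :=
  hg.integrable_of_hasCompactSupport (HasCompactSupport.of_compactSpace g)

/-! ### Zonal functions are eigenfunctions -/

/-- Reduces the diagonal second derivatives in the Laplacian to calculus in one variable along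
lines. -/
theorem iteratedFDeriv_two_of_line {E : Type*} [NormedAddCommGroup E] [NormedSpace ℝ E]
    {f : E → ℝ} {y v : E} (hf : ContDiffAt ℝ 2 f y) {h' : ℝ → ℝ} {h'' : ℝ}
    (h1 : ∀ᶠ t in 𝓝 (0 : ℝ), HasDerivAt (fun t => f (y + t • v)) (h' t) t)
    (h2 : HasDerivAt h' h'' 0) : iteratedFDeriv ℝ 2 f y ![v, v] = h'' := by
  rw [iteratedFDeriv_two_apply]
  have hd : ∀ᶠ z in 𝓝 y, DifferentiableAt ℝ f z :=
    (hf.eventually (by simp)).mono fun z hz => hz.differentiableAt (by simp)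
  have hline : ContinuousAt (fun t : ℝ => y + t • v) 0 := by fun_prop
  have hd' : ∀ᶠ t in 𝓝 (0 : ℝ), DifferentiableAt ℝ f (y + t • v) :=
    hline.eventually (by simpa using hd)
  have hlineD : ∀ t : ℝ, HasDerivAt (fun t : ℝ => y + t • v) v t := by
    intro t
    simpa using ((hasDerivAt_id t).smul_const v).const_add y
  have he : h' =ᶠ[𝓝 0] fun t => fderiv ℝ f (y + t • v) v := by
    filter_upwards [h1, hd'] with t ht hdt
    have h4 : HasDerivAt (fun t => f (y + t • v)) (fderiv ℝ f (y + t • v) v) t :=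
      HasFDerivAt.comp_hasDerivAt t hdt.hasFDerivAt (hlineD t)
    exact ht.unique h4
  have hf2 : DifferentiableAt ℝ (fderiv ℝ f) (y + (0 : ℝ) • v) := by
    have : ContDiffAt ℝ 1 (fderiv ℝ f) y := hf.fderiv_right (by norm_num)
    simpa using this.differentiableAt (by simp)
  have h3 : HasDerivAt (fun t : ℝ => fderiv ℝ f (y + t • v))
      (fderiv ℝ (fderiv ℝ f) (y + (0 : ℝ) • v) v) 0 :=
    HasFDerivAt.comp_hasDerivAt (0 : ℝ) hf2.hasFDerivAt (hlineD 0)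
  have h3' : HasDerivAt (fun t : ℝ => fderiv ℝ f (y + t • v) v)
      (fderiv ℝ (fderiv ℝ f) (y + (0 : ℝ) • v) v v) 0 := by
    simpa using h3.clm_apply (hasDerivAt_const (0 : ℝ) v)
  have h4 := h3'.unique (h2.congr_of_eventuallyEq he.symm)
  rw [zero_smul, add_zero] at h4
  exact h4

theorem exists_zonal_derivs (n k : ℕ) : ∃ d d' : ℝ → ℝ,
    (∀ t, HasDerivAt (zonal ((n : ℝ) / 2) k) (d t) t) ∧ (∀ t, HasDerivAt d (d' t) t) ∧
    ∀ t, (1 - t ^ 2) * d' t - (n + 1) * t * d t + k * (k + n) * zonal ((n : ℝ) / 2) k t = 0 := by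
  rcases k with _ | k
  · refine ⟨fun _ => 0, fun _ => 0, fun t => ?_, fun t => hasDerivAt_const _ _, fun t => by simp⟩
    rw [funext (zonal_zero _)]
    exact hasDerivAt_const _ _
  · refine ⟨_, _, hasDerivAt_zonal' _ k, hasDerivAt_zonal_deriv _ k, fun t => ?_⟩
    have := zonal_ode ((n : ℝ) / 2) k t
    push_cast
    linear_combination this

theorem hasDerivAt_sphere_line {a b c t : ℝ} (hp : 0 < 1 + 2 * t * c + t ^ 2) :
    HasDerivAt (fun t => (a + t * b) / Real.sqrt (1 + 2 * t * c + t ^ 2))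
      (b / Real.sqrt (1 + 2 * t * c + t ^ 2) -
        (a + t * b) * (c + t) / Real.sqrt (1 + 2 * t * c + t ^ 2) ^ 3) t := by
  have h1 : HasDerivAt (fun t : ℝ => 1 + 2 * t * c + t ^ 2) (2 * c + 2 * t) t := by
    have := (((hasDerivAt_id t).const_mul 2).mul_const c).const_add 1 |>.fun_add
      ((hasDerivAt_id t).fun_pow 2)
    simpa using this
  have h2 := h1.sqrt hp.ne'
  have h3 : HasDerivAt (fun t : ℝ => a + t * b) b t := by
    simpa using ((hasDerivAt_id t).mul_const b).const_add a
  have hs : 0 < Real.sqrt (1 + 2 * t * c + t ^ 2) := Real.sqrt_pos.mpr hp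
  refine (h3.fun_div h2 hs.ne').congr_deriv ?_
  field_simp

theorem hasDerivAt_sphere_line_deriv {a b c : ℝ} :
    HasDerivAt (fun t => b / Real.sqrt (1 + 2 * t * c + t ^ 2) -
        (a + t * b) * (c + t) / Real.sqrt (1 + 2 * t * c + t ^ 2) ^ 3)
      (-2 * b * c + a * (3 * c ^ 2 - 1)) 0 := by
  have h1 : HasDerivAt (fun t : ℝ => 1 + 2 * t * c + t ^ 2) (2 * c) 0 := by
    have := (((hasDerivAt_id (0 : ℝ)).const_mul 2).mul_const c).const_add 1 |>.fun_add
      ((hasDerivAt_id (0 : ℝ)).fun_pow 2)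
    simpa using this
  have h2 := h1.sqrt (by simp)
  have h3 : HasDerivAt (fun t : ℝ => a + t * b) b 0 := by
    simpa using ((hasDerivAt_id (0 : ℝ)).mul_const b).const_add a
  have h4 : HasDerivAt (fun t : ℝ => c + t) 1 0 := (hasDerivAt_id (0 : ℝ)).const_add c
  have h5 := ((hasDerivAt_const (0 : ℝ) b).fun_div h2 (by simp)).fun_sub
    ((h3.fun_mul h4).fun_div (h2.fun_pow 3) (by simp))
  refine h5.congr_deriv ?_
  simp
  ring

/-- The radial extension is φ(⟪x, y⟫/‖y‖). Its second derivatives along the coordinate lines through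
a point of the sphere are explicit, and their sum is the Gegenbauer operator applied to φ. -/
theorem zonal_mem_sphericalHarmonics (n k : ℕ) (x : USphere (n + 1)) :
    (fun y : USphere (n + 1) => zonal ((n : ℝ) / 2) k (inner ℝ (x : Ambient (n + 1)) y)) ∈
      sphericalHarmonics (n + 1) k := by
  set φ := zonal ((n : ℝ) / 2) k with hφ
  set g : USphere (n + 1) → ℝ := fun y => φ (inner ℝ (x : Ambient (n + 1)) y) with hg
  have hext : ∀ y : Ambient (n + 1), y ≠ 0 →
      radialExt g y = φ (inner ℝ (x : Ambient (n + 1)) y / ‖y‖) := by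
    intro y hy
    rw [radialExt, dif_neg hy]
    simp only [hg, inner_smul_right]
    congr 1
    field_simp
  have hsm : SmoothOnSphere g := by
    refine ContDiffOn.congr (f := fun y => φ (inner ℝ (x : Ambient (n + 1)) y / ‖y‖)) ?_ hext
    refine (contDiff_zonal _ k).comp_contDiffOn ?_
    refine ContDiffOn.div (contDiff_const.inner ℝ contDiff_id).contDiffOn ?_ ?_
    · exact fun y hy => (contDiffAt_norm ℝ hy).contDiffWithinAt
    · exact fun y hy => norm_ne_zero_iff.mpr hy
  refine ⟨hsm, fun y => ?_⟩
  obtain ⟨d, d', hd, hd', hode⟩ := exists_zonal_derivs n k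
  set e := EuclideanSpace.basisFun (Fin (n + 1 + 1)) ℝ with he
  set a : ℝ := inner ℝ (x : Ambient (n + 1)) y with ha
  have hy1 := norm_coe_sphere y
  have hx1 := norm_coe_sphere x
  have hline : ∀ i, iteratedFDeriv ℝ 2 (radialExt g) (y : Ambient (n + 1)) ![e i, e i] =
      d' a * (inner ℝ (x : Ambient (n + 1)) (e i) - a * inner ℝ (y : Ambient (n + 1)) (e i)) ^ 2 +
      d a * (-2 * inner ℝ (x : Ambient (n + 1)) (e i) * inner ℝ (y : Ambient (n + 1)) (e i) +
        a * (3 * inner ℝ (y : Ambient (n + 1)) (e i) ^ 2 - 1)) := by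
    intro i
    set b : ℝ := inner ℝ (x : Ambient (n + 1)) (e i)
    set c : ℝ := inner ℝ (y : Ambient (n + 1)) (e i) with hc
    have hei : ‖e i‖ = 1 := e.norm_eq_one i
    have hnorm : ∀ t : ℝ, ‖(y : Ambient (n + 1)) + t • e i‖ = Real.sqrt (1 + 2 * t * c + t ^ 2) := by
      intro t
      rw [← Real.sqrt_sq (norm_nonneg _), @norm_add_sq_real]
      congr 1
      rw [hy1, norm_smul, hei, inner_smul_right, ← hc]
      rw [mul_one, Real.norm_eq_abs, sq_abs]
      ring
    have hcont : ContinuousAt (fun t : ℝ => 1 + 2 * t * c + t ^ 2) 0 := by fun_prop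
    have hpos : ∀ᶠ t in 𝓝 (0 : ℝ), 0 < 1 + 2 * t * c + t ^ 2 :=
      hcont.eventually (by simpa using lt_mem_nhds (zero_lt_one (α := ℝ)))
    have hval : ∀ t : ℝ, 0 < 1 + 2 * t * c + t ^ 2 → radialExt g ((y : Ambient (n + 1)) + t • e i) =
        φ ((a + t * b) / Real.sqrt (1 + 2 * t * c + t ^ 2)) := by
      intro t ht
      rw [hext, hnorm]
      · rw [inner_add_right, inner_smul_right]
      · rw [← norm_ne_zero_iff, hnorm]
        exact (Real.sqrt_pos.mpr ht).ne'
    let q : ℝ → ℝ := fun t => (a + t * b) / Real.sqrt (1 + 2 * t * c + t ^ 2)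
    let q' : ℝ → ℝ := fun t => b / Real.sqrt (1 + 2 * t * c + t ^ 2) -
        (a + t * b) * (c + t) / Real.sqrt (1 + 2 * t * c + t ^ 2) ^ 3
    have hq0 : q 0 = a := by simp [q]
    have hq'0 : q' 0 = b - a * c := by simp [q']
    refine (iteratedFDeriv_two_of_line (hsm.contDiffAt y) (h' := fun t => d (q t) * q' t)
      (h'' := d' a * (b - a * c) ^ 2 + d a * (-2 * b * c + a * (3 * c ^ 2 - 1))) ?_ ?_)
    · filter_upwards [hpos.eventually_nhds] with t ht
      have h1 : HasDerivAt (fun t => φ (q t)) (d (q t) * q' t) t :=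
        (hd (q t)).comp t (hasDerivAt_sphere_line ht.self_of_nhds)
      exact h1.congr_of_eventuallyEq (ht.mono fun s hs => hval s hs)
    · have h1 : HasDerivAt (fun t => d (q t)) (d' (q 0) * q' 0) 0 :=
        (hd' (q 0)).comp 0 (hasDerivAt_sphere_line (by simp))
      refine (h1.fun_mul hasDerivAt_sphere_line_deriv).congr_deriv ?_
      change d' (q 0) * q' 0 * q' 0 + d (q 0) * _ = _
      rw [hq0, hq'0]
      ring
  have hsum1 : ∑ i, inner ℝ (x : Ambient (n + 1)) (e i) ^ 2 = 1 := by
    have := e.sum_sq_norm_inner_left (x : Ambient (n + 1))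
    simpa [hx1] using this
  have hsum2 : ∑ i, inner ℝ (y : Ambient (n + 1)) (e i) ^ 2 = 1 := by
    have := e.sum_sq_norm_inner_left (y : Ambient (n + 1))
    simpa [hy1] using this
  have hsum3 : ∑ i, inner ℝ (x : Ambient (n + 1)) (e i) * inner ℝ (y : Ambient (n + 1)) (e i) = a := by
    have := e.sum_inner_mul_inner (x : Ambient (n + 1)) y
    rw [ha, ← this]
    exact Finset.sum_congr rfl fun i _ => by rw [real_inner_comm (e i) (y : Ambient (n + 1))]
  -- The three Parseval sums above evaluate the trace; the constant term is counted n + 2 times,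
  -- once for each ambient coordinate.
  have hlap : laplaceBeltrami g y = (1 - a ^ 2) * d' a - (n + 1) * a * d a := by
    rw [laplaceBeltrami, InnerProductSpace.laplacian_eq_iteratedFDeriv_orthonormalBasis _ e]
    simp only [hline]
    have : ∀ i, d' a * (inner ℝ (x : Ambient (n + 1)) (e i) - a * inner ℝ (y : Ambient (n + 1)) (e i)) ^ 2 +
      d a * (-2 * inner ℝ (x : Ambient (n + 1)) (e i) * inner ℝ (y : Ambient (n + 1)) (e i) +
        a * (3 * inner ℝ (y : Ambient (n + 1)) (e i) ^ 2 - 1)) =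
        d' a * inner ℝ (x : Ambient (n + 1)) (e i) ^ 2
        + (d' a * a ^ 2 + 3 * d a * a) * inner ℝ (y : Ambient (n + 1)) (e i) ^ 2
        + (-2 * a * d' a - 2 * d a) *
          (inner ℝ (x : Ambient (n + 1)) (e i) * inner ℝ (y : Ambient (n + 1)) (e i)) - d a * a := by
      intro i; ring
    simp only [this]
    rw [Finset.sum_sub_distrib, Finset.sum_add_distrib, Finset.sum_add_distrib, ← Finset.mul_sum,
      ← Finset.mul_sum, ← Finset.mul_sum, hsum1, hsum2, hsum3]
    simp only [Finset.sum_const, Finset.card_univ, Fintype.card_fin, nsmul_eq_mul]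
    push_cast
    ring
  rw [hlap, eigval]
  have := hode a
  simp only [hg, ← ha]
  rw [← hφ] at this
  push_cast
  linear_combination -this

/-! ### Green's formula and orthogonality of the eigenspaces. -/

theorem integral_fderiv_eq_zero {E : Type*} [NormedAddCommGroup E] [NormedSpace ℝ E]
    [MeasurableSpace E] [BorelSpace E] [FiniteDimensional ℝ E] (μ : Measure E)
    [μ.IsAddHaarMeasure] {w : E → ℝ} (hw : ContDiff ℝ 1 w) (hc : HasCompactSupport w) (v : E) :
    ∫ x, fderiv ℝ w x v ∂μ = 0 := by
  have h1 : Integrable (fun x => fderiv ℝ w x v) μ := by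
    have hcont : Continuous fun x => fderiv ℝ w x v :=
      (hw.continuous_fderiv (by simp)).clm_apply continuous_const
    exact hcont.integrable_of_hasCompactSupport (hc.fderiv_apply (𝕜 := ℝ) v)
  have h2 := integral_mul_fderiv_eq_neg_fderiv_mul_of_integrable (μ := μ) (f := fun _ => (1 : ℝ))
    (g := w) (v := v) (by simp) (by simpa using h1)
    (by simpa using hw.continuous.integrable_of_hasCompactSupport hc)
    (fun x _ => by fun_prop) (fun x _ => hw.contDiffAt.differentiableAt (by simp))
  simpa using h2

/-- Integration in polar coordinates of a function that splits. -/
theorem integral_polar {N : ℕ} {F : Ambient N → ℝ} {a : USphere N → ℝ} {b : ℝ → ℝ}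
    (hF : ∀ (w : USphere N) (r : ℝ), 0 < r → F (r • (w : Ambient N)) = a w * b r) :
    ∫ y, F y = (∫ w, a w ∂surfaceMeasure N) *
      ∫ r : Set.Ioi (0 : ℝ), b r ∂Measure.volumeIoiPow (Module.finrank ℝ (Ambient N) - 1) := by
  have h1 := (Measure.measurePreserving_homeomorphUnitSphereProd
    (volume : Measure (Ambient N))).integral_comp (Homeomorph.measurableEmbedding _)
    (fun z => a z.1 * b z.2)
  rw [integral_prod_mul (fun w => a w) (fun r : Set.Ioi (0 : ℝ) => b r)] at h1
  rw [surfaceMeasure, ← h1]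
  have h2 : ∀ y : ({0}ᶜ : Set (Ambient N)),
      a (homeomorphUnitSphereProd (Ambient N) y).1 * b (homeomorphUnitSphereProd (Ambient N) y).2 = F y := by
    intro y
    set z := homeomorphUnitSphereProd (Ambient N) y with hz
    have hy : y = (homeomorphUnitSphereProd (Ambient N)).symm z := by rw [hz]; simp
    rw [← hF z.1 z.2 z.2.2, hy, homeomorphUnitSphereProd_symm_apply_coe]
  simp only [h2]
  rw [integral_subtype_comap (measurableSet_singleton _).compl, restrict_compl_singleton]

theorem laplacian_radialExt_smul {N : ℕ} {g : USphere N → ℝ} {r : ℝ} (hr : 0 < r)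
    (x : Ambient N) :
    Laplacian.laplacian (radialExt g) (r • x) = r⁻¹ ^ 2 * Laplacian.laplacian (radialExt g) x := by
  have h1 : ∀ y, fderiv ℝ (radialExt g) y = r • fderiv ℝ (radialExt g) (r • y) := by
    intro y
    rw [← fderiv_comp_smul]
    congr 1
    funext z
    exact (radialExt_smul_arg g hr z).symm
  have h2 : ∀ y, fderiv ℝ (fderiv ℝ (radialExt g)) y =
      r • r • fderiv ℝ (fderiv ℝ (radialExt g)) (r • y) := by
    intro y
    conv_lhs => rw [funext h1]
    rw [← fderiv_comp_smul]
    exact congrFun (fderiv_const_smul_field (𝕜 := ℝ)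
      (f := fun y => fderiv ℝ (radialExt g) (r • y)) r) y
  set e := EuclideanSpace.basisFun (Fin (N + 1)) ℝ
  rw [InnerProductSpace.laplacian_eq_iteratedFDeriv_orthonormalBasis _ e]
  simp only [Finset.mul_sum, iteratedFDeriv_two_apply]
  refine Finset.sum_congr rfl fun i _ => ?_
  rw [h2 x]
  simp only [smul_apply, smul_eq_mul]
  field_simp

theorem fderiv_radialExt_self {N : ℕ} {g : USphere N → ℝ} (hg : SmoothOnSphere g)
    {x : Ambient N} (hx : x ≠ 0) : fderiv ℝ (radialExt g) x x = 0 := by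
  have h1 : HasDerivAt (fun t : ℝ => (1 + t) • x) x 0 := by
    simpa using ((hasDerivAt_id (0 : ℝ)).const_add 1).smul_const x
  have hd : DifferentiableAt ℝ (radialExt g) ((1 + (0 : ℝ)) • x) := by
    have := (hg.contDiffAt_infty hx).differentiableAt (by simp)
    simpa using this
  have h2 : HasDerivAt (fun t : ℝ => radialExt g ((1 + t) • x))
      (fderiv ℝ (radialExt g) ((1 + (0 : ℝ)) • x) x) 0 := by
    have := HasFDerivAt.comp_hasDerivAt (f := fun t : ℝ => (1 + t) • x) (0 : ℝ) hd.hasFDerivAt h1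
    exact this
  have h3 : (fun t : ℝ => radialExt g ((1 + t) • x)) =ᶠ[𝓝 0] fun _ => radialExt g x := by
    filter_upwards [lt_mem_nhds (show (-1 : ℝ) < 0 by norm_num)] with t ht
    exact radialExt_smul_arg g (by linarith) x
  have h4 := h2.unique ((hasDerivAt_const (0 : ℝ) (radialExt g x)).congr_of_eventuallyEq h3)
  simpa using h4

/-- Green's formula transferred from the ambient space. The compactly supported field κ(‖x‖²)(H∇G −
G∇H) has divergence of integral zero; radial extensions have no radial derivative, so the cutoff
contributes nothing. Polar coordinates then factor the integral into the spherical one and a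
positive radial one. -/
theorem integral_laplaceBeltrami_mul {N : ℕ} {g h : USphere N → ℝ} (hg : SmoothOnSphere g)
    (hh : SmoothOnSphere h) :
    ∫ x, (laplaceBeltrami g x * h x - g x * laplaceBeltrami h x) ∂surfaceMeasure N = 0 := by
  let χ : ContDiffBump (2 : ℝ) := ⟨1 / 2, 1, by norm_num, by norm_num⟩
  have hle2 : (2 : WithTop ℕ∞) ≤ ∞ := WithTop.coe_le_coe.mpr le_top
  set G := radialExt g with hG
  set H := radialExt h with hH
  have hχ0 : ∀ u : ℝ, u ≤ 1 → χ u = 0 := by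
    intro u hu
    apply χ.zero_of_le_dist
    rw [Real.dist_eq]
    change (1 : ℝ) ≤ _
    rw [abs_sub_comm]; exact le_trans (by linarith) (le_abs_self _)
  have hχ3 : ∀ u : ℝ, 3 ≤ u → χ u = 0 := by
    intro u hu
    apply χ.zero_of_le_dist
    rw [Real.dist_eq]
    change (1 : ℝ) ≤ _
    exact le_trans (by linarith) (le_abs_self _)
  -- The factor u compensates the homogeneity of degree −2 of the Laplacian of a radial extension,
  -- so that the radial factor in polar coordinates is χ(r²).
  let κ : ℝ → ℝ := fun u => u * χ u
  have hκ : ContDiff ℝ ∞ κ := contDiff_id.mul χ.contDiff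
  let W : Ambient N → Ambient N → ℝ := fun v x =>
    κ (‖x‖ ^ 2) * (H x * fderiv ℝ G x v - G x * fderiv ℝ H x v)
  have hcG : ∀ v : Ambient N, ∀ x ≠ 0, ContDiffAt ℝ 1 (fun x => fderiv ℝ G x v) x := by
    intro v x hx
    exact (((hg.contDiffAt_infty hx).of_le hle2).fderiv_right (m := 1) (by norm_num)).clm_apply
      contDiffAt_const
  have hcH : ∀ v : Ambient N, ∀ x ≠ 0, ContDiffAt ℝ 1 (fun x => fderiv ℝ H x v) x := by
    intro v x hx
    exact (((hh.contDiffAt_infty hx).of_le hle2).fderiv_right (m := 1) (by norm_num)).clm_apply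
      contDiffAt_const
  have h1G : ∀ x ≠ 0, ContDiffAt ℝ 1 G x := fun x hx =>
    (hg.contDiffAt_infty hx).of_le (by exact_mod_cast le_top)
  have h1H : ∀ x ≠ 0, ContDiffAt ℝ 1 H x := fun x hx =>
    (hh.contDiffAt_infty hx).of_le (by exact_mod_cast le_top)
  have hκn : ContDiff ℝ 1 (fun x : Ambient N => κ (‖x‖ ^ 2)) :=
    (hκ.of_le (by exact_mod_cast le_top)).comp (contDiff_norm_sq ℝ)
  have hzero : ∀ x : Ambient N, ‖x‖ < 1 → κ (‖x‖ ^ 2) = 0 := by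
    intro x hx
    have : ‖x‖ ^ 2 ≤ 1 := by nlinarith [norm_nonneg x]
    simp [κ, hχ0 _ this]
  have hWc : ∀ v, ContDiff ℝ 1 (W v) := by
    intro v
    rw [contDiff_iff_contDiffAt]
    intro x
    by_cases hx : x = 0
    · have : W v =ᶠ[𝓝 x] fun _ => 0 := by
        have : Metric.ball (0 : Ambient N) 1 ∈ 𝓝 x := by
          rw [hx]; exact Metric.ball_mem_nhds _ one_pos
        filter_upwards [this] with z hz
        rw [mem_ball_zero_iff] at hz
        simp [W, hzero z hz]
      exact contDiffAt_const.congr_of_eventuallyEq this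
    · exact hκn.contDiffAt.mul (((h1H x hx).mul (hcG v x hx)).sub ((h1G x hx).mul (hcH v x hx)))
  have hWs : ∀ v, HasCompactSupport (W v) := by
    intro v
    refine HasCompactSupport.of_support_subset_isCompact (isCompact_closedBall (0 : Ambient N) 2) ?_
    intro x hx
    rw [mem_closedBall_zero_iff]
    by_contra hcon
    push Not at hcon
    apply hx
    have : 3 ≤ ‖x‖ ^ 2 := by nlinarith
    simp [W, κ, hχ3 _ this]
  set e := EuclideanSpace.basisFun (Fin (N + 1)) ℝ with he
  let F : Ambient N → ℝ := fun x =>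
    κ (‖x‖ ^ 2) * (Laplacian.laplacian G x * H x - G x * Laplacian.laplacian H x)
  have hdiv : ∀ x, F x = ∑ i, fderiv ℝ (W (e i)) x (e i) := by
    intro x
    by_cases hx : x = 0
    · have hb : Metric.ball (0 : Ambient N) 1 ∈ 𝓝 x := by
        rw [hx]; exact Metric.ball_mem_nhds _ one_pos
      have : ∀ v, W v =ᶠ[𝓝 x] fun _ => 0 := by
        intro v
        filter_upwards [hb] with z hz
        rw [mem_ball_zero_iff] at hz
        simp [W, hzero z hz]
      have h0 : ∀ v, fderiv ℝ (W v) x = 0 := by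
        intro v
        rw [(this v).fderiv_eq]
        simp
      simp only [h0]
      simp [F, hx, κ]
    · have dκ : HasFDerivAt (fun x : Ambient N => κ (‖x‖ ^ 2))
          (deriv κ (‖x‖ ^ 2) • (2 • (innerSL ℝ x))) x := by
        have h1 : HasDerivAt κ (deriv κ (‖x‖ ^ 2)) (‖x‖ ^ 2) :=
          (hκ.contDiffAt.differentiableAt (by simp)).hasDerivAt
        have h2 : HasFDerivAt (fun x : Ambient N => ‖x‖ ^ 2) (2 • (innerSL ℝ x)) x :=
          (hasStrictFDerivAt_norm_sq x).hasFDerivAt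
        exact h1.comp_hasFDerivAt x h2
      have dG := ((h1G x hx).differentiableAt (by simp)).hasFDerivAt
      have dH := ((h1H x hx).differentiableAt (by simp)).hasFDerivAt
      have hfG : DifferentiableAt ℝ (fderiv ℝ G) x :=
        (((hg.contDiffAt_infty hx).of_le hle2).fderiv_right (m := 1) (by norm_num)).differentiableAt
          (by simp)
      have hfH : DifferentiableAt ℝ (fderiv ℝ H) x :=
        (((hh.contDiffAt_infty hx).of_le hle2).fderiv_right (m := 1) (by norm_num)).differentiableAt
          (by simp)
      have hW : ∀ i, fderiv ℝ (W (e i)) x (e i) =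
          2 * deriv κ (‖x‖ ^ 2) * (H x * (inner ℝ x (e i) * fderiv ℝ G x (e i))
            - G x * (inner ℝ x (e i) * fderiv ℝ H x (e i)))
          + κ (‖x‖ ^ 2) * (H x * fderiv ℝ (fderiv ℝ G) x (e i) (e i)
            - G x * fderiv ℝ (fderiv ℝ H) x (e i) (e i)) := by
        intro i
        have d2G : HasFDerivAt (fun x => fderiv ℝ G x (e i))
            ((fderiv ℝ (fderiv ℝ G) x).flip (e i)) x := by
          have := hfG.hasFDerivAt.clm_apply (hasFDerivAt_const (e i) x)
          simpa using this
        have d2H : HasFDerivAt (fun x => fderiv ℝ H x (e i))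
            ((fderiv ℝ (fderiv ℝ H) x).flip (e i)) x := by
          have := hfH.hasFDerivAt.clm_apply (hasFDerivAt_const (e i) x)
          simpa using this
        have := (dκ.mul ((dH.mul d2G).sub (dG.mul d2H))).fderiv
        have e1 : W (e i) = fun x => κ (‖x‖ ^ 2) * (H x * fderiv ℝ G x (e i) - G x * fderiv ℝ H x (e i)) := rfl
        rw [e1]
        erw [this]
        simp
        ring
      -- Euler's relation in degree 0, which kills the terms containing κ'.
      have hsG : ∑ i, inner ℝ x (e i) * fderiv ℝ G x (e i) = 0 := by
        have h1 := fderiv_radialExt_self hg hx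
        rw [← hG] at h1
        conv_lhs at h1 => rw [← e.sum_repr' x]
        rw [map_sum] at h1
        rw [← h1]
        refine Finset.sum_congr rfl fun i _ => ?_
        rw [map_smul, smul_eq_mul, e.sum_repr' x, real_inner_comm]
      have hsH : ∑ i, inner ℝ x (e i) * fderiv ℝ H x (e i) = 0 := by
        have h1 := fderiv_radialExt_self hh hx
        rw [← hH] at h1
        conv_lhs at h1 => rw [← e.sum_repr' x]
        rw [map_sum] at h1
        rw [← h1]
        refine Finset.sum_congr rfl fun i _ => ?_
        rw [map_smul, smul_eq_mul, e.sum_repr' x, real_inner_comm]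
      simp only [hW]
      rw [Finset.sum_add_distrib, ← Finset.mul_sum, ← Finset.mul_sum, Finset.sum_sub_distrib,
        Finset.sum_sub_distrib, ← Finset.mul_sum, ← Finset.mul_sum, ← Finset.mul_sum,
        ← Finset.mul_sum, hsG, hsH]
      simp only [F]
      rw [InnerProductSpace.laplacian_eq_iteratedFDeriv_orthonormalBasis G e,
        InnerProductSpace.laplacian_eq_iteratedFDeriv_orthonormalBasis H e]
      simp only [iteratedFDeriv_two_apply, Matrix.cons_val_zero, Matrix.cons_val_one]
      ring
  have hint : ∫ x, F x = 0 := by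
    simp only [hdiv]
    rw [integral_finsetSum]
    · exact Finset.sum_eq_zero fun i _ => integral_fderiv_eq_zero _ (hWc _) (hWs _) _
    · intro i _
      have hcont : Continuous fun x => fderiv ℝ (W (e i)) x (e i) :=
        ((hWc _).continuous_fderiv (by simp)).clm_apply continuous_const
      exact hcont.integrable_of_hasCompactSupport ((hWs _).fderiv_apply (𝕜 := ℝ) _)
  rw [integral_polar (a := fun x => laplaceBeltrami g x * h x - g x * laplaceBeltrami h x)
    (b := fun r => χ (r ^ 2))] at hint
  · rcases mul_eq_zero.mp hint with h0 | h0
    · exact h0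
    · exfalso
      -- The radial factor cannot vanish: it is also a factor of this positive integral.
      have hp : 0 < ∫ x : Ambient N, χ (‖x‖ ^ 2) := by
        obtain ⟨w⟩ : Nonempty (USphere N) := by
          have : Nontrivial (Ambient N) := inferInstance
          exact (NormedSpace.sphere_nonempty.mpr zero_le_one).to_subtype
        refine Continuous.integral_pos_of_hasCompactSupport_nonneg_nonzero
          (x := Real.sqrt 2 • (w : Ambient N)) (χ.continuous.comp (by fun_prop)) ?_ (fun x => χ.nonneg) ?_
        · refine HasCompactSupport.of_support_subset_isCompact
            (isCompact_closedBall (0 : Ambient N) 2) ?_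
          intro x hx
          rw [mem_closedBall_zero_iff]
          by_contra hcon
          push Not at hcon
          exact hx (hχ3 _ (by nlinarith))
        · rw [norm_smul, norm_coe_sphere, mul_one, Real.norm_of_nonneg (Real.sqrt_nonneg _),
            Real.sq_sqrt (by norm_num)]
          have : χ 2 = 1 := χ.one_of_mem_closedBall (Metric.mem_closedBall_self (by norm_num))
          rw [this]; norm_num
      rw [integral_polar (a := fun _ => 1) (b := fun r => χ (r ^ 2)) (fun w r hr => by
        rw [norm_smul, norm_coe_sphere, mul_one, Real.norm_of_nonneg hr.le, one_mul]), h0,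
        mul_zero] at hp
      exact lt_irrefl _ hp
  · intro w r hr
    simp only [F, κ]
    rw [laplacian_radialExt_smul hr, laplacian_radialExt_smul hr, hG, hH, radialExt_smul_arg g hr,
      radialExt_smul_arg h hr, radialExt_coe, radialExt_coe, norm_smul, norm_coe_sphere, mul_one,
      Real.norm_of_nonneg hr.le, laplaceBeltrami, laplaceBeltrami]
    field_simp

theorem eigval_strictMono {N : ℕ} (hN : 1 ≤ N) : StrictMono (eigval N) := by
  intro k m hkm
  have h1 : (1 : ℝ) ≤ N := mod_cast hN
  have h2 : (k : ℝ) < m := mod_cast hkm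
  have h3 : (0 : ℝ) ≤ k := k.cast_nonneg
  unfold eigval
  nlinarith

theorem integral_mul_eq_zero_of_mem {N : ℕ} (hN : 1 ≤ N) {k m : ℕ} (hkm : k ≠ m)
    {g h : USphere N → ℝ} (hg : g ∈ sphericalHarmonics N k) (hh : h ∈ sphericalHarmonics N m) :
    ∫ x, g x * h x ∂surfaceMeasure N = 0 := by
  have h1 := integral_laplaceBeltrami_mul hg.1 hh.1
  have h2 : ∀ x, laplaceBeltrami g x * h x - g x * laplaceBeltrami h x =
      (eigval N m - eigval N k) * (g x * h x) := by
    intro x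
    have e1 := hg.2 x
    have e2 := hh.2 x
    linear_combination (-h x) * e1 + g x * e2
  simp only [h2] at h1
  rw [integral_const_mul] at h1
  exact (mul_eq_zero.mp h1).resolve_left
    (sub_ne_zero.mpr ((eigval_strictMono hN).injective.ne hkm.symm))

/-! ### Poisson integrals and the reproducing kernel. -/

/-- The total surface measure of `S^N`. -/
noncomputable def sphereArea (N : ℕ) : ℝ := (surfaceMeasure N).real Set.univ

instance (N : ℕ) : Nonempty (USphere N) :=
  have : Nontrivial (Ambient N) := inferInstance
  (NormedSpace.sphere_nonempty.mpr zero_le_one).to_subtype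

theorem sphereArea_pos (N : ℕ) : 0 < sphereArea N := measureReal_univ_pos

theorem abs_inner_sphere_le {N : ℕ} (x y : USphere N) : |inner ℝ (x : Ambient N) y| ≤ 1 := by
  simpa [norm_coe_sphere] using abs_real_inner_le_norm (x : Ambient N) y

theorem continuous_zonal_inner (n k : ℕ) {N : ℕ} (x : USphere N) :
    Continuous fun y : USphere N => zonal ((n : ℝ) / 2) k (inner ℝ (x : Ambient N) y) :=
  (contDiff_zonal _ k).continuous.comp (by fun_prop)

/-- The generating function of the zonal functions. -/
noncomputable def poissonKernel (n : ℕ) (r t : ℝ) : ℝ :=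
  (1 - r ^ 2) * (1 - 2 * t * r + r ^ 2) ^ (-((n : ℝ) / 2 + 1))

theorem poissonKernel_nonneg (n : ℕ) {r t : ℝ} (hr : |r| < 1) (ht : |t| ≤ 1) :
    0 ≤ poissonKernel n r t := by
  have h1 : r ^ 2 ≤ 1 := by rw [← sq_abs]; nlinarith [abs_nonneg r]
  exact mul_nonneg (by linarith) (Real.rpow_nonneg (poisson_denom_pos ht hr).le _)

theorem continuous_poissonKernel_inner (n : ℕ) {r : ℝ} (hr : |r| < 1) {N : ℕ} (x : USphere N) :
    Continuous fun y : USphere N => poissonKernel n r (inner ℝ (x : Ambient N) y) := by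
  unfold poissonKernel
  refine continuous_const.mul (Continuous.rpow_const (by fun_prop) fun y => Or.inl ?_)
  exact (poisson_denom_pos (abs_inner_sphere_le x y) hr).ne'

theorem summable_poly_geometric (n : ℕ) {r : ℝ} (hr : |r| < 1) :
    Summable fun k : ℕ => (k + 1 : ℝ) ^ n * |r| ^ k := by
  rcases eq_or_ne r 0 with rfl | h0
  · refine summable_of_ne_finset_zero (s := {0}) fun k hk => ?_
    simp only [Finset.mem_singleton] at hk
    simp [hk]
  · have h1 := summable_pow_mul_geometric_of_norm_lt_one n (r := |r|) (by simpa using hr)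
    have h2 := ((summable_nat_add_iff 1).mpr h1).mul_left |r|⁻¹
    refine h2.congr fun k => ?_
    have : |r| ≠ 0 := abs_ne_zero.mpr h0
    push_cast
    rw [pow_succ |r|]
    field_simp

theorem hasSum_poisson_integral (n : ℕ) {r : ℝ} (hr : |r| < 1) {g : USphere (n + 1) → ℝ}
    (hg : Continuous g) (x : USphere (n + 1)) :
    HasSum (fun k : ℕ => r ^ k *
        ∫ y, zonal ((n : ℝ) / 2) k (inner ℝ (x : Ambient (n + 1)) y) * g y ∂surfaceMeasure (n + 1))
      (∫ y, poissonKernel n r (inner ℝ (x : Ambient (n + 1)) y) * g y ∂surfaceMeasure (n + 1)) := by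
  obtain ⟨A, hA, hz⟩ := zonal_sup_bound n
  obtain ⟨G, hG⟩ := isCompact_univ.exists_bound_of_continuousOn hg.continuousOn
  have hcont : ∀ k : ℕ, Continuous fun y : USphere (n + 1) =>
      r ^ k * (zonal ((n : ℝ) / 2) k (inner ℝ (x : Ambient (n + 1)) y) * g y) := fun k =>
    continuous_const.mul ((continuous_zonal_inner n k x).mul hg)
  have h := hasSum_integral_of_summable_integral_norm (μ := surfaceMeasure (n + 1))
    (F := fun (k : ℕ) (y : USphere (n + 1)) =>
      r ^ k * (zonal ((n : ℝ) / 2) k (inner ℝ (x : Ambient (n + 1)) y) * g y))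
    (fun k => integrable_of_continuous (hcont k)) ?_
  · have e1 : ∀ y : USphere (n + 1), ∑' k : ℕ,
        r ^ k * (zonal ((n : ℝ) / 2) k (inner ℝ (x : Ambient (n + 1)) y) * g y) =
        poissonKernel n r (inner ℝ (x : Ambient (n + 1)) y) * g y := by
      intro y
      have := (hasSum_zonal n (abs_inner_sphere_le x y) hr).mul_right (g y)
      refine HasSum.tsum_eq (this.congr_fun fun k => by ring)
    simp only [e1, integral_const_mul] at h
    exact h
  · refine Summable.of_nonneg_of_le (fun k => integral_nonneg fun y => norm_nonneg _) (fun k => ?_)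
      ((summable_poly_geometric n hr).mul_left (A * G * sphereArea (n + 1)))
    have hb : ∀ y : USphere (n + 1),
        ‖r ^ k * (zonal ((n : ℝ) / 2) k (inner ℝ (x : Ambient (n + 1)) y) * g y)‖ ≤
          A * G * ((k + 1 : ℝ) ^ n * |r| ^ k) := by
      intro y
      have h1 := hz k _ (abs_inner_sphere_le x y)
      have h2 := hG y trivial
      rw [norm_mul, norm_mul, norm_pow, Real.norm_eq_abs r, Real.norm_eq_abs (zonal _ _ _)]
      calc |r| ^ k * (|zonal ((n : ℝ) / 2) k (inner ℝ (x : Ambient (n + 1)) y)| * ‖g y‖)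
          ≤ |r| ^ k * (A * (k + 1 : ℝ) ^ n * G) := by gcongr
        _ = _ := by ring
    calc _ ≤ ∫ _ : USphere (n + 1), A * G * ((k + 1 : ℝ) ^ n * |r| ^ k) ∂surfaceMeasure (n + 1) :=
          integral_mono (integrable_of_continuous (hcont k).norm) (integrable_const _) hb
      _ = _ := by rw [integral_const, smul_eq_mul, sphereArea]; ring

theorem integral_zonal_succ (n k : ℕ) (x : USphere (n + 1)) :
    ∫ y, zonal ((n : ℝ) / 2) (k + 1) (inner ℝ (x : Ambient (n + 1)) y) ∂surfaceMeasure (n + 1)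
      = 0 := by
  have := integral_mul_eq_zero_of_mem (by omega) (Nat.succ_ne_zero k)
    (zonal_mem_sphericalHarmonics n (k + 1) x) (zonal_mem_sphericalHarmonics n 0 x)
  simpa [zonal_zero] using this

theorem integral_poissonKernel (n : ℕ) {r : ℝ} (hr : |r| < 1) (x : USphere (n + 1)) :
    ∫ y, poissonKernel n r (inner ℝ (x : Ambient (n + 1)) y) ∂surfaceMeasure (n + 1) =
      sphereArea (n + 1) := by
  have h1 := hasSum_poisson_integral n hr (g := fun _ => 1) continuous_const x
  simp only [mul_one] at h1
  refine h1.unique ?_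
  have := hasSum_single (f := fun k : ℕ => r ^ k * ∫ y, zonal ((n : ℝ) / 2) k
    (inner ℝ (x : Ambient (n + 1)) y) ∂surfaceMeasure (n + 1)) 0 ?_
  · simpa [zonal_zero, sphereArea] using this
  · intro k hk
    obtain ⟨m, rfl⟩ := Nat.exists_eq_succ_of_ne_zero hk
    rw [Nat.succ_eq_add_one, integral_zonal_succ, mul_zero]

theorem sphere_dist_sq {N : ℕ} (x y : USphere N) :
    dist x y ^ 2 = 2 - 2 * inner ℝ (x : Ambient N) y := by
  rw [Subtype.dist_eq, dist_eq_norm, norm_sub_sq_real, norm_coe_sphere, norm_coe_sphere]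
  ring

/-- The Poisson integrals of a continuous function converge to it uniformly. -/
theorem exists_poisson_integral_close (n : ℕ) {g : USphere (n + 1) → ℝ} (hg : Continuous g)
    {ε : ℝ} (hε : 0 < ε) : ∃ r₀ : ℝ, 1 / 2 ≤ r₀ ∧ r₀ < 1 ∧ ∀ r, r₀ ≤ r → r < 1 → ∀ x : USphere (n + 1),
      |∫ y, poissonKernel n r (inner ℝ (x : Ambient (n + 1)) y) * g y ∂surfaceMeasure (n + 1) -
        sphereArea (n + 1) * g x| ≤ ε := by
  set A := sphereArea (n + 1) with hAdef
  have hA : 0 < A := sphereArea_pos _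
  obtain ⟨G', hG'⟩ := isCompact_univ.exists_bound_of_continuousOn hg.continuousOn
  set G := max G' 1
  have hG : ∀ x, |g x| ≤ G := fun x => (hG' x trivial).trans (le_max_left _ _)
  have hG0 : 0 < G := lt_of_lt_of_le one_pos (le_max_right _ _)
  have hu := CompactSpace.uniformContinuous_of_continuous hg
  obtain ⟨δ, hδ, hgδ⟩ := Metric.uniformContinuous_iff.mp hu (ε / (2 * A)) (by positivity)
  -- At distance at least δ from x one has 1 − 2tr + r² = (1 − r)² + r(2 − 2t) ≥ δ²/2 as soon as r ≥
  -- 1/2, so the kernel there is at most (1 − r²)D.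
  set D : ℝ := (δ ^ 2 / 2) ^ (-((n : ℝ) / 2 + 1)) with hD
  have hD0 : 0 < D := Real.rpow_pos_of_pos (by positivity) _
  refine ⟨max (1 / 2) (1 - ε / (8 * G * D * A)), le_max_left _ _,
    max_lt (by norm_num) (sub_lt_self _ (by positivity)), fun r hr hr1 x => ?_⟩
  have hr2 : 1 / 2 ≤ r := (le_max_left _ _).trans hr
  have hr3 : 1 - ε / (8 * G * D * A) ≤ r := (le_max_right _ _).trans hr
  have hra : |r| < 1 := by rw [abs_of_nonneg (by linarith)]; exact hr1
  have hpc := continuous_poissonKernel_inner n hra x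
  set p : USphere (n + 1) → ℝ := fun y => poissonKernel n r (inner ℝ (x : Ambient (n + 1)) y)
  have hp0 : ∀ y, 0 ≤ p y := fun y => poissonKernel_nonneg n hra (abs_inner_sphere_le x y)
  have hint : ∫ y, p y ∂surfaceMeasure (n + 1) = A := integral_poissonKernel n hra x
  have hpt : ∀ y, |p y * (g y - g x)| ≤ ε / (2 * A) * p y + 2 * G * (1 - r ^ 2) * D := by
    intro y
    have hq : 0 ≤ 1 - r ^ 2 := by nlinarith
    rw [abs_mul, abs_of_nonneg (hp0 y)]
    rcases lt_or_ge (dist y x) δ with hd | hd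
    · have := (hgδ hd).le
      rw [Real.dist_eq] at this
      have h2 : 0 ≤ 2 * G * (1 - r ^ 2) * D := by positivity
      nlinarith [hp0 y, mul_le_mul_of_nonneg_left this (hp0 y)]
    · have hd2 : δ ^ 2 ≤ dist y x ^ 2 := by gcongr
      rw [dist_comm, sphere_dist_sq] at hd2
      have hpy : p y ≤ (1 - r ^ 2) * D := by
        refine mul_le_mul_of_nonneg_left ?_ hq
        refine Real.rpow_le_rpow_of_nonpos (by positivity) ?_ (by
          have : (0 : ℝ) ≤ n := n.cast_nonneg
          linarith)
        nlinarith [sq_nonneg (1 - r)]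
      have h1 : |g y - g x| ≤ 2 * G := (abs_sub _ _).trans (by linarith [hG x, hG y])
      have h2 : 0 ≤ ε / (2 * A) * p y := mul_nonneg (by positivity) (hp0 y)
      have h3 : p y * |g y - g x| ≤ (1 - r ^ 2) * D * (2 * G) :=
        mul_le_mul hpy h1 (abs_nonneg _) (by positivity)
      linarith
  have e1 : ∫ y, p y * g y ∂surfaceMeasure (n + 1) - A * g x =
      ∫ y, p y * (g y - g x) ∂surfaceMeasure (n + 1) := by
    rw [← hint, ← integral_mul_const, ← integral_sub
      (integrable_of_continuous (g := fun y => p y * g y) (hpc.mul hg))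
      (integrable_of_continuous (g := fun y => p y * g x) (hpc.mul continuous_const))]
    simp only [mul_sub]
  rw [e1]
  calc |∫ y, p y * (g y - g x) ∂surfaceMeasure (n + 1)|
      ≤ ∫ y, |p y * (g y - g x)| ∂surfaceMeasure (n + 1) := abs_integral_le_integral_abs
    _ ≤ ∫ y, (ε / (2 * A) * p y + 2 * G * (1 - r ^ 2) * D) ∂surfaceMeasure (n + 1) :=
        integral_mono (integrable_of_continuous
          (hpc.mul (hg.sub continuous_const)).abs)
          (integrable_of_continuous ((continuous_const.mul hpc).add continuous_const)) hpt
    _ = ε / 2 + 2 * G * (1 - r ^ 2) * D * A := by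
        rw [integral_add
          (integrable_of_continuous (g := fun y => ε / (2 * A) * p y) (continuous_const.mul hpc))
          (integrable_const _), integral_const_mul, hint, integral_const, smul_eq_mul, hAdef,
          sphereArea]
        have : (surfaceMeasure (n + 1)).real Set.univ ≠ 0 := hA.ne'
        field_simp
    _ ≤ ε := by
        have h1 : 1 - r ^ 2 ≤ 2 * (ε / (8 * G * D * A)) := by nlinarith
        have h2 : 2 * G * (1 - r ^ 2) * D * A ≤ 2 * G * (2 * (ε / (8 * G * D * A))) * D * A := by
          gcongr
        have h3 : 2 * G * (2 * (ε / (8 * G * D * A))) * D * A = ε / 2 := by field_simp; norm_num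
        linarith

/-- The zonal function is the reproducing kernel of the spherical harmonics. -/
theorem integral_zonal_mul_of_mem {n k : ℕ} {g : USphere (n + 1) → ℝ}
    (hg : g ∈ sphericalHarmonics (n + 1) k) (x : USphere (n + 1)) :
    ∫ y, zonal ((n : ℝ) / 2) k (inner ℝ (x : Ambient (n + 1)) y) * g y ∂surfaceMeasure (n + 1) =
      sphereArea (n + 1) * g x := by
  set I := ∫ y, zonal ((n : ℝ) / 2) k (inner ℝ (x : Ambient (n + 1)) y) * g y
    ∂surfaceMeasure (n + 1) with hI
  have hgc := hg.1.continuous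
  -- Orthogonality leaves only the term of degree k in the Poisson series of g. Letting r tend to 1,
  -- the left side tends to the area times g(x) and the right side to I.
  have h1 : ∀ r : ℝ, |r| < 1 →
      ∫ y, poissonKernel n r (inner ℝ (x : Ambient (n + 1)) y) * g y ∂surfaceMeasure (n + 1) =
        r ^ k * I := by
    intro r hr
    refine (hasSum_poisson_integral n hr hgc x).unique (hasSum_single k fun m hm => ?_)
    rw [integral_mul_eq_zero_of_mem (by omega) hm (zonal_mem_sphericalHarmonics n m x) hg, mul_zero]
  have h2 : Tendsto (fun r : ℝ => r ^ k * I) (𝓝[<] 1) (𝓝 I) := by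
    have : Tendsto (fun r : ℝ => r ^ k * I) (𝓝 1) (𝓝 (1 ^ k * I)) := by
      apply Continuous.tendsto; fun_prop
    rw [one_pow, one_mul] at this
    exact this.mono_left nhdsWithin_le_nhds
  refine tendsto_nhds_unique h2 ?_
  rw [Metric.tendsto_nhds]
  intro ε hε
  obtain ⟨r₀, hr₀, hr₁, hclose⟩ := exists_poisson_integral_close n hgc (half_pos hε)
  filter_upwards [Ioo_mem_nhdsLT hr₁] with r hr
  have hra : |r| < 1 := by rw [abs_of_nonneg (by linarith [hr.1])]; exact hr.2
  rw [← h1 r hra, Real.dist_eq]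
  exact (hclose r hr.1.le hr.2 x).trans_lt (by linarith)

/-! ### Finite dimensionality -/

/-- The integral operators with kernel `φ ⟪x, y⟫` that have finite rank on continuous functions. -/
def HasFiniteRange (N : ℕ) (φ : ℝ → ℝ) : Prop :=
  Continuous φ ∧ ∃ W : Submodule ℝ (USphere N → ℝ), FiniteDimensional ℝ W ∧
    ∀ g : USphere N → ℝ, Continuous g →
      (fun x : USphere N => ∫ y, φ (inner ℝ (x : Ambient N) y) * g y ∂surfaceMeasure N) ∈ W

theorem hasFiniteRange_const (N : ℕ) (c : ℝ) : HasFiniteRange N fun _ => c := by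
  refine ⟨continuous_const, Submodule.span ℝ {fun _ => 1}, inferInstance, fun g _ => ?_⟩
  rw [Submodule.mem_span_singleton]
  exact ⟨∫ y, c * g y ∂surfaceMeasure N, by funext; simp⟩

theorem HasFiniteRange.linear {N : ℕ} {φ ψ : ℝ → ℝ} (hφ : HasFiniteRange N φ)
    (hψ : HasFiniteRange N ψ) (a b : ℝ) : HasFiniteRange N fun t => a * φ t + b * ψ t := by
  obtain ⟨hφc, W, hW, h1⟩ := hφ
  obtain ⟨hψc, V, hV, h2⟩ := hψ
  refine ⟨by fun_prop, W ⊔ V, inferInstance, fun g hg => ?_⟩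
  have := Submodule.add_mem_sup (W.smul_mem a (h1 g hg)) (V.smul_mem b (h2 g hg))
  refine Eq.subst (motive := fun z => z ∈ W ⊔ V) ?_ this
  funext x
  simp only [Pi.add_apply, Pi.smul_apply, smul_eq_mul]
  rw [← integral_const_mul, ← integral_const_mul, ← integral_add]
  · congr 1; funext y; ring
  · exact integrable_of_continuous (by fun_prop)
  · exact integrable_of_continuous (by fun_prop)

/-- As ⟪x, y⟫ = ∑ x_i y_i, the operator with kernel tφ(t) is the sum over i of: multiply by y_i,
apply the operator with kernel φ, multiply by x_i. -/
theorem HasFiniteRange.id_mul {N : ℕ} {φ : ℝ → ℝ} (hφ : HasFiniteRange N φ) :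
    HasFiniteRange N fun t => t * φ t := by
  obtain ⟨hφc, W, hW, h1⟩ := hφ
  let m : Fin (N + 1) → (USphere N → ℝ) →ₗ[ℝ] (USphere N → ℝ) := fun i =>
    LinearMap.mulLeft ℝ (fun x : USphere N => (x : Ambient N) i)
  refine ⟨by fun_prop, ⨆ i, W.map (m i), inferInstance, fun g hg => ?_⟩
  have hc : ∀ i, Continuous fun y : USphere N => (y : Ambient N) i := fun i => by fun_prop
  have := Submodule.sum_mem (⨆ i, W.map (m i)) (t := Finset.univ) (f := fun i => m i
      (fun x : USphere N => ∫ y, φ (inner ℝ (x : Ambient N) y) * ((y : Ambient N) i * g y)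
        ∂surfaceMeasure N)) fun i _ =>
    (le_iSup (fun i => W.map (m i)) i)
      (Submodule.mem_map_of_mem (h1 (fun y => (y : Ambient N) i * g y) ((hc i).mul hg)))
  refine Eq.subst (motive := fun z => z ∈ ⨆ i, W.map (m i)) ?_ this
  funext x
  simp only [Finset.sum_apply, m, LinearMap.mulLeft_apply, Pi.mul_apply]
  simp only [← integral_const_mul]
  rw [← integral_finsetSum]
  · congr 1; funext y
    rw [PiLp.inner_apply, Finset.sum_mul, Finset.sum_mul]
    refine Finset.sum_congr rfl fun i _ => ?_
    simp only [RCLike.inner_apply, conj_trivial]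
    ring
  · intro i _
    have := hc i
    exact integrable_of_continuous (by fun_prop)

theorem hasFiniteRange_gegen (N : ℕ) (μ : ℝ) (k : ℕ) : HasFiniteRange N (gegen μ k) := by
  induction k using Nat.twoStepInduction with
  | zero => simpa [funext (gegen_zero μ)] using hasFiniteRange_const N 0
  | one => simpa [funext (gegen_one μ)] using hasFiniteRange_const N 1
  | more k ih1 ih2 =>
    have := ih2.id_mul.linear ih1 (2 * (k + μ) / (k + 1)) (-((k + 2 * μ - 1) / (k + 1)))
    refine Eq.subst (motive := fun z => HasFiniteRange N z) ?_ this
    funext x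
    have h := gegen_rec μ k x
    have : (k : ℝ) + 1 ≠ 0 := by positivity
    field_simp
    linear_combination -h

theorem hasFiniteRange_zonal (N : ℕ) (ν : ℝ) (k : ℕ) : HasFiniteRange N (zonal ν k) := by
  rcases k with _ | k
  · simpa [funext (zonal_zero ν)] using hasFiniteRange_const N 1
  · have := (hasFiniteRange_gegen N (ν + 1) (k + 2)).linear (hasFiniteRange_gegen N (ν + 1) k) 1 (-1)
    refine Eq.subst (motive := fun z => HasFiniteRange N z) ?_ this
    funext x
    rw [zonal_succ]; ring

/-- On H_k the operator with zonal kernel is the area times the identity, and it has finite rank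
because the kernel is a polynomial in ⟪x, y⟫. This matters since `harmonicDim` is a `finrank`, which
would be 0 in infinite dimension. -/
theorem finiteDimensional_sphericalHarmonics (n k : ℕ) :
    FiniteDimensional ℝ (sphericalHarmonics (n + 1) k) := by
  obtain ⟨-, W, hW, h⟩ := hasFiniteRange_zonal (n + 1) ((n : ℝ) / 2) k
  refine Submodule.finiteDimensional_of_le (S₂ := W) fun g hg => ?_
  have h1 := W.smul_mem (sphereArea (n + 1))⁻¹ (h g hg.1.continuous)
  refine Eq.subst (motive := fun z => z ∈ W) ?_ h1
  funext x
  have := (sphereArea_pos (n + 1)).ne'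
  rw [Pi.smul_apply, integral_zonal_mul_of_mem hg, smul_eq_mul]
  field_simp

/-! ### The terms of the Fourier–Laplace series -/

variable {n : ℕ} {Y : (k : ℕ) → Fin (harmonicDim (n + 1) k) → USphere (n + 1) → ℝ}

theorem IsHarmonicSystem.continuous (hY : IsHarmonicSystem (n + 1) Y) (k j) : Continuous (Y k j) :=
  (hY.mem k j).1.continuous

theorem IsHarmonicSystem.integral_sum_mul (hY : IsHarmonicSystem (n + 1) Y) (k : ℕ)
    (c : Fin (harmonicDim (n + 1) k) → ℝ) (i) :
    ∫ y, (∑ j, c j * Y k j y) * Y k i y ∂surfaceMeasure (n + 1) = c i := by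
  simp only [Finset.sum_mul]
  rw [integral_finsetSum]
  · simp only [mul_assoc, integral_const_mul, hY.orthonormal]
    simp
  · intro j _
    have := hY.continuous k j
    have := hY.continuous k i
    exact integrable_of_continuous (by fun_prop)

/-- Orthonormality gives linear independence, and in finite dimension the number of functions then
forces them to span. -/
theorem IsHarmonicSystem.exists_eq_sum (hY : IsHarmonicSystem (n + 1) Y) {k : ℕ}
    {g : USphere (n + 1) → ℝ} (hg : g ∈ sphericalHarmonics (n + 1) k) :
    ∃ c : Fin (harmonicDim (n + 1) k) → ℝ, ∀ x, g x = ∑ j, c j * Y k j x := by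
  have := finiteDimensional_sphericalHarmonics n k
  let b : Fin (harmonicDim (n + 1) k) → sphericalHarmonics (n + 1) k := fun j => ⟨Y k j, hY.mem k j⟩
  have hb : ∀ (c : Fin (harmonicDim (n + 1) k) → ℝ) x,
      ((∑ j, c j • b j : sphericalHarmonics (n + 1) k) : USphere (n + 1) → ℝ) x =
        ∑ j, c j * Y k j x := by
    intro c x
    simp [b, Finset.sum_apply]
  have hli : LinearIndependent ℝ b := by
    rw [Fintype.linearIndependent_iff]
    intro c hc i
    rw [← hY.integral_sum_mul k c i]
    simp only [← hb c, hc]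
    simp
  have hs := hli.span_eq_top_of_card_eq_finrank' (Fintype.card_fin _)
  have hm : (⟨g, hg⟩ : sphericalHarmonics (n + 1) k) ∈ Submodule.span ℝ (Set.range b) := by
    rw [hs]; trivial
  obtain ⟨c, hc⟩ := (Submodule.mem_span_range_iff_exists_fun ℝ).mp hm
  refine ⟨c, fun x => ?_⟩
  rw [← hb c x, hc]

/-- The addition theorem: expand the zonal function with pole x in the basis; the reproducing
property identifies the coefficients. It removes the choice of basis from all that follows. -/
theorem IsHarmonicSystem.sum_mul_eq_zonal (hY : IsHarmonicSystem (n + 1) Y) (k : ℕ)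
    (x y : USphere (n + 1)) :
    ∑ j, Y k j x * Y k j y =
      (sphereArea (n + 1))⁻¹ * zonal ((n : ℝ) / 2) k (inner ℝ (x : Ambient (n + 1)) y) := by
  obtain ⟨c, hc⟩ := hY.exists_eq_sum (zonal_mem_sphericalHarmonics n k x)
  have hA := (sphereArea_pos (n + 1)).ne'
  have h1 : ∀ i, c i = sphereArea (n + 1) * Y k i x := by
    intro i
    rw [← integral_zonal_mul_of_mem (hY.mem k i) x, ← hY.integral_sum_mul k c i]
    simp only [hc]
  rw [hc y]
  simp only [h1, Finset.mul_sum]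
  refine Finset.sum_congr rfl fun j _ => ?_
  field_simp

theorem integrable_mul_continuous {N : ℕ} {f g : USphere N → ℝ}
    (hf : Integrable f (surfaceMeasure N)) (hg : Continuous g) :
    Integrable (fun y => f y * g y) (surfaceMeasure N) := by
  obtain ⟨G, hG⟩ := isCompact_univ.exists_bound_of_continuousOn hg.continuousOn
  exact hf.mul_bdd (c := G) hg.aestronglyMeasurable (Eventually.of_forall fun y => hG y trivial)

theorem seriesTerm_eq_integral (hY : IsHarmonicSystem (n + 1) Y) {f : USphere (n + 1) → ℝ}
    (hf : Integrable f (surfaceMeasure (n + 1))) (k : ℕ) (x : USphere (n + 1)) :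
    seriesTerm Y f k x = (sphereArea (n + 1))⁻¹ *
      ∫ y, f y * zonal ((n : ℝ) / 2) k (inner ℝ (x : Ambient (n + 1)) y) ∂surfaceMeasure (n + 1) := by
  simp only [seriesTerm, RCLike.ofReal_real_eq_id, id]
  simp only [← integral_const_mul]
  rw [← integral_finsetSum]
  · congr 1; funext y
    have := hY.sum_mul_eq_zonal k x y
    calc ∑ j, Y k j x * (f y * Y k j y) = f y * ∑ j, Y k j x * Y k j y := by
          rw [Finset.mul_sum]; exact Finset.sum_congr rfl fun j _ => by ring
      _ = _ := by rw [this]; ring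
  · intro j _
    exact (integrable_mul_continuous hf (hY.continuous k j)).const_mul _

theorem seriesTerm_mem (hY : IsHarmonicSystem (n + 1) Y) (f : USphere (n + 1) → ℝ) (k : ℕ) :
    seriesTerm Y f k ∈ sphericalHarmonics (n + 1) k := by
  have : seriesTerm Y f k = ∑ j, (∫ y, f y * Y k j y ∂surfaceMeasure (n + 1)) • Y k j := by
    funext x
    simp only [seriesTerm, RCLike.ofReal_real_eq_id, id, Finset.sum_apply, Pi.smul_apply, smul_eq_mul]
    exact Finset.sum_congr rfl fun j _ => by ring
  rw [this]
  exact Submodule.sum_mem _ fun j _ => Submodule.smul_mem _ _ (hY.mem k j)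

theorem continuous_seriesTerm (hY : IsHarmonicSystem (n + 1) Y) (f : USphere (n + 1) → ℝ) (k : ℕ) :
    Continuous (seriesTerm Y f k) := (seriesTerm_mem hY f k).1.continuous

theorem seriesTerm_of_mem (hY : IsHarmonicSystem (n + 1) Y) {g : USphere (n + 1) → ℝ} {m : ℕ}
    (hg : g ∈ sphericalHarmonics (n + 1) m) (k : ℕ) (x : USphere (n + 1)) :
    seriesTerm Y g k x = if k = m then g x else 0 := by
  rw [seriesTerm_eq_integral hY (integrable_of_continuous hg.1.continuous)]
  have hA := (sphereArea_pos (n + 1)).ne'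
  split_ifs with h
  · subst h
    have := integral_zonal_mul_of_mem hg x
    simp only [mul_comm (zonal _ _ _)] at this
    rw [this]; field_simp
  · have := integral_mul_eq_zero_of_mem (by omega) (Ne.symm h) hg (zonal_mem_sphericalHarmonics n k x)
    rw [this, mul_zero]

theorem integral_mul_seriesTerm (hY : IsHarmonicSystem (n + 1) Y) {f : USphere (n + 1) → ℝ}
    (hf : Integrable f (surfaceMeasure (n + 1))) (k : ℕ) :
    ∫ x, f x * seriesTerm Y f k x ∂surfaceMeasure (n + 1) =
      ∫ x, seriesTerm Y f k x ^ 2 ∂surfaceMeasure (n + 1) := by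
  set c : Fin (harmonicDim (n + 1) k) → ℝ := fun j => ∫ y, f y * Y k j y ∂surfaceMeasure (n + 1)
  have e : ∀ x, seriesTerm Y f k x = ∑ j, c j * Y k j x := by
    intro x
    simp only [seriesTerm, RCLike.ofReal_real_eq_id, id]
    exact Finset.sum_congr rfl fun j _ => mul_comm _ _
  have key : ∀ h : USphere (n + 1) → ℝ, Integrable h (surfaceMeasure (n + 1)) →
      ∫ x, h x * seriesTerm Y f k x ∂surfaceMeasure (n + 1) =
        ∑ j, c j * ∫ x, h x * Y k j x ∂surfaceMeasure (n + 1) := by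
    intro h hh
    simp only [e, Finset.mul_sum, ← integral_const_mul]
    rw [integral_finsetSum]
    · refine Finset.sum_congr rfl fun j _ => ?_
      congr 1; funext y; ring
    · intro j _
      exact integrable_mul_continuous hh (continuous_const.mul (hY.continuous k j))
  rw [key f hf]
  have h2 := key (seriesTerm Y f k) (integrable_of_continuous (continuous_seriesTerm hY f k))
  simp only [sq]
  rw [h2]
  refine Finset.sum_congr rfl fun j _ => ?_
  congr 1
  simp only [e]
  exact (hY.integral_sum_mul k c j).symm

/-- The square norm of a linear combination of terms of the Fourier–Laplace series. -/
theorem integral_sum_seriesTerm_sq (hY : IsHarmonicSystem (n + 1) Y) (f : USphere (n + 1) → ℝ)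
    (s : Finset ℕ) (a : ℕ → ℝ) :
    ∫ x, (∑ k ∈ s, a k * seriesTerm Y f k x) ^ 2 ∂surfaceMeasure (n + 1) =
      ∑ k ∈ s, a k ^ 2 * ∫ x, seriesTerm Y f k x ^ 2 ∂surfaceMeasure (n + 1) := by
  have hc := continuous_seriesTerm hY f
  simp only [sq (∑ k ∈ s, _), Finset.sum_mul_sum]
  rw [integral_finsetSum]
  · refine Finset.sum_congr rfl fun k hk => ?_
    rw [integral_finsetSum, Finset.sum_eq_single k]
    · rw [← integral_const_mul]; congr 1; funext x; ring
    · intro m _ hm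
      have := integral_mul_eq_zero_of_mem (by omega) hm.symm (seriesTerm_mem hY f k)
        (seriesTerm_mem hY f m)
      rw [show (fun x => a k * seriesTerm Y f k x * (a m * seriesTerm Y f m x)) = fun x =>
        a k * a m * (seriesTerm Y f k x * seriesTerm Y f m x) from funext fun x => by ring,
        integral_const_mul, this, mul_zero]
    · exact fun h => absurd hk h
    · intro m _
      exact integrable_of_continuous
        ((continuous_const.mul (hc k)).mul (continuous_const.mul (hc m)))
  · intro k _
    exact integrable_of_continuous (continuous_finsetSum _ fun m _ =>
      (continuous_const.mul (hc k)).mul (continuous_const.mul (hc m)))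

/-- Bessel's inequality. -/
theorem sum_integral_seriesTerm_sq_le (hY : IsHarmonicSystem (n + 1) Y) {f : USphere (n + 1) → ℝ}
    (hf : MemLp f 2 (surfaceMeasure (n + 1))) (s : Finset ℕ) :
    ∑ k ∈ s, ∫ x, seriesTerm Y f k x ^ 2 ∂surfaceMeasure (n + 1) ≤
      ∫ x, f x ^ 2 ∂surfaceMeasure (n + 1) := by
  have hf1 : Integrable f (surfaceMeasure (n + 1)) := hf.integrable (by norm_num)
  have hf2 := hf.integrable_sq
  have hc := continuous_seriesTerm hY f
  have hS : Continuous fun x => ∑ k ∈ s, seriesTerm Y f k x := continuous_finsetSum _ fun k _ => hc k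
  have h1 : 0 ≤ ∫ x, (f x - ∑ k ∈ s, seriesTerm Y f k x) ^ 2 ∂surfaceMeasure (n + 1) :=
    integral_nonneg fun x => sq_nonneg _
  have e1 : (fun x => (f x - ∑ k ∈ s, seriesTerm Y f k x) ^ 2) = fun x =>
      (f x ^ 2 - 2 * (f x * ∑ k ∈ s, seriesTerm Y f k x)) + (∑ k ∈ s, seriesTerm Y f k x) ^ 2 := by
    funext x; ring
  have hi := integrable_mul_continuous hf1 hS
  have hS2 : Integrable (fun x => (∑ k ∈ s, seriesTerm Y f k x) ^ 2) (surfaceMeasure (n + 1)) :=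
    integrable_of_continuous (by fun_prop)
  have hd : Integrable (fun x => f x ^ 2 - 2 * (f x * ∑ k ∈ s, seriesTerm Y f k x))
      (surfaceMeasure (n + 1)) := hf2.sub (hi.const_mul 2)
  rw [e1, integral_add hd hS2, integral_sub hf2 (hi.const_mul 2), integral_const_mul] at h1
  have h2 : ∫ x, f x * ∑ k ∈ s, seriesTerm Y f k x ∂surfaceMeasure (n + 1) =
      ∑ k ∈ s, ∫ x, seriesTerm Y f k x ^ 2 ∂surfaceMeasure (n + 1) := by
    simp only [Finset.mul_sum]
    rw [integral_finsetSum _ fun k _ => integrable_mul_continuous hf1 (hc k)]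
    exact Finset.sum_congr rfl fun k _ => integral_mul_seriesTerm hY hf1 k
  have h3 := integral_sum_seriesTerm_sq hY f s fun _ => 1
  simp only [one_mul, one_pow] at h3
  rw [h2, h3] at h1
  linarith

/-! ### Measure of balls and the maximal theorem. -/

open scoped Pointwise in
-- For r < 1 the cone over the ball is covered by its dilate with ratio 1 − r and a Euclidean ball
-- of radius 2r. Hence its volume c satisfies c(1 − (1 − r)^(N+1)) ≤ V(2r)^(N+1), and the bracket is
-- at least r.
theorem exists_measure_closedBall_le (N : ℕ) : ∃ C : ℝ, 0 < C ∧ ∀ (x : USphere N) (r : ℝ), 0 < r →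
    surfaceMeasure N (Metric.closedBall x r) ≤ ENNReal.ofReal (C * r ^ N) := by
  set V : ℝ := (volume : Measure (Ambient N)).real (Metric.ball 0 1) with hV
  have hV0 : 0 ≤ V := measureReal_nonneg
  have hdim : Module.finrank ℝ (Ambient N) = N + 1 := by simp
  refine ⟨(N + 1) * (V * 2 ^ (N + 1)) + sphereArea N,
    add_pos_of_nonneg_of_pos (by positivity) (sphereArea_pos N), fun x r hr => ?_⟩
  have hA := sphereArea_pos N
  rcases le_or_gt 1 r with h1 | h1
  · calc surfaceMeasure N (Metric.closedBall x r) ≤ surfaceMeasure N Set.univ :=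
          measure_mono (Set.subset_univ _)
      _ = ENNReal.ofReal (sphereArea N) := by
          rw [sphereArea, measureReal_def, ENNReal.ofReal_toReal (measure_ne_top _ _)]
      _ ≤ _ := by
          refine ENNReal.ofReal_le_ofReal ?_
          have h2 : 1 ≤ r ^ N := one_le_pow₀ h1
          have h3 : 0 ≤ (N + 1) * (V * 2 ^ (N + 1)) := by positivity
          nlinarith
  · set cone : Set (Ambient N) := Set.Ioo (0 : ℝ) 1 • (Subtype.val '' Metric.closedBall x r) with hcone
    have hfin : volume cone ≠ ⊤ := by
      refine ((measure_mono ?_).trans_lt (measure_ball_lt_top (x := (0 : Ambient N)) (r := 1))).ne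
      rintro _ ⟨t, ht, _, ⟨y, -, rfl⟩, rfl⟩
      simp only [mem_ball_zero_iff, norm_smul, norm_coe_sphere, mul_one, Real.norm_eq_abs]
      rw [abs_of_pos ht.1]; exact ht.2
    have hsub : cone ⊆ (1 - r) • cone ∪ Metric.closedBall (x : Ambient N) (2 * r) := by
      rintro _ ⟨t, ht, _, ⟨y, hy, rfl⟩, rfl⟩
      have hy' : ‖(y : Ambient N) - x‖ ≤ r := by
        rw [← dist_eq_norm, ← Subtype.dist_eq]; exact hy
      rcases lt_or_ge t (1 - r) with h | h
      · left
        have h1r : 0 < 1 - r := by linarith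
        refine ⟨(t / (1 - r)) • (y : Ambient N), ⟨t / (1 - r),
          ⟨div_pos ht.1 h1r, (div_lt_one h1r).mpr h⟩, _, ⟨y, hy, rfl⟩, rfl⟩, ?_⟩
        simp only [smul_smul]
        congr 1
        field_simp
      · right
        rw [Metric.mem_closedBall, dist_eq_norm]
        have e : t • (y : Ambient N) - x = (t - 1) • (y : Ambient N) + (y - x) := by
          rw [sub_smul, one_smul]; abel
        change ‖t • (y : Ambient N) - x‖ ≤ _
        rw [e]
        refine (norm_add_le _ _).trans ?_
        rw [norm_smul, norm_coe_sphere, mul_one, Real.norm_eq_abs, abs_of_nonpos (by linarith [ht.2])]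
        linarith
    have hm := (measure_mono hsub).trans (measure_union_le (μ := (volume : Measure (Ambient N))) _ _)
    rw [Measure.addHaar_smul, Measure.addHaar_closedBall _ _ (by positivity), hdim,
      ← ENNReal.ofReal_toReal hfin, ← ENNReal.ofReal_toReal (measure_ball_lt_top
        (μ := (volume : Measure (Ambient N))) (x := (0 : Ambient N)) (r := 1)).ne,
      ← ENNReal.ofReal_mul (by positivity), ← ENNReal.ofReal_mul (by positivity),
      ← ENNReal.ofReal_add (by positivity) (by positivity),
      ENNReal.ofReal_le_ofReal_iff (by positivity)] at hm
    set c := (volume cone).toReal with hc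
    have hc0 : 0 ≤ c := ENNReal.toReal_nonneg
    change c ≤ |(1 - r) ^ (N + 1)| * c + (2 * r) ^ (N + 1) * V at hm
    have hp : |(1 - r) ^ (N + 1)| ≤ 1 - r := by
      rw [abs_of_nonneg (by have : 0 ≤ 1 - r := by linarith
                            positivity), pow_succ]
      have : (1 - r) ^ N ≤ 1 := pow_le_one₀ (by linarith) (by linarith)
      nlinarith
    have hcb : c ≤ V * 2 ^ (N + 1) * r ^ N := by
      have h2 : r * c ≤ r * (V * 2 ^ (N + 1) * r ^ N) := by
        have h3 : |(1 - r) ^ (N + 1)| * c ≤ (1 - r) * c := by gcongr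
        have h4 : (2 * r) ^ (N + 1) * V = r * (V * 2 ^ (N + 1) * r ^ N) := by ring
        linarith
      exact le_of_mul_le_mul_left h2 hr
    rw [surfaceMeasure, Measure.toSphere_apply' _ Metric.isClosed_closedBall.measurableSet, ← hcone,
      hdim, ← ENNReal.ofReal_toReal hfin, ← hc, ← ENNReal.ofReal_natCast,
      ← ENNReal.ofReal_mul (by positivity)]
    refine ENNReal.ofReal_le_ofReal ?_
    push_cast
    have h5 : ((N : ℝ) + 1) * c ≤ (N + 1) * (V * 2 ^ (N + 1) * r ^ N) := by gcongr
    have h6 : 0 ≤ sphereArea N * r ^ N := by positivity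
    linarith

theorem dist_sphere_le_two {N : ℕ} (x y : USphere N) : dist x y ≤ 2 := by
  have h1 := sphere_dist_sq x y
  have h2 := abs_le.mp (abs_inner_sphere_le x y)
  nlinarith [dist_nonneg (x := x) (y := y)]

/-- The means of `f` over the balls centred at `z`, relative to the `N`-th power of the radius,
are at most `m`. -/
def BallMeansLE {N : ℕ} (f : USphere N → ENNReal) (m : ℝ) (z : USphere N) : Prop :=
  ∀ r : ℝ, 0 < r → ∫⁻ y in Metric.closedBall z r, f y ∂surfaceMeasure N ≤ ENNReal.ofReal (m * r ^ N)

/-- The Hardy–Littlewood maximal theorem. -/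
theorem exists_measure_not_ballMeansLE_le (N : ℕ) : ∃ C : ℝ, 0 < C ∧
    ∀ (ι : USphere N → USphere N), Isometry ι → ∀ (f : USphere N → ENNReal) (α : ℝ), 0 < α →
      surfaceMeasure N {x | ¬ BallMeansLE f α (ι x)} ≤
        ENNReal.ofReal (C / α) * ∫⁻ y, f y ∂surfaceMeasure N := by
  obtain ⟨C, hC, hball⟩ := exists_measure_closedBall_le N
  refine ⟨C * 5 ^ N, by positivity, fun ι hι f α hα => ?_⟩
  set t := {x | ¬ BallMeansLE f α (ι x)} with ht
  have hex : ∀ x : USphere N, ∃ r : ℝ, 0 < r ∧ r ≤ 4 ∧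
      (x ∈ t → ENNReal.ofReal (α * r ^ N) < ∫⁻ y in Metric.closedBall (ι x) r, f y ∂surfaceMeasure N) := by
    intro x
    by_cases hx : x ∈ t
    · simp only [ht, Set.mem_ofPred_eq, BallMeansLE, not_forall, not_le] at hx
      obtain ⟨r, hr, hlt⟩ := hx
      -- The covering lemma needs bounded radii. A ball of radius 4 is the whole sphere, so capping
      -- r keeps the integral and only lowers the other side.
      refine ⟨min r 4, by positivity, min_le_right _ _, fun _ => ?_⟩
      rcases le_total r 4 with h | h
      · rwa [min_eq_left h]
      · rw [min_eq_right h]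
        have h1 : Metric.closedBall (ι x) r ⊆ Metric.closedBall (ι x) 4 := fun y _ =>
          (dist_sphere_le_two y (ι x)).trans (by norm_num)
        calc ENNReal.ofReal (α * 4 ^ N) ≤ ENNReal.ofReal (α * r ^ N) := by gcongr
          _ < _ := hlt
          _ ≤ _ := lintegral_mono_set h1
    · exact ⟨1, one_pos, by norm_num, fun h => absurd h hx⟩
  choose r hr0 hr4 hr using hex
  obtain ⟨u, hut, hdis, hcov⟩ := Vitali.exists_disjoint_subfamily_covering_enlargement_closedBall
    t ι r 4 (fun x _ => hr4 x) 5 (by norm_num)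
  have hcount : u.Countable := by
    refine hdis.countable_of_nonempty_interior fun x _ => ?_
    exact ⟨ι x, Metric.ball_subset_interior_closedBall (Metric.mem_ball_self (hr0 x))⟩
  -- The selected disjoint balls are centred at ι b; as ι is an isometry, the enlarged balls centred
  -- at b cover t.
  have hsub : t ⊆ ⋃ b ∈ u, Metric.closedBall b (5 * r b) := by
    intro x hx
    obtain ⟨b, hb, hxb⟩ := hcov x hx
    refine Set.mem_biUnion hb ?_
    have := hxb (Metric.mem_closedBall_self (hr0 x).le)
    rwa [Metric.mem_closedBall, hι.dist_eq] at this
  calc surfaceMeasure N t ≤ ∑' b : u, surfaceMeasure N (Metric.closedBall (b : USphere N) (5 * r b)) :=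
        (measure_mono hsub).trans (measure_biUnion_le _ hcount _)
    _ ≤ ∑' b : u, ENNReal.ofReal (C * 5 ^ N / α) *
          ∫⁻ y in Metric.closedBall (ι b) (r b), f y ∂surfaceMeasure N := by
        refine ENNReal.tsum_le_tsum fun b => ?_
        refine (hball b _ (by have := hr0 b; positivity)).trans ?_
        have h1 : C * (5 * r b) ^ N = C * 5 ^ N / α * (α * r b ^ N) := by
          rw [mul_pow]; field_simp
        rw [h1, ENNReal.ofReal_mul (by positivity)]
        gcongr
        exact (hr b (hut b.2)).le
    _ = ENNReal.ofReal (C * 5 ^ N / α) *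
          ∫⁻ y in ⋃ b ∈ u, Metric.closedBall (ι b) (r b), f y ∂surfaceMeasure N := by
        rw [ENNReal.tsum_mul_left, lintegral_biUnion hcount
          (fun b _ => Metric.isClosed_closedBall.measurableSet) hdis]
    _ ≤ _ := by
        gcongr
        exact Measure.restrict_le_self

/-- Cauchy–Schwarz: means of `f` are controlled by means of its square. -/
theorem exists_ballMeansLE_of_sq (N : ℕ) : ∃ C : ℝ, 0 < C ∧ ∀ (f : USphere N → ENNReal) (m : ℝ)
    (z : USphere N), AEMeasurable f (surfaceMeasure N) → 0 ≤ m →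
    BallMeansLE (fun y => f y ^ 2) (m ^ 2 / C) z → BallMeansLE f m z := by
  obtain ⟨C, hC, hball⟩ := exists_measure_closedBall_le N
  refine ⟨C, hC, fun f m z hf hm h r hr => ?_⟩
  have h1 := ENNReal.lintegral_mul_le_Lp_mul_Lq
    ((surfaceMeasure N).restrict (Metric.closedBall z r)) Real.HolderConjugate.two_two
    hf.restrict (g := fun _ => 1) aemeasurable_const
  simp only [Pi.mul_apply, mul_one, ENNReal.one_rpow, lintegral_const, one_mul,
    Measure.restrict_apply_univ] at h1
  have h2 := h r hr
  have h2' : ∫⁻ y in Metric.closedBall z r, f y ^ (2 : ℝ) ∂surfaceMeasure N ≤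
      ENNReal.ofReal (m ^ 2 / C * r ^ N) := by simpa using h2
  refine h1.trans ?_
  calc _ ≤ ENNReal.ofReal (m ^ 2 / C * r ^ N) ^ (1 / 2 : ℝ) * ENNReal.ofReal (C * r ^ N) ^ (1 / 2 : ℝ) := by
        gcongr
        exact hball z r hr
    _ = ENNReal.ofReal (m * r ^ N) := by
        rw [← ENNReal.mul_rpow_of_nonneg _ _ (by norm_num), ← ENNReal.ofReal_mul (by positivity),
          show m ^ 2 / C * r ^ N * (C * r ^ N) = (m * r ^ N) ^ 2 by field_simp,
          ENNReal.ofReal_rpow_of_nonneg (by positivity) (by norm_num), ← Real.sqrt_eq_rpow,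
          Real.sqrt_sq (by positivity)]

/-! ### Kernel operators controlled by means over balls. -/

/-- A decreasing profile with a moderate singularity and integrable decay. -/
noncomputable def profile (n : ℕ) (u : ℝ) : ℝ := if u ≤ 1 then (u ^ n)⁻¹ else (u ^ (n + 2))⁻¹

theorem lintegral_profile_mul_le (n : ℕ) {f : USphere (n + 1) → ENNReal}
    (hf : AEMeasurable f (surfaceMeasure (n + 1))) {m h : ℝ} (hm : 0 ≤ m) (hh : 0 < h)
    {z : USphere (n + 1)} (hz : BallMeansLE f m z) :
    ∫⁻ y, ENNReal.ofReal (profile n (h * dist y z)) * f y ∂surfaceMeasure (n + 1) ≤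
      ENNReal.ofReal (2 ^ (n + 3) * m / h ^ (n + 1)) := by
  let B : ℝ → Set (USphere (n + 1)) := fun r => Metric.closedBall z r
  have hBm : ∀ r, MeasurableSet (B r) := fun r => Metric.isClosed_closedBall.measurableSet
  -- The profile is dominated by dyadic layers on balls, with weights 2^((i+1)n) inside and
  -- 2^(−i(n+2)) outside. Against ball means of order r^(n+1) both series are geometric with ratio
  -- 1/2, since n < n + 1 < n + 2.
  have hpt : ∀ y, ENNReal.ofReal (profile n (h * dist y z)) * f y ≤
      (∑' i : ℕ, (B ((1 / 2) ^ i / h)).indicator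
        (fun y => ENNReal.ofReal (2 ^ ((i + 1) * n)) * f y) y) +
      ∑' i : ℕ, (B (2 ^ (i + 1) / h)).indicator
        (fun y => ENNReal.ofReal ((1 / 2) ^ (i * (n + 2))) * f y) y := by
    intro y
    rcases le_or_gt (h * dist y z) 1 with hu | hu
    · rw [profile, if_pos hu]
      refine le_trans ?_ le_self_add
      have hd : 0 ≤ h * dist y z := by positivity
      rcases hd.eq_or_lt with h0 | h0
      · refine le_trans ?_ (ENNReal.le_tsum 0)
        have hmem : y ∈ B ((1 / 2) ^ 0 / h) := by
          change dist y z ≤ _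
          rw [pow_zero, le_div_iff₀ hh, mul_comm]; exact hu
        rw [Set.indicator_of_mem hmem, ← h0]
        gcongr
        -- At the centre the profile takes the value 1 for n = 0 and the default value 0⁻¹ = 0 for n
        -- > 0.
        rcases Nat.eq_zero_or_pos n with rfl | hn
        · simp
        · rw [zero_pow hn.ne', inv_zero]; positivity
      · obtain ⟨i, hi1, hi2⟩ := exists_nat_pow_near_of_lt_one h0 hu (y := (1 / 2 : ℝ)) (by norm_num)
          (by norm_num)
        refine le_trans ?_ (ENNReal.le_tsum i)
        have hmem : y ∈ B ((1 / 2) ^ i / h) := by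
          change dist y z ≤ _
          rw [le_div_iff₀ hh, mul_comm]; exact hi2
        rw [Set.indicator_of_mem hmem]
        gcongr
        rw [pow_mul, ← inv_pow]
        have : (h * dist y z)⁻¹ ≤ 2 ^ (i + 1) := by
          rw [inv_le_comm₀ h0 (by positivity), ← one_div, ← one_div_pow]; exact hi1.le
        gcongr
    · rw [profile, if_neg (not_le.mpr hu)]
      refine le_trans ?_ le_add_self
      obtain ⟨i, hi1, hi2⟩ := exists_nat_pow_near hu.le (y := (2 : ℝ)) (by norm_num)
      refine le_trans ?_ (ENNReal.le_tsum i)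
      have hmem : y ∈ B (2 ^ (i + 1) / h) := by
        change dist y z ≤ _
        rw [le_div_iff₀ hh, mul_comm]; exact hi2.le
      rw [Set.indicator_of_mem hmem]
      gcongr
      rw [pow_mul, ← inv_pow]
      have : (h * dist y z)⁻¹ ≤ (1 / 2) ^ i := by
        rw [one_div_pow, one_div]
        gcongr
      gcongr
  have hterm : ∀ (r c : ℝ), 0 < r → 0 ≤ c →
      ∫⁻ y, (B r).indicator (fun y => ENNReal.ofReal c * f y) y ∂surfaceMeasure (n + 1) ≤
        ENNReal.ofReal (c * (m * r ^ (n + 1))) := by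
    intro r c hr hc
    rw [lintegral_indicator (hBm r), lintegral_const_mul'' _ hf.restrict, ENNReal.ofReal_mul hc]
    gcongr
    exact hz r hr
  have hae : ∀ (r c : ℝ), AEMeasurable (fun y => (B r).indicator
      (fun y => ENNReal.ofReal c * f y) y) (surfaceMeasure (n + 1)) := fun r c =>
    (hf.const_mul _).indicator (hBm r)
  have hs : ∀ D : ℝ, 0 ≤ D → ∑' i : ℕ, ENNReal.ofReal (D * (1 / 2) ^ i) = ENNReal.ofReal (2 * D) := by
    intro D hD
    rw [← ENNReal.ofReal_tsum_of_nonneg (fun i => by positivity)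
      (summable_geometric_two.mul_left D), tsum_mul_left, tsum_geometric_two, mul_comm]
  calc _ ≤ _ := lintegral_mono hpt
    _ = (∑' i : ℕ, ∫⁻ y, (B ((1 / 2) ^ i / h)).indicator
          (fun y => ENNReal.ofReal (2 ^ ((i + 1) * n)) * f y) y ∂surfaceMeasure (n + 1)) +
        ∑' i : ℕ, ∫⁻ y, (B (2 ^ (i + 1) / h)).indicator
          (fun y => ENNReal.ofReal ((1 / 2) ^ (i * (n + 2))) * f y) y ∂surfaceMeasure (n + 1) := by
        rw [lintegral_add_left' (AEMeasurable.tsum fun i => hae _ _),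
          lintegral_tsum fun i => hae _ _, lintegral_tsum fun i => hae _ _]
    _ ≤ (∑' i : ℕ, ENNReal.ofReal (2 ^ n * m / h ^ (n + 1) * (1 / 2) ^ i)) +
        ∑' i : ℕ, ENNReal.ofReal (2 ^ (n + 1) * m / h ^ (n + 1) * (1 / 2) ^ i) := by
        refine add_le_add (ENNReal.tsum_le_tsum fun i => ?_) (ENNReal.tsum_le_tsum fun i => ?_)
        · refine (hterm _ _ (by positivity) (by positivity)).trans_eq ?_
          congr 1
          have h2 : (2 : ℝ) ^ (i * n) * (1 / 2) ^ (i * n) = 1 := by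
            rw [← mul_pow]; norm_num
          rw [div_pow, ← pow_mul, add_mul, pow_add, one_mul, mul_add, pow_add, mul_one]
          calc _ = (2 : ℝ) ^ (i * n) * (1 / 2) ^ (i * n) * (2 ^ n * m / h ^ (n + 1) * (1 / 2) ^ i) := by
                ring
            _ = _ := by rw [h2, one_mul]
        · refine (hterm _ _ (by positivity) (by positivity)).trans_eq ?_
          congr 1
          have h2 : (2 : ℝ) ^ (i * (n + 1)) * (1 / 2) ^ (i * (n + 1)) = 1 := by
            rw [← mul_pow]; norm_num
          rw [div_pow _ h, ← pow_mul, show (i + 1) * (n + 1) = i * (n + 1) + (n + 1) by ring, pow_add,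
            show i * (n + 2) = i * (n + 1) + i by ring, pow_add]
          calc _ = (2 : ℝ) ^ (i * (n + 1)) * (1 / 2) ^ (i * (n + 1)) *
                (2 ^ (n + 1) * m / h ^ (n + 1) * (1 / 2) ^ i) := by ring
            _ = _ := by rw [h2, one_mul]
    _ ≤ _ := by
        rw [hs _ (by positivity), hs _ (by positivity), ← ENNReal.ofReal_add (by positivity) (by positivity)]
        refine ENNReal.ofReal_le_ofReal ?_
        have : 2 * (2 ^ n * m / h ^ (n + 1)) + 2 * (2 ^ (n + 1) * m / h ^ (n + 1)) =
          6 * (2 ^ n * m / h ^ (n + 1)) := by rw [pow_succ]; ring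
        rw [this, show 2 ^ (n + 3) * m / h ^ (n + 1) = 8 * (2 ^ n * m / h ^ (n + 1)) by ring]
        have : 0 ≤ 2 ^ n * m / h ^ (n + 1) := by positivity
        linarith

/-- Here s stands for √(1 − t²) and u for the distance to the nearer pole. For hu ≤ 1 the
singularity u^(−n/2) is weakened to u^(−n), which is still integrable; for hu > 1 the factor
(hu)^(n/2) ≥ 1 is given away. -/
theorem le_mul_profile (n : ℕ) {k s u a h : ℝ} (hk : 0 ≤ k) (hu : 0 < u) (hus : u ≤ 2 * s)
    (ha : 0 ≤ a) (hh : 0 < h) (h1 : k * s ^ ((n : ℝ) / 2) ≤ a)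
    (h2 : k * s ^ ((n : ℝ) / 2) * (h * s) ^ (n + 2) ≤ a) :
    k ≤ 2 ^ (2 * n + 2) * a * h ^ ((n : ℝ) / 2) * profile n (h * u) := by
  have hs : 0 < s := by linarith
  have hhu : 0 < h * u := by positivity
  have hν : (0 : ℝ) ≤ (n : ℝ) / 2 := by positivity
  have h2n : (2 : ℝ) ^ ((n : ℝ) / 2) ≤ 2 ^ n := by
    rw [← Real.rpow_natCast]
    exact Real.rpow_le_rpow_of_exponent_le (by norm_num) (by linarith)
  have hpow : (h * u) ^ ((n : ℝ) / 2) ≤ h ^ ((n : ℝ) / 2) * (2 ^ n * s ^ ((n : ℝ) / 2)) := by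
    rw [Real.mul_rpow hh.le hu.le]
    gcongr
    calc u ^ ((n : ℝ) / 2) ≤ (2 * s) ^ ((n : ℝ) / 2) := by gcongr
      _ = 2 ^ ((n : ℝ) / 2) * s ^ ((n : ℝ) / 2) := Real.mul_rpow (by norm_num) hs.le
      _ ≤ _ := by gcongr
  have hw : 0 < h ^ ((n : ℝ) / 2) := Real.rpow_pos_of_pos hh _
  rcases le_or_gt (h * u) 1 with hle | hlt
  · rw [profile, if_pos hle, ← div_eq_mul_inv, le_div_iff₀ (by positivity)]
    calc k * (h * u) ^ n ≤ k * (h * u) ^ ((n : ℝ) / 2) := by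
          gcongr
          rw [← Real.rpow_natCast]
          exact Real.rpow_le_rpow_of_exponent_ge hhu hle (by linarith)
      _ ≤ k * (h ^ ((n : ℝ) / 2) * (2 ^ n * s ^ ((n : ℝ) / 2))) := by gcongr
      _ = 2 ^ n * (k * s ^ ((n : ℝ) / 2)) * h ^ ((n : ℝ) / 2) := by ring
      _ ≤ 2 ^ n * a * h ^ ((n : ℝ) / 2) := by gcongr
      _ ≤ _ := by
          gcongr
          · norm_num
          · omega
  · rw [profile, if_neg (not_le.mpr hlt), ← div_eq_mul_inv, le_div_iff₀ (by positivity)]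
    have h3 : (1 : ℝ) ≤ (h * u) ^ ((n : ℝ) / 2) := Real.one_le_rpow hlt.le hν
    calc k * (h * u) ^ (n + 2) ≤ k * ((h * u) ^ ((n : ℝ) / 2) * (h * u) ^ (n + 2)) := by
          gcongr
          exact le_mul_of_one_le_left (by positivity) h3
      _ ≤ k * ((h ^ ((n : ℝ) / 2) * (2 ^ n * s ^ ((n : ℝ) / 2))) * (h * (2 * s)) ^ (n + 2)) := by
          gcongr
      _ = 2 ^ (2 * n + 2) * (k * s ^ ((n : ℝ) / 2) * (h * s) ^ (n + 2)) * h ^ ((n : ℝ) / 2) := by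
          rw [show h * (2 * s) = 2 * (h * s) by ring, mul_pow 2 (h * s), show 2 * n + 2 = n + (n + 2) by ring,
            pow_add 2 n]
          ring
      _ ≤ _ := by gcongr

theorem measure_sphere_singleton (n : ℕ) (z : USphere (n + 1)) :
    surfaceMeasure (n + 1) {z} = 0 := by
  obtain ⟨C, hC, hball⟩ := exists_measure_closedBall_le (n + 1)
  have h1 : Tendsto (fun r : ℝ => ENNReal.ofReal (C * r ^ (n + 1))) (𝓝[>] 0) (𝓝 0) := by
    have : Tendsto (fun r : ℝ => ENNReal.ofReal (C * r ^ (n + 1))) (𝓝 0)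
        (𝓝 (ENNReal.ofReal (C * 0 ^ (n + 1)))) :=
      (ENNReal.continuous_ofReal.comp (by fun_prop)).tendsto _
    simp only [zero_pow (Nat.succ_ne_zero n), mul_zero, ENNReal.ofReal_zero] at this
    exact this.mono_left nhdsWithin_le_nhds
  refine le_antisymm (ge_of_tendsto h1 ?_) zero_le
  filter_upwards [self_mem_nhdsWithin] with r hr
  refine (measure_mono ?_).trans (hball z r hr)
  simpa using (Set.mem_Ioi.mp hr).le

/-- Integral operators whose kernels have a moderate singularity at the diagonal and the
antidiagonal are controlled by means over balls. -/
theorem exists_abs_integral_mul_kernel_le (n : ℕ) : ∃ C : ℝ, 0 < C ∧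
    ∀ (K : ℝ → ℝ) (a h : ℝ), 0 ≤ a → 0 < h →
    (∀ t, |t| < 1 → |K t| * Real.sqrt (1 - t ^ 2) ^ ((n : ℝ) / 2) ≤ a) →
    (∀ t, |t| < 1 → |K t| * Real.sqrt (1 - t ^ 2) ^ ((n : ℝ) / 2) *
      (h * Real.sqrt (1 - t ^ 2)) ^ (n + 2) ≤ a) →
    ∀ (f : USphere (n + 1) → ℝ) (m : ℝ) (x : USphere (n + 1)),
      AEStronglyMeasurable f (surfaceMeasure (n + 1)) → 0 ≤ m →
      BallMeansLE (fun y => ‖f y‖ₑ) m x → BallMeansLE (fun y => ‖f y‖ₑ) m (-x) →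
      |∫ y, f y * K (inner ℝ (x : Ambient (n + 1)) y) ∂surfaceMeasure (n + 1)| ≤
        C * (a * m * h ^ (-((n : ℝ) / 2 + 1))) := by
  refine ⟨2 ^ (2 * n + 2) * 2 ^ (n + 4), by positivity,
    fun K a h ha hh hK1 hK2 f m x hf hm hx hx' => ?_⟩
  set b := 2 ^ (2 * n + 2) * a * h ^ ((n : ℝ) / 2) with hb
  have hb0 : 0 ≤ b := by positivity
  have hprof : ∀ u : ℝ, 0 ≤ u → 0 ≤ profile n u := by
    intro u hu
    unfold profile
    split_ifs <;> positivity
  have hpt : ∀ᵐ y ∂surfaceMeasure (n + 1),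
      ‖f y * K (inner ℝ (x : Ambient (n + 1)) y)‖ₑ ≤
        ENNReal.ofReal b * (ENNReal.ofReal (profile n (h * dist y x)) * ‖f y‖ₑ +
          ENNReal.ofReal (profile n (h * dist y (-x))) * ‖f y‖ₑ) := by
    have n1 : ∀ z, ∀ᵐ y ∂surfaceMeasure (n + 1), y ≠ z := fun z =>
      measure_eq_zero_iff_ae_notMem.mp (measure_sphere_singleton n z)
    filter_upwards [n1 x, n1 (-x)] with y hy1 hy2
    set t := inner ℝ (x : Ambient (n + 1)) y with ht
    have d1 : dist y x ^ 2 = 2 - 2 * t := by rw [dist_comm, sphere_dist_sq]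
    have d2 : dist y (-x) ^ 2 = 2 + 2 * t := by
      rw [dist_comm, sphere_dist_sq]
      simp [ht, inner_neg_left]
    have p1 : 0 < dist y x := dist_pos.mpr hy1
    have p2 : 0 < dist y (-x) := dist_pos.mpr hy2
    have ht1 : |t| < 1 := abs_lt.mpr ⟨by nlinarith, by nlinarith⟩
    -- The kernel may be singular at x and at −x. The sign of t decides which is nearer, and the
    -- distance to that one is at most 2√(1 − t²).
    have key : |K t| ≤ b * (profile n (h * dist y x) + profile n (h * dist y (-x))) := by
      rcases le_total 0 t with h0 | h0
      · have := le_mul_profile n (abs_nonneg (K t)) p1 (s := Real.sqrt (1 - t ^ 2)) (by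
          have : dist y x / 2 ≤ Real.sqrt (1 - t ^ 2) := Real.le_sqrt_of_sq_le (by
            rw [div_pow, d1]; nlinarith [abs_lt.mp ht1])
          linarith) ha hh (hK1 t ht1) (hK2 t ht1)
        have h3 := mul_nonneg hb0 (hprof (h * dist y (-x)) (by positivity))
        rw [← hb] at this
        linarith
      · have := le_mul_profile n (abs_nonneg (K t)) p2 (s := Real.sqrt (1 - t ^ 2)) (by
          have : dist y (-x) / 2 ≤ Real.sqrt (1 - t ^ 2) := Real.le_sqrt_of_sq_le (by
            rw [div_pow, d2]; nlinarith [abs_lt.mp ht1])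
          linarith) ha hh (hK1 t ht1) (hK2 t ht1)
        have h3 := mul_nonneg hb0 (hprof (h * dist y x) (by positivity))
        rw [← hb] at this
        linarith
    rw [enorm_mul, mul_comm, ← add_mul, ← mul_assoc,
      ← ENNReal.ofReal_add (hprof _ (by positivity)) (hprof _ (by positivity)),
      ← ENNReal.ofReal_mul hb0, Real.enorm_eq_ofReal_abs (K t)]
    gcongr
  have hfm : AEMeasurable (fun y => ‖f y‖ₑ) (surfaceMeasure (n + 1)) := hf.enorm
  have hm1 : Measurable (profile n) :=
    Measurable.ite measurableSet_Iic (by fun_prop) (by fun_prop)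
  have hmeas : ∀ z, AEMeasurable (fun y => ENNReal.ofReal (profile n (h * dist y z)) * ‖f y‖ₑ)
      (surfaceMeasure (n + 1)) := by
    intro z
    refine AEMeasurable.mul ?_ hfm
    have : Measurable fun y : USphere (n + 1) => h * dist y z :=
      (continuous_const.mul (continuous_id.dist continuous_const)).measurable
    exact (ENNReal.measurable_ofReal.comp (hm1.comp this)).aemeasurable
  have hfin : ‖∫ y, f y * K (inner ℝ (x : Ambient (n + 1)) y) ∂surfaceMeasure (n + 1)‖ₑ ≤
      ENNReal.ofReal (b * (2 * (2 ^ (n + 3) * m / h ^ (n + 1)))) := by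
    calc _ ≤ _ := enorm_integral_le_lintegral_enorm _
      _ ≤ _ := lintegral_mono_ae hpt
      _ = ENNReal.ofReal b *
          (∫⁻ y, ENNReal.ofReal (profile n (h * dist y x)) * ‖f y‖ₑ ∂surfaceMeasure (n + 1) +
          ∫⁻ y, ENNReal.ofReal (profile n (h * dist y (-x))) * ‖f y‖ₑ ∂surfaceMeasure (n + 1)) := by
        have := lintegral_const_mul'' (ENNReal.ofReal b) ((hmeas x).add (hmeas (-x)))
        simp only [Pi.add_apply] at this
        rw [this, lintegral_add_left' (hmeas _)]
      _ ≤ ENNReal.ofReal b * (ENNReal.ofReal (2 ^ (n + 3) * m / h ^ (n + 1)) +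
          ENNReal.ofReal (2 ^ (n + 3) * m / h ^ (n + 1))) := by
        gcongr
        · exact lintegral_profile_mul_le n hfm hm hh hx
        · exact lintegral_profile_mul_le n hfm hm hh hx'
      _ = _ := by
        rw [← ENNReal.ofReal_add (by positivity) (by positivity), ← ENNReal.ofReal_mul hb0, two_mul]
  rw [Real.enorm_eq_ofReal_abs, ENNReal.ofReal_le_ofReal_iff (by positivity)] at hfin
  refine hfin.trans_eq ?_
  have e : h ^ ((n : ℝ) / 2) / h ^ (n + 1) = h ^ (-((n : ℝ) / 2 + 1)) := by
    rw [← Real.rpow_natCast h (n + 1), ← Real.rpow_sub hh]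
    congr 1
    push_cast
    ring
  rw [← e, hb]
  ring

theorem eigval_succ (n k : ℕ) : eigval (n + 1) k = (k : ℝ) * (k + n) := by
  unfold eigval
  push_cast
  ring

/-! ### Weak type bounds and their interpolation. -/

/-- The maximal function of a family of operators is of weak type `(q, q)`. -/
def WeakType {N : ℕ} {I : Type*} (q c : ℝ) (T : I → (USphere N → ℝ) → USphere N → ℝ) : Prop :=
  ∀ f, MemLp f (ENNReal.ofReal q) (surfaceMeasure N) → ∀ β : ℝ, 0 < β →
    surfaceMeasure N {x | ∃ i, β < |T i f x|} ≤
      ENNReal.ofReal (c / β ^ q) * ∫⁻ y, ‖f y‖ₑ ^ q ∂surfaceMeasure N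

theorem WeakType.mono {N : ℕ} {I : Type*} {q c c' : ℝ} {T : I → (USphere N → ℝ) → USphere N → ℝ}
    (h : WeakType q c T) (hc : c ≤ c') : WeakType q c' T := by
  intro f hf β hβ
  refine (h f hf β hβ).trans ?_
  gcongr

/-- Operators controlled by the means over balls are of weak types `(1, 1)` and `(2, 2)`. -/
theorem exists_weakType_of_ballMeansLE (N : ℕ) : ∃ C : ℝ, 0 < C ∧
    ∀ {I : Type*} (T : I → (USphere N → ℝ) → USphere N → ℝ) (D : ℝ), 0 < D →
    (∀ f, Integrable f (surfaceMeasure N) → ∀ (m : ℝ) (x : USphere N), 0 ≤ m →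
      BallMeansLE (fun y => ‖f y‖ₑ) m x → BallMeansLE (fun y => ‖f y‖ₑ) m (-x) →
      ∀ i, |T i f x| ≤ D * m) →
    WeakType 1 (C * D) T ∧ WeakType 2 (C * D ^ 2) T := by
  obtain ⟨C₁, hC₁, h₁⟩ := exists_measure_not_ballMeansLE_le N
  obtain ⟨C₂, hC₂, h₂⟩ := exists_ballMeansLE_of_sq N
  refine ⟨max (2 * C₁) (2 * C₁ * C₂), by positivity, fun {I} T D hD hT => ?_⟩
  have hneg : Isometry (fun x : USphere N => -x) := by
    refine Isometry.of_dist_eq fun x y => ?_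
    rw [Subtype.dist_eq, Subtype.dist_eq]
    simp
  have hsub : ∀ f, Integrable f (surfaceMeasure N) → ∀ β : ℝ, 0 < β →
      {x | ∃ i, β < |T i f x|} ⊆ {x | ¬ BallMeansLE (fun y => ‖f y‖ₑ) (β / D) x} ∪
        {x | ¬ BallMeansLE (fun y => ‖f y‖ₑ) (β / D) (-x)} := by
    rintro f hf β hβ x ⟨i, hi⟩
    by_contra hcon
    simp only [Set.mem_union, Set.mem_ofPred_eq, not_or, not_not] at hcon
    have := hT f hf (β / D) x (by positivity) hcon.1 hcon.2 i
    rw [mul_div_cancel₀ _ hD.ne'] at this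
    exact absurd hi (not_lt.mpr this)
  constructor
  · refine WeakType.mono (c := 2 * C₁ * D) ?_ (by gcongr; exact le_max_left _ _)
    intro f hf β hβ
    have hf1 : Integrable f (surfaceMeasure N) := by
      rw [← memLp_one_iff_integrable]; simpa using hf
    have e1 := h₁ id isometry_id (fun y => ‖f y‖ₑ) (β / D) (by positivity)
    have e2 := h₁ _ hneg (fun y => ‖f y‖ₑ) (β / D) (by positivity)
    refine (measure_mono (hsub f hf1 β hβ)).trans ((measure_union_le _ _).trans
      ((add_le_add e1 e2).trans_eq ?_))
    rw [← two_mul, ← mul_assoc]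
    simp only [ENNReal.rpow_one, Real.rpow_one]
    congr 1
    rw [show (2 : ENNReal) = ENNReal.ofReal 2 by simp, ← ENNReal.ofReal_mul (by norm_num)]
    congr 1
    field_simp
  · refine WeakType.mono (c := 2 * C₁ * C₂ * D ^ 2) ?_ (by gcongr; exact le_max_right _ _)
    intro f hf β hβ
    have hf2 : MemLp f 2 (surfaceMeasure N) := by simpa using hf
    have hf1 : Integrable f (surfaceMeasure N) := hf2.integrable (by norm_num)
    have e1 := h₁ id isometry_id (fun y => ‖f y‖ₑ ^ 2) ((β / D) ^ 2 / C₂) (by positivity)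
    have e2 := h₁ _ hneg (fun y => ‖f y‖ₑ ^ 2) ((β / D) ^ 2 / C₂) (by positivity)
    have hs : ∀ z, ¬ BallMeansLE (fun y => ‖f y‖ₑ) (β / D) z →
        ¬ BallMeansLE (fun y => ‖f y‖ₑ ^ 2) ((β / D) ^ 2 / C₂) z := fun z hz h =>
      hz (h₂ _ _ _ hf1.1.enorm (by positivity) h)
    refine (measure_mono (hsub f hf1 β hβ)).trans ((measure_union_le _ _).trans
      ((add_le_add ((measure_mono fun x hx => hs x hx).trans e1)
        ((measure_mono fun x hx => hs (-x) hx).trans e2)).trans_eq ?_))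
    rw [← two_mul, ← mul_assoc]
    simp only [← ENNReal.rpow_natCast, Nat.cast_ofNat]
    congr 1
    rw [show (2 : ENNReal) = ENNReal.ofReal 2 by simp, ← ENNReal.ofReal_mul (by norm_num)]
    congr 1
    rw [show β ^ (2 : ℝ) = β ^ 2 by norm_cast]
    field_simp

/-- Interpolation between weak types `(1, 1)` and `(2, 2)`. -/
theorem WeakType.interpolate {N : ℕ} {I : Type*} {T : I → (USphere N → ℝ) → USphere N → ℝ}
    {c A p : ℝ} (hc : 0 < c) (hA : 0 < A) (h1 : WeakType 1 (c * A) T) (h2 : WeakType 2 c T)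
    (hadd : ∀ f g, Integrable f (surfaceMeasure N) → Integrable g (surfaceMeasure N) →
      ∀ i x, T i (f + g) x = T i f x + T i g x) (hp1 : 1 ≤ p) (hp2 : p ≤ 2) :
    WeakType p (6 * c * A ^ (2 - p)) T := by
  intro f hf β hβ
  -- Truncating f at height Aβ balances the two parts: the large part under weak type (1, 1) and the
  -- small part under weak type (2, 2) both give c A^(2−p) β^(−p), with factors 2 and 4.
  set γ := A * β with hγ
  have hγ0 : 0 < γ := by positivity
  have hf1 : Integrable f (surfaceMeasure N) := by
    refine hf.integrable ?_
    rw [← ENNReal.ofReal_one]; exact ENNReal.ofReal_le_ofReal hp1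
  -- A strongly measurable representative makes the set where |f'| > γ measurable.
  obtain ⟨f', hf'm, hff'⟩ := hf1.1
  have hs : MeasurableSet {x | γ < |f' x|} := measurableSet_lt measurable_const hf'm.measurable.abs
  set s := {x | γ < |f' x|} with hsdef
  have hU : s.indicator f + sᶜ.indicator f = f := Set.indicator_self_add_compl s f
  have hi1 : Integrable (s.indicator f) (surfaceMeasure N) := hf1.indicator hs
  have hi2 : Integrable (sᶜ.indicator f) (surfaceMeasure N) := hf1.indicator hs.compl
  have hb2 : ∀ᵐ x ∂surfaceMeasure N, ‖sᶜ.indicator f x‖ ≤ γ := by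
    filter_upwards [hff'] with x hx
    by_cases h : x ∈ s
    · rw [Set.indicator_of_notMem (by simpa using h)]; simpa using hγ0.le
    · rw [Set.indicator_of_mem (by simpa using h), hx]
      exact not_lt.mp h
  have hm2 : MemLp (sᶜ.indicator f) (ENNReal.ofReal 2) (surfaceMeasure N) :=
    MemLp.of_bound hi2.1 γ hb2
  have hm1 : MemLp (s.indicator f) (ENNReal.ofReal 1) (surfaceMeasure N) := by
    simpa [memLp_one_iff_integrable] using hi1
  have hsub : {x | ∃ i, β < |T i f x|} ⊆ {x | ∃ i, β / 2 < |T i (s.indicator f) x|} ∪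
      {x | ∃ i, β / 2 < |T i (sᶜ.indicator f) x|} := by
    rintro x ⟨i, hi⟩
    by_contra hcon
    simp only [Set.mem_union, Set.mem_ofPred_eq, not_or, not_exists, not_lt] at hcon
    have h3 := hadd _ _ hi1 hi2 i x
    rw [hU] at h3
    rw [h3] at hi
    linarith [abs_add_le (T i (s.indicator f) x) (T i (sᶜ.indicator f) x), hcon.1 i, hcon.2 i]
  have hI1 : ∫⁻ y, ‖s.indicator f y‖ₑ ^ (1 : ℝ) ∂surfaceMeasure N ≤
      ENNReal.ofReal (γ ^ (1 - p)) * ∫⁻ y, ‖f y‖ₑ ^ p ∂surfaceMeasure N := by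
    rw [← lintegral_const_mul'' _ (hf1.1.enorm.pow_const p)]
    refine lintegral_mono_ae ?_
    filter_upwards [hff'] with x hx
    by_cases h : x ∈ s
    · rw [Set.indicator_of_mem h]
      have hlt : γ < |f x| := by rw [hx]; exact h
      have h0 : 0 < |f x| := hγ0.trans hlt
      rw [Real.enorm_eq_ofReal_abs, ENNReal.ofReal_rpow_of_pos h0, ENNReal.ofReal_rpow_of_pos h0,
        ← ENNReal.ofReal_mul (by positivity)]
      refine ENNReal.ofReal_le_ofReal ?_
      calc |f x| ^ (1 : ℝ) = |f x| ^ (1 - p) * |f x| ^ p := by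
            rw [← Real.rpow_add h0]; congr 1; ring
        _ ≤ γ ^ (1 - p) * |f x| ^ p := by
            gcongr ?_ * _
            exact Real.rpow_le_rpow_of_nonpos hγ0 hlt.le (by linarith)
    · rw [Set.indicator_of_notMem h]; simp
  have hI2 : ∫⁻ y, ‖sᶜ.indicator f y‖ₑ ^ (2 : ℝ) ∂surfaceMeasure N ≤
      ENNReal.ofReal (γ ^ (2 - p)) * ∫⁻ y, ‖f y‖ₑ ^ p ∂surfaceMeasure N := by
    rw [← lintegral_const_mul'' _ (hf1.1.enorm.pow_const p)]
    refine lintegral_mono_ae ?_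
    filter_upwards [hff'] with x hx
    by_cases h : x ∈ s
    · rw [Set.indicator_of_notMem (by simpa using h)]; simp
    · rw [Set.indicator_of_mem (by simpa using h)]
      have hle : |f x| ≤ γ := by rw [hx]; exact not_lt.mp h
      rcases eq_or_ne (f x) 0 with h0 | h0
      · rw [h0]; simp
      have h0 : 0 < |f x| := abs_pos.mpr h0
      rw [Real.enorm_eq_ofReal_abs, ENNReal.ofReal_rpow_of_pos h0, ENNReal.ofReal_rpow_of_pos h0,
        ← ENNReal.ofReal_mul (by positivity)]
      refine ENNReal.ofReal_le_ofReal ?_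
      calc |f x| ^ (2 : ℝ) = |f x| ^ (2 - p) * |f x| ^ p := by
            rw [← Real.rpow_add h0]; congr 1; ring
        _ ≤ γ ^ (2 - p) * |f x| ^ p := by
            gcongr ?_ * _
            exact Real.rpow_le_rpow h0.le hle (by linarith)
  have e1 := h1 _ hm1 (β / 2) (by positivity)
  have e2 := h2 _ hm2 (β / 2) (by positivity)
  calc surfaceMeasure N {x | ∃ i, β < |T i f x|} ≤ _ := (measure_mono hsub).trans (measure_union_le _ _)
    _ ≤ _ := add_le_add e1 e2
    _ ≤ ENNReal.ofReal (c * A / (β / 2) ^ (1 : ℝ)) *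
          (ENNReal.ofReal (γ ^ (1 - p)) * ∫⁻ y, ‖f y‖ₑ ^ p ∂surfaceMeasure N) +
        ENNReal.ofReal (c / (β / 2) ^ (2 : ℝ)) *
          (ENNReal.ofReal (γ ^ (2 - p)) * ∫⁻ y, ‖f y‖ₑ ^ p ∂surfaceMeasure N) := by gcongr
    _ = _ := by
        rw [← mul_assoc, ← mul_assoc, ← add_mul, ← ENNReal.ofReal_mul (by positivity),
          ← ENNReal.ofReal_mul (by positivity), ← ENNReal.ofReal_add (by positivity) (by positivity)]
        congr 2
        have g1 : γ ^ (1 - p) = A ^ (2 - p) / A * (β / β ^ p) := by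
          rw [hγ, Real.mul_rpow hA.le hβ.le, Real.rpow_sub hβ, Real.rpow_one,
            show 1 - p = (2 - p) - 1 by ring, Real.rpow_sub hA, Real.rpow_one]
        have g2 : γ ^ (2 - p) = A ^ (2 - p) * (β ^ 2 / β ^ p) := by
          rw [hγ, Real.mul_rpow hA.le hβ.le, Real.rpow_sub hβ]
          norm_cast
        rw [g1, g2, Real.rpow_one, show (β / 2) ^ (2 : ℝ) = (β / 2) ^ 2 by norm_cast]
        have : β ^ p ≠ 0 := (Real.rpow_pos_of_pos hβ p).ne'
        field_simp
        ring

/-! ### Bounds for the dyadic pieces and for single terms. -/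

theorem seriesTerm_add (hY : IsHarmonicSystem (n + 1) Y) {f g : USphere (n + 1) → ℝ}
    (hf : Integrable f (surfaceMeasure (n + 1))) (hg : Integrable g (surfaceMeasure (n + 1)))
    (k : ℕ) (x : USphere (n + 1)) :
    seriesTerm Y (f + g) k x = seriesTerm Y f k x + seriesTerm Y g k x := by
  rw [seriesTerm_eq_integral hY (hf.add hg), seriesTerm_eq_integral hY hf,
    seriesTerm_eq_integral hY hg, ← mul_add, ← integral_add
    (integrable_mul_continuous hf (continuous_zonal_inner n k x))
    (integrable_mul_continuous hg (continuous_zonal_inner n k x))]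
  simp only [Pi.add_apply, add_mul]

theorem sum_mul_seriesTerm_eq_integral (hY : IsHarmonicSystem (n + 1) Y)
    {f : USphere (n + 1) → ℝ} (hf : Integrable f (surfaceMeasure (n + 1))) (s : Finset ℕ)
    (a : ℕ → ℝ) (x : USphere (n + 1)) :
    ∑ k ∈ s, a k * seriesTerm Y f k x = (sphereArea (n + 1))⁻¹ *
      ∫ y, f y * (∑ k ∈ s, a k * zonal ((n : ℝ) / 2) k (inner ℝ (x : Ambient (n + 1)) y))
        ∂surfaceMeasure (n + 1) := by
  simp only [seriesTerm_eq_integral hY hf, Finset.mul_sum]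
  rw [integral_finsetSum, Finset.mul_sum]
  · refine Finset.sum_congr rfl fun k _ => ?_
    rw [show (fun y : USphere (n + 1) => f y * (a k * zonal ((n : ℝ) / 2) k
      (inner ℝ (x : Ambient (n + 1)) y))) = fun y => a k * (f y * zonal ((n : ℝ) / 2) k
      (inner ℝ (x : Ambient (n + 1)) y)) from funext fun y => by ring, integral_const_mul]
    ring
  · intro k _
    exact integrable_mul_continuous hf (continuous_const.mul (continuous_zonal_inner n k x))

/-- The dyadic pieces of the Riesz means. -/
noncomputable def bandSum (Y : (k : ℕ) → Fin (harmonicDim (n + 1) k) → USphere (n + 1) → ℝ)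
    (ψ : ℝ → ℝ) (j : ℕ) (l : ℝ) (f : USphere (n + 1) → ℝ) (x : USphere (n + 1)) : ℝ :=
  ∑ k ∈ Finset.range ⌈l⌉₊, ψ (2 ^ j * (1 - (k : ℝ) * (k + n) / l)) * seriesTerm Y f k x

theorem band_eq_zero {ψ : ℝ → ℝ} (hsupp : ∀ w, ψ w ≠ 0 → 1 / 2 ≤ w ∧ w ≤ 2) (n j : ℕ) {l : ℝ}
    (hl : 0 < l) {k : ℕ} (hk : ⌈l⌉₊ ≤ k) : ψ (2 ^ j * (1 - (k : ℝ) * (k + n) / l)) = 0 := by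
  by_contra hne
  have h1 := (hsupp _ hne).1
  have hlk : l ≤ k := Nat.ceil_le.mp hk
  have hk1 : (1 : ℝ) ≤ k := by
    have : 0 < k := by
      rcases Nat.eq_zero_or_pos k with rfl | h
      · simp at hlk; linarith
      · exact h
    exact_mod_cast this
  have h2 : 1 ≤ (k : ℝ) * (k + n) / l := by
    rw [le_div_iff₀ hl]
    have : (0 : ℝ) ≤ n := n.cast_nonneg
    nlinarith
  have h3 : (2 : ℝ) ^ j * (1 - (k : ℝ) * (k + n) / l) ≤ 0 :=
    mul_nonpos_of_nonneg_of_nonpos (by positivity) (by linarith)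
  linarith

/-- The kernel bound for M = 0 and M = n + 2 is what `exists_abs_integral_mul_kernel_le` requires,
with a a constant times h √l^ν. The outcome is h √l^ν h^(−ν−1) = (√l/h)^ν = 2^(jν), independent of
l. -/
theorem exists_abs_bandSum_le (hY : IsHarmonicSystem (n + 1) Y) {ψ : ℝ → ℝ} (hψ : ContDiff ℝ ∞ ψ)
    (hsupp : ∀ w, ψ w ≠ 0 → 1 / 2 ≤ w ∧ w ≤ 2) : ∃ C : ℝ, 0 < C ∧ ∀ (j : ℕ) (l : ℝ), 4 ^ j ≤ l →
    ∀ f, Integrable f (surfaceMeasure (n + 1)) → ∀ (m : ℝ) (x : USphere (n + 1)), 0 ≤ m →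
      BallMeansLE (fun y => ‖f y‖ₑ) m x → BallMeansLE (fun y => ‖f y‖ₑ) m (-x) →
      |bandSum Y ψ j l f x| ≤ C * (2 : ℝ) ^ (j * ((n : ℝ) / 2)) * m := by
  obtain ⟨C₁, hC₁, hk1⟩ := multiplier_kernel_bound n 0 hψ hsupp
  obtain ⟨C₂, hC₂, hk2⟩ := multiplier_kernel_bound n (n + 2) hψ hsupp
  obtain ⟨C₃, hC₃, hK⟩ := exists_abs_integral_mul_kernel_le n
  have hA := sphereArea_pos (n + 1)
  refine ⟨(sphereArea (n + 1))⁻¹ * (C₃ * max C₁ C₂), by positivity,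
    fun j l hl f hf m x hm hx hx' => ?_⟩
  have hl0 : 0 < l := lt_of_lt_of_le (by positivity) hl
  have hsl : 0 < Real.sqrt l := Real.sqrt_pos.mpr hl0
  set h := Real.sqrt l / 2 ^ j with hh
  have hh0 : 0 < h := by positivity
  have hz : ∀ k ≥ ⌈l⌉₊, ψ (2 ^ j * (1 - (k : ℝ) * (k + n) / l)) = 0 := fun k hk =>
    band_eq_zero hsupp n j hl0 hk
  set K : ℝ → ℝ := fun t => ∑ k ∈ Finset.range ⌈l⌉₊,
    ψ (2 ^ j * (1 - (k : ℝ) * (k + n) / l)) * zonal ((n : ℝ) / 2) k t with hKdef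
  set a := max C₁ C₂ * h * Real.sqrt l ^ ((n : ℝ) / 2) with ha
  have ha0 : 0 ≤ a := by positivity
  have hCa : ∀ {c : ℝ}, c ≤ max C₁ C₂ → c * h * Real.sqrt l ^ ((n : ℝ) / 2) ≤ a := by
    intro c hc
    rw [ha]
    gcongr
  have b1 : ∀ t, |t| < 1 → |K t| * Real.sqrt (1 - t ^ 2) ^ ((n : ℝ) / 2) ≤ a := by
    intro t ht
    have := hk1 j l hl _ hz t ht
    rw [pow_zero, mul_one] at this
    exact this.trans (hCa (le_max_left _ _))
  have b2 : ∀ t, |t| < 1 → |K t| * Real.sqrt (1 - t ^ 2) ^ ((n : ℝ) / 2) *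
      (h * Real.sqrt (1 - t ^ 2)) ^ (n + 2) ≤ a := by
    intro t ht
    exact (hk2 j l hl _ hz t ht).trans (hCa (le_max_right _ _))
  have := hK K a h ha0 hh0 b1 b2 f m x hf.1 hm hx hx'
  rw [bandSum, sum_mul_seriesTerm_eq_integral hY hf, abs_mul, abs_of_pos (inv_pos.mpr hA)]
  have e : h * Real.sqrt l ^ ((n : ℝ) / 2) * h ^ (-((n : ℝ) / 2 + 1)) = (2 : ℝ) ^ (j * ((n : ℝ) / 2)) := by
    rw [neg_add, Real.rpow_add hh0, Real.rpow_neg_one, Real.rpow_neg hh0.le, hh,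
      Real.div_rpow hsl.le (by positivity), Real.rpow_mul (by norm_num), Real.rpow_natCast]
    have : Real.sqrt l ^ ((n : ℝ) / 2) ≠ 0 := (Real.rpow_pos_of_pos hsl _).ne'
    have : ((2 : ℝ) ^ j) ^ ((n : ℝ) / 2) ≠ 0 := (Real.rpow_pos_of_pos (by positivity) _).ne'
    field_simp
  calc _ ≤ (sphereArea (n + 1))⁻¹ * (C₃ * (a * m * h ^ (-((n : ℝ) / 2 + 1)))) := by gcongr
    _ = _ := by rw [ha, ← e]; ring

/-- The same with h = 1: a single zonal function is only known to decay like s^(−ν), and on the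
sphere the extra factor s^(n+2) is at most 1. -/
theorem exists_abs_seriesTerm_le (hY : IsHarmonicSystem (n + 1) Y) : ∃ C : ℝ, 0 < C ∧
    ∀ (j k : ℕ), k < 2 ^ (j + 1) →
    ∀ f, Integrable f (surfaceMeasure (n + 1)) → ∀ (m : ℝ) (x : USphere (n + 1)), 0 ≤ m →
      BallMeansLE (fun y => ‖f y‖ₑ) m x → BallMeansLE (fun y => ‖f y‖ₑ) m (-x) →
      |seriesTerm Y f k x| ≤ C * (2 : ℝ) ^ (j * ((n : ℝ) / 2)) * m := by
  obtain ⟨C₁, hC₁, hk1⟩ := zonal_decay_sqrt n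
  obtain ⟨C₃, hC₃, hK⟩ := exists_abs_integral_mul_kernel_le n
  have hA := sphereArea_pos (n + 1)
  refine ⟨(sphereArea (n + 1))⁻¹ * (C₃ * (C₁ * 2 ^ ((n : ℝ) / 2))), by positivity,
    fun j k hjk f hf m x hm hx hx' => ?_⟩
  have hle : ((k : ℝ) + 1) ^ ((n : ℝ) / 2) ≤ 2 ^ ((n : ℝ) / 2) * 2 ^ (j * ((n : ℝ) / 2)) := by
    have h1 : (k : ℝ) + 1 ≤ 2 * 2 ^ j := by
      have : k + 1 ≤ 2 ^ (j + 1) := hjk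
      rw [pow_succ, mul_comm] at this
      exact_mod_cast this
    rw [Real.rpow_mul (by norm_num) (j : ℝ), Real.rpow_natCast, ← Real.mul_rpow (by norm_num) (by positivity)]
    gcongr
  set a := C₁ * (2 ^ ((n : ℝ) / 2) * 2 ^ (j * ((n : ℝ) / 2))) with ha
  have b1 : ∀ t, |t| < 1 → |zonal ((n : ℝ) / 2) k t| * Real.sqrt (1 - t ^ 2) ^ ((n : ℝ) / 2) ≤ a := by
    intro t ht
    refine (hk1 k t ht).trans ?_
    rw [ha]
    gcongr
  have b2 : ∀ t, |t| < 1 → |zonal ((n : ℝ) / 2) k t| * Real.sqrt (1 - t ^ 2) ^ ((n : ℝ) / 2) *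
      (1 * Real.sqrt (1 - t ^ 2)) ^ (n + 2) ≤ a := by
    intro t ht
    refine le_trans (mul_le_of_le_one_right (by positivity) ?_) (b1 t ht)
    rw [one_mul]
    refine pow_le_one₀ (Real.sqrt_nonneg _) (Real.sqrt_le_one.mpr ?_)
    nlinarith [sq_nonneg t]
  have := hK _ a 1 (by positivity) one_pos b1 b2 f m x hf.1 hm hx hx'
  rw [Real.one_rpow, mul_one] at this
  rw [seriesTerm_eq_integral hY hf, abs_mul, abs_of_pos (inv_pos.mpr hA)]
  calc _ ≤ (sphereArea (n + 1))⁻¹ * (C₃ * (a * m)) := by gcongr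
    _ = _ := by rw [ha]; ring

theorem lintegral_sq_eq {f : USphere (n + 1) → ℝ} (hf : MemLp f 2 (surfaceMeasure (n + 1))) :
    ∫⁻ y, ‖f y‖ₑ ^ (2 : ℝ) ∂surfaceMeasure (n + 1) =
      ENNReal.ofReal (∫ y, f y ^ 2 ∂surfaceMeasure (n + 1)) := by
  rw [ofReal_integral_eq_lintegral_ofReal hf.integrable_sq (Eventually.of_forall fun x => sq_nonneg _)]
  refine lintegral_congr fun y => ?_
  rw [Real.enorm_eq_ofReal_abs, ENNReal.ofReal_rpow_of_nonneg (abs_nonneg _) (by norm_num)]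
  norm_cast
  rw [sq_abs]

/-- The terms of degree below `2 ^ (j + 1)` are of weak type `(2, 2)` with a uniform constant. -/
theorem weakType_two_seriesTerm (hY : IsHarmonicSystem (n + 1) Y) (j : ℕ) :
    WeakType 2 1 fun (k : Fin (2 ^ (j + 1))) f x => seriesTerm Y f (k : ℕ) x := by
  intro f hf β hβ
  have hf2 : MemLp f 2 (surfaceMeasure (n + 1)) := by simpa using hf
  have hc := continuous_seriesTerm hY f
  have hS : Continuous fun x => ∑ k ∈ Finset.range (2 ^ (j + 1)), seriesTerm Y f k x ^ 2 :=
    continuous_finsetSum _ fun k _ => (hc k).pow 2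
  -- The maximum over k is dominated by the square function, whose norm Bessel's inequality bounds
  -- whatever the number of terms.
  have hsub : {x | ∃ k : Fin (2 ^ (j + 1)), β < |seriesTerm Y f (k : ℕ) x|} ⊆
      {x | β ^ 2 ≤ ∑ k ∈ Finset.range (2 ^ (j + 1)), seriesTerm Y f k x ^ 2} := by
    rintro x ⟨k, hk⟩
    refine le_trans ?_ (Finset.single_le_sum (f := fun k => seriesTerm Y f k x ^ 2)
      (fun i _ => sq_nonneg _) (Finset.mem_range.mpr k.2))
    rw [← sq_abs (seriesTerm Y f _ x)]
    gcongr
  have h1 := mul_meas_ge_le_integral_of_nonneg (μ := surfaceMeasure (n + 1))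
    (f := fun x => ∑ k ∈ Finset.range (2 ^ (j + 1)), seriesTerm Y f k x ^ 2)
    (Eventually.of_forall fun x => Finset.sum_nonneg fun k _ => sq_nonneg _)
    (integrable_of_continuous hS) (β ^ 2)
  rw [integral_finsetSum _ fun k _ => integrable_of_continuous
    (g := fun x => seriesTerm Y f k x ^ 2) ((hc k).pow 2)] at h1
  have h2 := h1.trans (sum_integral_seriesTerm_sq_le hY hf2 _)
  rw [lintegral_sq_eq hf2, ← ENNReal.ofReal_mul (by positivity)]
  refine (measure_mono hsub).trans ?_
  rw [← ENNReal.ofReal_toReal (measure_ne_top (surfaceMeasure (n + 1)) _)]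
  refine ENNReal.ofReal_le_ofReal ?_
  rw [show β ^ (2 : ℝ) = β ^ 2 by norm_cast, div_mul_eq_mul_div, one_mul, le_div_iff₀ (by positivity),
    mul_comm]
  exact h2

theorem deriv_ne_zero_supp {ψ : ℝ → ℝ} {a b : ℝ} (hsupp : ∀ w, ψ w ≠ 0 → a ≤ w ∧ w ≤ b) {w : ℝ}
    (hw : deriv ψ w ≠ 0) : a ≤ w ∧ w ≤ b := by
  have h1 : w ∈ tsupport ψ := support_deriv_subset hw
  have h2 : tsupport ψ ⊆ Set.Icc a b := closure_minimal (fun w hw => hsupp w hw) isClosed_Icc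
  exact h2 h1

/-- The Sobolev energy carried by a single eigenvalue L as r varies. The coefficient lives on L ≤ r
≤ L + 4L/q, and there the integrand is O(q/L), so q and L cancel. The condition q ≥ 4 yields the
upper end of the window. -/
theorem lintegral_band_coeff_le {ψ : ℝ → ℝ} (hsupp : ∀ w, ψ w ≠ 0 → 1 / 2 ≤ w ∧ w ≤ 2) {B B' : ℝ}
    (hB : ∀ w, |ψ w| ≤ B) (hB' : ∀ w, |deriv ψ w| ≤ B') {q L : ℝ} (hq : 4 ≤ q) (hL : 0 ≤ L) :
    ∫⁻ r in Set.Ioi (1 / 2 : ℝ), ENNReal.ofReal (q / r * ψ (q * (1 - L / r)) ^ 2 +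
      r / q * (deriv ψ (q * (1 - L / r)) * (q * L / r ^ 2)) ^ 2) ≤
      ENNReal.ofReal (4 * (B ^ 2 + B' ^ 2)) := by
  set c := q * (B ^ 2 + B' ^ 2) / L with hc
  have hloc : ∀ r : ℝ, 0 < r → (1 / 2 ≤ q * (1 - L / r) ∧ q * (1 - L / r) ≤ 2) →
      L ≤ r ∧ r ≤ L + 4 * L / q := by
    rintro r hr ⟨h1, h2⟩
    have h3 : r * (q * (1 - L / r)) = q * (r - L) := by field_simp
    have h4 : r * (1 / 2) ≤ q * (r - L) := by rw [← h3]; gcongr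
    have h5 : q * (r - L) ≤ r * 2 := by rw [← h3]; gcongr
    refine ⟨by nlinarith, ?_⟩
    rw [← sub_le_iff_le_add', le_div_iff₀ (by linarith)]
    nlinarith
  have hpt : ∀ r ∈ Set.Ioi (1 / 2 : ℝ), ENNReal.ofReal (q / r * ψ (q * (1 - L / r)) ^ 2 +
      r / q * (deriv ψ (q * (1 - L / r)) * (q * L / r ^ 2)) ^ 2) ≤
      (Set.Icc L (L + 4 * L / q)).indicator (fun _ => ENNReal.ofReal c) r := by
    intro r hr
    have hr0 : 0 < r := lt_trans (by norm_num) (Set.mem_Ioi.mp hr)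
    by_cases hmem : 1 / 2 ≤ q * (1 - L / r) ∧ q * (1 - L / r) ≤ 2
    · obtain ⟨m1, m2⟩ := hloc r hr0 hmem
      have hL0 : 0 < L := by
        rcases hL.eq_or_lt with h | h
        · rw [← h] at m2; simp at m2; linarith
        · exact h
      rw [Set.indicator_of_mem (Set.mem_Icc.mpr ⟨m1, m2⟩)]
      refine ENNReal.ofReal_le_ofReal ?_
      have s1 : ψ (q * (1 - L / r)) ^ 2 ≤ B ^ 2 := sq_le_sq' (abs_le.mp (hB _)).1 (abs_le.mp (hB _)).2
      have s2 : deriv ψ (q * (1 - L / r)) ^ 2 ≤ B' ^ 2 :=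
        sq_le_sq' (abs_le.mp (hB' _)).1 (abs_le.mp (hB' _)).2
      have i1 : q / r ≤ q / L := by gcongr
      have i2 : r / q * (q * L / r ^ 2) ^ 2 ≤ q / L := by
        have : r / q * (q * L / r ^ 2) ^ 2 = q * (L ^ 2 / r ^ 3) := by field_simp
        rw [this, div_eq_mul_one_div q]
        refine mul_le_mul_of_nonneg_left ?_ (by linarith)
        rw [div_le_div_iff₀ (by positivity) hL0, one_mul, ← pow_succ]
        gcongr
      calc _ = q / r * ψ (q * (1 - L / r)) ^ 2 +
            r / q * (q * L / r ^ 2) ^ 2 * deriv ψ (q * (1 - L / r)) ^ 2 := by ring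
        _ ≤ q / L * B ^ 2 + q / L * B' ^ 2 := by gcongr
        _ = c := by rw [hc]; ring
    · have z1 : ψ (q * (1 - L / r)) = 0 := by
        by_contra h; exact hmem (hsupp _ h)
      have z2 : deriv ψ (q * (1 - L / r)) = 0 := by
        by_contra h; exact hmem (deriv_ne_zero_supp hsupp h)
      rw [z1, z2]
      simp
  calc _ ≤ ∫⁻ r in Set.Ioi (1 / 2 : ℝ),
        (Set.Icc L (L + 4 * L / q)).indicator (fun _ => ENNReal.ofReal c) r :=
        setLIntegral_mono' measurableSet_Ioi hpt
    _ ≤ ∫⁻ r, (Set.Icc L (L + 4 * L / q)).indicator (fun _ => ENNReal.ofReal c) r :=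
        setLIntegral_le_lintegral _ _
    _ = ENNReal.ofReal c * ENNReal.ofReal (4 * L / q) := by
        rw [lintegral_indicator measurableSet_Icc, setLIntegral_const, Real.volume_Icc, add_sub_cancel_left]
    _ ≤ _ := by
        rw [← ENNReal.ofReal_mul' (by positivity)]
        refine ENNReal.ofReal_le_ofReal ?_
        rcases hL.eq_or_lt with h | h
        · rw [← h]; simp; positivity
        · rw [hc]
          refine le_of_eq ?_
          field_simp

theorem lintegral_ofReal_sum_seriesTerm_sq (hY : IsHarmonicSystem (n + 1) Y)
    (f : USphere (n + 1) → ℝ) (s : Finset ℕ) (a b : ℕ → ℝ) {u v : ℝ} (hu : 0 ≤ u) (hv : 0 ≤ v) :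
    ∫⁻ x, ENNReal.ofReal (u * (∑ k ∈ s, a k * seriesTerm Y f k x) ^ 2 +
        v * (∑ k ∈ s, b k * seriesTerm Y f k x) ^ 2) ∂surfaceMeasure (n + 1) =
      ∑ k ∈ s, ENNReal.ofReal (u * a k ^ 2 + v * b k ^ 2) *
        ENNReal.ofReal (∫ x, seriesTerm Y f k x ^ 2 ∂surfaceMeasure (n + 1)) := by
  have hc := continuous_seriesTerm hY f
  have hcs : ∀ a : ℕ → ℝ, Continuous fun x => (∑ k ∈ s, a k * seriesTerm Y f k x) ^ 2 := fun a =>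
    (continuous_finsetSum _ fun k _ => continuous_const.mul (hc k)).pow 2
  have hi1 : Integrable (fun x => u * (∑ k ∈ s, a k * seriesTerm Y f k x) ^ 2)
    (surfaceMeasure (n + 1)) := integrable_of_continuous (continuous_const.mul (hcs a))
  have hi2 : Integrable (fun x => v * (∑ k ∈ s, b k * seriesTerm Y f k x) ^ 2)
    (surfaceMeasure (n + 1)) := integrable_of_continuous (continuous_const.mul (hcs b))
  have hi : Integrable (fun x => u * (∑ k ∈ s, a k * seriesTerm Y f k x) ^ 2 +
      v * (∑ k ∈ s, b k * seriesTerm Y f k x) ^ 2) (surfaceMeasure (n + 1)) := hi1.add hi2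
  rw [← ofReal_integral_eq_lintegral_ofReal hi
    (Eventually.of_forall fun x => by positivity), integral_add hi1 hi2, integral_const_mul,
    integral_const_mul, integral_sum_seriesTerm_sq hY, integral_sum_seriesTerm_sq hY, Finset.mul_sum,
    Finset.mul_sum, ← Finset.sum_add_distrib, ENNReal.ofReal_sum_of_nonneg]
  · refine Finset.sum_congr rfl fun k _ => ?_
    rw [← ENNReal.ofReal_mul (by positivity)]
    congr 1; ring
  · intro k _
    have : 0 ≤ ∫ x, seriesTerm Y f k x ^ 2 ∂surfaceMeasure (n + 1) := integral_nonneg fun x => sq_nonneg _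
    positivity

/-- A one-dimensional Sobolev inequality. -/
theorem ofReal_sq_le_lintegral {T T' : ℝ → ℝ} {l q : ℝ} (hl : 1 / 2 ≤ l) (hq : 0 < q)
    (hT : ∀ r, 0 < r → HasDerivAt T (T' r) r) (hT' : ContinuousOn T' (Set.Ioi 0))
    (h0 : T (1 / 2) = 0) :
    ENNReal.ofReal (T l ^ 2) ≤
      ∫⁻ r in Set.Ioi (1 / 2 : ℝ), ENNReal.ofReal (q / r * T r ^ 2 + r / q * T' r ^ 2) := by
  have hsub : Set.uIcc (1 / 2 : ℝ) l ⊆ Set.Ioi 0 := by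
    rw [Set.uIcc_of_le hl]
    exact fun r hr => lt_of_lt_of_le (by norm_num) hr.1
  have hTc : ContinuousOn T (Set.Ioi 0) := fun r hr => (hT r hr).continuousAt.continuousWithinAt
  have hint : IntervalIntegrable (fun r => 2 * T r * T' r) volume (1 / 2) l :=
    (((continuousOn_const.mul hTc).mul hT').mono hsub).intervalIntegrable
  have h1 := intervalIntegral.integral_eq_sub_of_hasDerivAt (f := fun r => T r ^ 2)
    (f' := fun r => 2 * T r * T' r) (a := 1 / 2) (b := l) (fun r hr => by
      have := (hT r (hsub hr)).fun_pow 2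
      simpa using this) hint
  rw [h0, intervalIntegral.integral_of_le hl] at h1
  have h2 : T l ^ 2 = ∫ r in Set.Ioc (1 / 2 : ℝ) l, 2 * T r * T' r := by rw [h1]; ring
  calc ENNReal.ofReal (T l ^ 2) = ‖T l ^ 2‖ₑ := by
        rw [Real.enorm_eq_ofReal_abs, abs_of_nonneg (sq_nonneg _)]
    _ ≤ ∫⁻ r in Set.Ioc (1 / 2 : ℝ) l, ‖2 * T r * T' r‖ₑ := by
        rw [h2]; exact enorm_integral_le_lintegral_enorm _
    _ ≤ ∫⁻ r in Set.Ioc (1 / 2 : ℝ) l, ENNReal.ofReal (q / r * T r ^ 2 + r / q * T' r ^ 2) := by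
        refine setLIntegral_mono' measurableSet_Ioc fun r hr => ?_
        have hr0 : 0 < r := lt_trans (by norm_num) hr.1
        rw [Real.enorm_eq_ofReal_abs]
        refine ENNReal.ofReal_le_ofReal ?_
        set w := q / r with hw
        have hw0 : 0 < w := by positivity
        have e : r / q = w⁻¹ := by rw [hw, inv_div]
        rw [e]
        -- The weight q/r matches the scale of a dyadic piece, whose r-derivative has order q/r.
        have key : w * T r ^ 2 + w⁻¹ * T' r ^ 2 - 2 * (|T r| * |T' r|) =
            w * (|T r| - w⁻¹ * |T' r|) ^ 2 := by
          rw [← sq_abs (T r), ← sq_abs (T' r)]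
          field_simp
          ring
        have : 0 ≤ w * (|T r| - w⁻¹ * |T' r|) ^ 2 := by positivity
        rw [abs_mul, abs_mul, abs_two]
        linarith
    _ ≤ _ := lintegral_mono_set fun r hr => hr.1

theorem bandSum_eq_of_le {ψ : ℝ → ℝ} (hsupp : ∀ w, ψ w ≠ 0 → 1 / 2 ≤ w ∧ w ≤ 2) (j : ℕ) {l : ℝ}
    (hl : 0 < l) (f : USphere (n + 1) → ℝ) (x : USphere (n + 1)) {K : ℕ} (hK : ⌈l⌉₊ ≤ K) :
    bandSum Y ψ j l f x =
      ∑ k ∈ Finset.range K, ψ (2 ^ j * (1 - (k : ℝ) * (k + n) / l)) * seriesTerm Y f k x := by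
  rw [bandSum]
  refine Finset.sum_subset (Finset.range_mono hK) fun k _ hk => ?_
  rw [band_eq_zero hsupp n j hl (by simpa using hk), zero_mul]

/-- The Sobolev inequality in r bounds the squared supremum over l by an integral over r.
Integrating over the sphere first, orthogonality decouples the eigenvalues, each has bounded energy,
and Bessel's inequality sums them; the constant is independent of j. -/
theorem exists_weakType_two_bandSum (hY : IsHarmonicSystem (n + 1) Y) {ψ : ℝ → ℝ}
    (hψ : ContDiff ℝ ∞ ψ) (hsupp : ∀ w, ψ w ≠ 0 → 1 / 2 ≤ w ∧ w ≤ 2) : ∃ C : ℝ, 0 < C ∧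
    ∀ j : ℕ, 2 ≤ j → WeakType 2 C fun (l : Set.Ici ((4 : ℝ) ^ j)) f x => bandSum Y ψ j l f x := by
  have hcs : HasCompactSupport ψ := HasCompactSupport.of_support_subset_isCompact
    (isCompact_Icc (a := (1 / 2 : ℝ)) (b := 2)) fun w hw => hsupp w hw
  obtain ⟨B, hB0, hB⟩ := exists_bound_iteratedDeriv hψ hcs 0
  obtain ⟨B', hB'0, hB'⟩ := exists_bound_iteratedDeriv hψ hcs 1
  simp only [iteratedDeriv_zero] at hB
  simp only [iteratedDeriv_one] at hB'
  refine ⟨4 * (B ^ 2 + B' ^ 2), by positivity, fun j hj f hf β hβ => ?_⟩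
  have hf2 : MemLp f 2 (surfaceMeasure (n + 1)) := by simpa using hf
  have hc := continuous_seriesTerm hY f
  set q : ℝ := 2 ^ j with hq
  have hq4 : 4 ≤ q := by
    calc (4 : ℝ) = 2 ^ 2 := by norm_num
      _ ≤ 2 ^ j := pow_le_pow_right₀ (by norm_num) hj
  have hψd : ∀ w, HasDerivAt ψ (deriv ψ w) w := fun w =>
    (hψ.contDiffAt.differentiableAt (by simp)).hasDerivAt
  have hψ'c : Continuous (deriv ψ) := hψ.continuous_deriv (by simp)
  let a : ℕ → ℝ → ℝ := fun k r => ψ (q * (1 - (k : ℝ) * (k + n) / r))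
  let b : ℕ → ℝ → ℝ := fun k r => deriv ψ (q * (1 - (k : ℝ) * (k + n) / r)) *
    (q * ((k : ℝ) * (k + n)) / r ^ 2)
  have ham : ∀ k, Measurable (a k) := fun k => hψ.continuous.measurable.comp (by fun_prop)
  have hbm : ∀ k, Measurable (b k) := fun k =>
    (hψ'c.measurable.comp (by fun_prop)).mul (by fun_prop)
  -- K fixes the range of summation, so that one finite sum serves all l with ⌈l⌉₊ ≤ K. All bounds
  -- are uniform in K, which finally tends to infinity.
  let F : ℕ → USphere (n + 1) → ℝ → ENNReal := fun K x r =>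
    ENNReal.ofReal (q / r * (∑ k ∈ Finset.range K, a k r * seriesTerm Y f k x) ^ 2 +
      r / q * (∑ k ∈ Finset.range K, b k r * seriesTerm Y f k x) ^ 2)
  have hmeas : ∀ K, Measurable (Function.uncurry (F K)) := by
    intro K
    have h1 : ∀ k, Measurable fun z : USphere (n + 1) × ℝ => seriesTerm Y f k z.1 := fun k =>
      (hc k).measurable.comp measurable_fst
    have h2 : ∀ k, Measurable fun z : USphere (n + 1) × ℝ => a k z.2 := fun k =>
      (ham k).comp measurable_snd
    have h3 : ∀ k, Measurable fun z : USphere (n + 1) × ℝ => b k z.2 := fun k =>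
      (hbm k).comp measurable_snd
    refine ENNReal.measurable_ofReal.comp ?_
    fun_prop
  have hF : ∀ K, ∫⁻ x, (∫⁻ r in Set.Ioi (1 / 2 : ℝ), F K x r) ∂surfaceMeasure (n + 1) ≤
      ENNReal.ofReal (4 * (B ^ 2 + B' ^ 2)) *
        ∫⁻ y, ‖f y‖ₑ ^ (2 : ℝ) ∂surfaceMeasure (n + 1) := by
    intro K
    rw [lintegral_lintegral_swap (hmeas K).aemeasurable]
    calc _ = ∫⁻ r in Set.Ioi (1 / 2 : ℝ), ∑ k ∈ Finset.range K,
            ENNReal.ofReal (q / r * a k r ^ 2 + r / q * b k r ^ 2) *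
              ENNReal.ofReal (∫ x, seriesTerm Y f k x ^ 2 ∂surfaceMeasure (n + 1)) := by
          refine setLIntegral_congr_fun measurableSet_Ioi fun r hr => ?_
          have hr0 : 0 < r := lt_trans (by norm_num) (Set.mem_Ioi.mp hr)
          exact lintegral_ofReal_sum_seriesTerm_sq hY f _ (fun k => a k r) (fun k => b k r)
            (by positivity) (by positivity)
      _ = ∑ k ∈ Finset.range K, (∫⁻ r in Set.Ioi (1 / 2 : ℝ),
            ENNReal.ofReal (q / r * a k r ^ 2 + r / q * b k r ^ 2)) *
              ENNReal.ofReal (∫ x, seriesTerm Y f k x ^ 2 ∂surfaceMeasure (n + 1)) := by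
          have hm : ∀ k, Measurable fun r => ENNReal.ofReal (q / r * a k r ^ 2 + r / q * b k r ^ 2) := by
            intro k
            have := ham k
            have := hbm k
            exact ENNReal.measurable_ofReal.comp (by fun_prop)
          rw [lintegral_finsetSum _ fun k _ => (hm k).mul_const _]
          refine Finset.sum_congr rfl fun k _ => ?_
          rw [lintegral_mul_const _ (hm k)]
      _ ≤ ∑ k ∈ Finset.range K, ENNReal.ofReal (4 * (B ^ 2 + B' ^ 2)) *
              ENNReal.ofReal (∫ x, seriesTerm Y f k x ^ 2 ∂surfaceMeasure (n + 1)) := by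
          gcongr with k
          exact lintegral_band_coeff_le hsupp hB hB' hq4 (by positivity)
      _ = ENNReal.ofReal (4 * (B ^ 2 + B' ^ 2)) *
            ENNReal.ofReal (∑ k ∈ Finset.range K, ∫ x, seriesTerm Y f k x ^ 2 ∂surfaceMeasure (n + 1)) := by
          rw [← Finset.mul_sum, ENNReal.ofReal_sum_of_nonneg fun k _ =>
            integral_nonneg fun x => sq_nonneg _]
      _ ≤ _ := by
          rw [lintegral_sq_eq hf2]
          gcongr
          exact sum_integral_seriesTerm_sq_le hY hf2 _
  have hpt : ∀ (K : ℕ) (x : USphere (n + 1)) (l : ℝ), 4 ^ j ≤ l → ⌈l⌉₊ ≤ K →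
      ENNReal.ofReal (bandSum Y ψ j l f x ^ 2) ≤ ∫⁻ r in Set.Ioi (1 / 2 : ℝ), F K x r := by
    intro K x l hl hK
    have hl1 : 1 ≤ l := le_trans (one_le_pow₀ (by norm_num)) hl
    rw [bandSum_eq_of_le hsupp j (by linarith) f x hK]
    refine ofReal_sq_le_lintegral (q := q) (T := fun r => ∑ k ∈ Finset.range K, a k r * seriesTerm Y f k x)
      (T' := fun r => ∑ k ∈ Finset.range K, b k r * seriesTerm Y f k x)
      (by linarith) (by linarith) ?_ ?_ ?_
    · intro r hr
      refine HasDerivAt.fun_sum fun k _ => HasDerivAt.mul_const ?_ _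
      have h1 : HasDerivAt (fun r : ℝ => q * (1 - (k : ℝ) * (k + n) / r))
          (q * ((k : ℝ) * (k + n)) / r ^ 2) r := by
        have := (((hasDerivAt_inv hr.ne').const_mul ((k : ℝ) * (k + n))).const_sub 1).const_mul q
        refine (this.congr_deriv ?_).congr_of_eventuallyEq ?_
        · field_simp
        · exact Eventually.of_forall fun r => by simp only [div_eq_mul_inv]
      exact (hψd _).comp r h1
    · refine continuousOn_finsetSum _ fun k _ => ContinuousOn.mul ?_ continuousOn_const
      have hne : ∀ r ∈ Set.Ioi (0 : ℝ), r ≠ 0 := fun r hr => (Set.mem_Ioi.mp hr).ne'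
      have hne2 : ∀ r ∈ Set.Ioi (0 : ℝ), r ^ 2 ≠ 0 := fun r hr => pow_ne_zero _ (hne r hr)
      refine ContinuousOn.mul (hψ'c.comp_continuousOn ?_) (continuousOn_const.div (by fun_prop) hne2)
      exact continuousOn_const.mul (continuousOn_const.sub (continuousOn_const.div continuousOn_id hne))
    · refine Finset.sum_eq_zero fun k _ => ?_
      -- At r = 1/2 the argument of ψ is q ≥ 4 for k = 0 and at most 0 for k ≥ 1, outside [1/2, 2]
      -- in both cases.
      have : a k (1 / 2) = 0 := by
        by_contra hne
        obtain ⟨h1, h2⟩ := hsupp _ hne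
        rcases Nat.eq_zero_or_pos k with rfl | hk
        · simp at h2; linarith
        · have hk1 : (1 : ℝ) ≤ k := by exact_mod_cast hk
          have hn0 : (0 : ℝ) ≤ n := n.cast_nonneg
          have h3 : q * (1 - (k : ℝ) * (k + n) / (1 / 2)) ≤ 0 :=
            mul_nonpos_of_nonneg_of_nonpos (by linarith) (by
              have : (1 : ℝ) ≤ k * (k + n) := by nlinarith
              linarith)
          linarith
      rw [this, zero_mul]
  have hK : ∀ K : ℕ, surfaceMeasure (n + 1) {x | ∃ l : Set.Ici ((4 : ℝ) ^ j), ⌈(l : ℝ)⌉₊ ≤ K ∧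
      β < |bandSum Y ψ j l f x|} ≤ ENNReal.ofReal (4 * (B ^ 2 + B' ^ 2) / β ^ (2 : ℝ)) *
        ∫⁻ y, ‖f y‖ₑ ^ (2 : ℝ) ∂surfaceMeasure (n + 1) := by
    intro K
    have hsub : {x | ∃ l : Set.Ici ((4 : ℝ) ^ j), ⌈(l : ℝ)⌉₊ ≤ K ∧ β < |bandSum Y ψ j l f x|} ⊆
        {x | ENNReal.ofReal (β ^ 2) ≤ ∫⁻ r in Set.Ioi (1 / 2 : ℝ), F K x r} := by
      rintro x ⟨l, hlK, hlt⟩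
      refine le_trans (ENNReal.ofReal_le_ofReal ?_) (hpt K x l l.2 hlK)
      rw [← sq_abs (bandSum Y ψ j l f x)]
      gcongr
    have hβ2 : ENNReal.ofReal (β ^ 2) ≠ 0 := by simpa using hβ.ne'
    refine (measure_mono hsub).trans ((meas_ge_le_lintegral_div
      (hmeas K).lintegral_prod_right'.aemeasurable hβ2 ENNReal.ofReal_ne_top).trans ?_)
    rw [ENNReal.div_eq_inv_mul, ← ENNReal.ofReal_inv_of_pos (by positivity)]
    calc _ ≤ ENNReal.ofReal (β ^ 2)⁻¹ * (ENNReal.ofReal (4 * (B ^ 2 + B' ^ 2)) *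
        ∫⁻ y, ‖f y‖ₑ ^ (2 : ℝ) ∂surfaceMeasure (n + 1)) := by gcongr; exact hF K
      _ = _ := by
        rw [← mul_assoc, ← ENNReal.ofReal_mul (by positivity), show β ^ (2 : ℝ) = β ^ 2 by norm_cast]
        congr 2
        ring
  have hU : {x | ∃ l : Set.Ici ((4 : ℝ) ^ j), β < |bandSum Y ψ j l f x|} =
      ⋃ K : ℕ, {x | ∃ l : Set.Ici ((4 : ℝ) ^ j), ⌈(l : ℝ)⌉₊ ≤ K ∧ β < |bandSum Y ψ j l f x|} := by
    ext x
    simp only [Set.mem_iUnion, Set.mem_ofPred_eq]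
    exact ⟨fun ⟨l, hl⟩ => ⟨_, l, le_rfl, hl⟩, fun ⟨_, l, _, hl⟩ => ⟨l, hl⟩⟩
  rw [hU, Monotone.measure_iUnion]
  · exact iSup_le hK
  · rintro K K' hKK' x ⟨l, h1, h2⟩
    exact ⟨l, h1.trans hKK', h2⟩

/-! ### Dyadic decomposition of the Riesz means. -/

/-- A smooth function with compact support in `(0, ∞)` whose dyadic dilates sum to `x ^ s`
near `0`. -/
noncomputable def dyadicBump (s x : ℝ) : ℝ :=
  x ^ s * (Real.smoothTransition (2 * x - 1) - Real.smoothTransition (x - 1))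

theorem dyadicBump_supp (s : ℝ) {x : ℝ} (hx : dyadicBump s x ≠ 0) : 1 / 2 ≤ x ∧ x ≤ 2 := by
  by_contra hcon
  apply hx
  unfold dyadicBump
  rcases lt_or_ge x (1 / 2) with h | h
  · rw [Real.smoothTransition.zero_of_nonpos (by linarith),
      Real.smoothTransition.zero_of_nonpos (by linarith), sub_zero, mul_zero]
  · have h2 : 2 < x := by
      by_contra h2
      exact hcon ⟨h, not_lt.mp h2⟩
    rw [Real.smoothTransition.one_of_one_le (by linarith),
      Real.smoothTransition.one_of_one_le (by linarith), sub_self, mul_zero]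

theorem contDiff_dyadicBump (s : ℝ) : ContDiff ℝ ∞ (dyadicBump s) := by
  rw [contDiff_iff_contDiffAt]
  intro x
  rcases lt_or_ge x (1 / 2) with h | h
  · refine (contDiffAt_const (c := (0 : ℝ))).congr_of_eventuallyEq ?_
    filter_upwards [Iio_mem_nhds h] with y hy
    by_contra hne
    exact absurd (dyadicBump_supp s hne).1 (not_le.mpr hy)
  · refine ContDiffAt.mul (Real.contDiffAt_rpow_const_of_ne (by linarith)) (ContDiffAt.sub ?_ ?_)
    · exact ContDiffAt.comp x Real.smoothTransition.contDiffAt (by fun_prop)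
    · exact ContDiffAt.comp x Real.smoothTransition.contDiffAt (by fun_prop)

/-- The j-th term equals v^s (χ(2^(j+1)v − 1) − χ(2^j v − 1)), with χ the smooth transition, so the
sum telescopes; v ≤ 1 makes the first cutoff vanish. -/
theorem rpow_eq_sum_dyadicBump (s : ℝ) {v : ℝ} (hv : 0 < v) (hv1 : v ≤ 1) (J : ℕ) :
    v ^ s = ∑ j ∈ Finset.range J, (2 : ℝ) ^ (-(j * s)) * dyadicBump s (2 ^ j * v) +
      v ^ s * (1 - Real.smoothTransition (2 ^ J * v - 1)) := by
  induction J with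
  | zero =>
    rw [Real.smoothTransition.zero_of_nonpos (by simpa using hv1)]
    simp
  | succ J ih =>
    rw [Finset.sum_range_succ]
    have h1 : (2 : ℝ) ^ (-(J * s)) * dyadicBump s (2 ^ J * v) = v ^ s *
        (Real.smoothTransition (2 ^ (J + 1) * v - 1) - Real.smoothTransition (2 ^ J * v - 1)) := by
      rw [dyadicBump, Real.mul_rpow (by positivity) hv.le, Real.rpow_neg (by norm_num),
        Real.rpow_mul (by norm_num), Real.rpow_natCast, pow_succ,
        show 2 * (2 ^ J * v) = 2 ^ J * 2 * v by ring]
      have : ((2 : ℝ) ^ J) ^ s ≠ 0 := (Real.rpow_pos_of_pos (by positivity) _).ne'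
      field_simp
    rw [h1]
    linear_combination ih

theorem rieszMean_real (s l : ℝ) (f : USphere (n + 1) → ℝ) (x : USphere (n + 1)) :
    rieszMean Y s l f x = ∑ k ∈ indicesBelow (n + 1) l,
      (1 - (k : ℝ) * (k + n) / l) ^ s * seriesTerm Y f k x := by
  simp only [rieszMean, RCLike.ofReal_real_eq_id, id, eigval_succ]

theorem bandSum_eq_sum_indicesBelow {ψ : ℝ → ℝ} (hsupp : ∀ w, ψ w ≠ 0 → 1 / 2 ≤ w ∧ w ≤ 2) (j : ℕ)
    {l : ℝ} (hl : 0 < l) (f : USphere (n + 1) → ℝ) (x : USphere (n + 1)) :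
    bandSum Y ψ j l f x = ∑ k ∈ indicesBelow (n + 1) l,
      ψ (2 ^ j * (1 - (k : ℝ) * (k + n) / l)) * seriesTerm Y f k x := by
  rw [bandSum]
  symm
  refine Finset.sum_subset (Finset.filter_subset _ _) fun k _ hk => ?_
  rw [mem_indicesBelow (by omega) hl, eigval_succ, not_lt] at hk
  have : ψ (2 ^ j * (1 - (k : ℝ) * (k + n) / l)) = 0 := by
    by_contra hne
    have h1 := (hsupp _ hne).1
    have h2 : 1 ≤ (k : ℝ) * (k + n) / l := (one_le_div hl).mpr hk
    have h3 : (2 : ℝ) ^ j * (1 - (k : ℝ) * (k + n) / l) ≤ 0 :=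
      mul_nonpos_of_nonneg_of_nonpos (by positivity) (by linarith)
    linarith
  rw [this, zero_mul]

/-- With 4^J comparable to l the decomposition stops after J pieces. The remainder lives where 1 −
λ_k/l < 2/2^J: at most 3√l/2^J ≤ 6 indices, all below 2^(J+1), each with coefficient at most 2^s
2^(−Js). -/
theorem abs_rieszMean_le {s : ℝ} (hs : 0 ≤ s) {l : ℝ} {J : ℕ} (hJ : (4 : ℝ) ^ J ≤ l)
    (hJ' : l < 4 ^ (J + 1)) (f : USphere (n + 1) → ℝ) (x : USphere (n + 1)) {B : ℝ}
    (hB : ∀ k : ℕ, k < 2 ^ (J + 1) → |seriesTerm Y f k x| ≤ B) :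
    |rieszMean Y s l f x| ≤
      ∑ j ∈ Finset.range J, (2 : ℝ) ^ (-(j * s)) * |bandSum Y (dyadicBump s) j l f x| +
        6 * 2 ^ s * (2 : ℝ) ^ (-(J * s)) * B := by
  have hl : 0 < l := lt_of_lt_of_le (by positivity) hJ
  have hB0 : 0 ≤ B := (abs_nonneg _).trans (hB 0 (by positivity))
  have hv : ∀ k ∈ indicesBelow (n + 1) l, 0 < 1 - (k : ℝ) * (k + n) / l ∧
      1 - (k : ℝ) * (k + n) / l ≤ 1 := by
    intro k hk
    rw [mem_indicesBelow (by omega) hl, eigval_succ] at hk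
    have h1 : (k : ℝ) * (k + n) / l < 1 := (div_lt_one hl).mpr hk
    have h2 : 0 ≤ (k : ℝ) * (k + n) / l := by positivity
    exact ⟨by linarith, by linarith⟩
  set R := ∑ k ∈ indicesBelow (n + 1) l, (1 - (k : ℝ) * (k + n) / l) ^ s *
    (1 - Real.smoothTransition (2 ^ J * (1 - (k : ℝ) * (k + n) / l) - 1)) * seriesTerm Y f k x with hR
  have hdec : rieszMean Y s l f x =
      ∑ j ∈ Finset.range J, (2 : ℝ) ^ (-(j * s)) * bandSum Y (dyadicBump s) j l f x + R := by
    simp only [bandSum_eq_sum_indicesBelow (fun w => dyadicBump_supp s) _ hl, Finset.mul_sum]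
    rw [Finset.sum_comm, hR, ← Finset.sum_add_distrib, rieszMean_real]
    refine Finset.sum_congr rfl fun k hk => ?_
    conv_lhs => rw [rpow_eq_sum_dyadicBump s (hv k hk).1 (hv k hk).2 J]
    rw [add_mul, Finset.sum_mul]
    congr 1
    exact Finset.sum_congr rfl fun j _ => by ring
  obtain ⟨S, hS, hmem⟩ := exists_card_bound (n := n) hJ
  have hsq : Real.sqrt l < 2 ^ (J + 1) := by
    rw [Real.sqrt_lt' (by positivity), ← pow_mul, mul_comm, pow_mul]
    norm_num
    exact hJ'
  have hcard : (S.card : ℝ) ≤ 6 := by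
    refine hS.trans ?_
    have : Real.sqrt l / 2 ^ J ≤ 2 := by
      rw [div_le_iff₀ (by positivity)]
      rw [pow_succ] at hsq
      linarith
    linarith
  set D := 2 ^ s * (2 : ℝ) ^ (-(J * s)) * B with hD
  have hD0 : 0 ≤ D := by positivity
  have hRle : |R| ≤ 6 * D := by
    calc |R| ≤ ∑ k ∈ indicesBelow (n + 1) l, |(1 - (k : ℝ) * (k + n) / l) ^ s *
          (1 - Real.smoothTransition (2 ^ J * (1 - (k : ℝ) * (k + n) / l) - 1)) *
            seriesTerm Y f k x| := Finset.abs_sum_le_sum_abs _ _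
      _ ≤ ∑ k ∈ indicesBelow (n + 1) l, if k ∈ S then D else 0 := by
          refine Finset.sum_le_sum fun k hk => ?_
          obtain ⟨hv0, hv1⟩ := hv k hk
          rw [mem_indicesBelow (by omega) hl, eigval_succ] at hk
          set v := 1 - (k : ℝ) * (k + n) / l with hvdef
          rcases le_or_gt 2 (2 ^ J * v) with h | h
          · rw [Real.smoothTransition.one_of_one_le (by linarith), sub_self, mul_zero, zero_mul, abs_zero]
            split_ifs <;> [exact hD0; exact le_rfl]
          · have hkS : k ∈ S := by
              refine hmem k ?_ hk
              have h1 : v ≤ 2 / 2 ^ J := by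
                rw [le_div_iff₀ (by positivity), mul_comm]; exact h.le
              have h2 : l * v = l - k * (k + n) := by rw [hvdef]; field_simp
              have h3 : l * v ≤ l * (2 / 2 ^ J) := by gcongr
              rw [mul_sub, mul_one]
              linarith
            rw [if_pos hkS]
            have hk2 : k < 2 ^ (J + 1) := by
              have h1 : (k : ℝ) ^ 2 ≤ k * (k + n) := by
                rw [sq]
                gcongr
                linarith [(Nat.cast_nonneg n : (0 : ℝ) ≤ n)]
              have h2 : (k : ℝ) ≤ Real.sqrt l := Real.le_sqrt_of_sq_le (h1.trans hk.le)
              exact_mod_cast h2.trans_lt hsq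
            have hvs : v ^ s ≤ 2 ^ s * (2 : ℝ) ^ (-(J * s)) := by
              have h1 : v ≤ 2 * (2 ^ J)⁻¹ := by
                rw [← div_eq_mul_inv, le_div_iff₀ (by positivity), mul_comm]; exact h.le
              calc v ^ s ≤ (2 * ((2 : ℝ) ^ J)⁻¹) ^ s := by gcongr
                _ = _ := by
                  rw [Real.mul_rpow (by norm_num) (by positivity), Real.inv_rpow (by positivity),
                    Real.rpow_neg (by norm_num), Real.rpow_mul (by norm_num), Real.rpow_natCast]
            have hχ0 := Real.smoothTransition.nonneg (2 ^ J * v - 1)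
            have hχ1 := Real.smoothTransition.le_one (2 ^ J * v - 1)
            rw [abs_mul, abs_of_nonneg (mul_nonneg (by positivity) (by linarith))]
            calc v ^ s * (1 - Real.smoothTransition (2 ^ J * v - 1)) * |seriesTerm Y f k x|
                ≤ (2 ^ s * (2 : ℝ) ^ (-(J * s))) * 1 * B := by
                  have := hB k hk2
                  have : 0 ≤ 1 - Real.smoothTransition (2 ^ J * v - 1) := by linarith
                  gcongr
                  linarith
              _ = D := by rw [hD]; ring
      _ ≤ 6 * D := by
          rw [← Finset.sum_filter, Finset.sum_const, nsmul_eq_mul]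
          gcongr
          refine le_trans ?_ hcard
          exact_mod_cast Finset.card_le_card fun k hk => (Finset.mem_filter.mp hk).2
  rw [hdec]
  refine (abs_add_le _ _).trans (add_le_add ((Finset.abs_sum_le_sum_abs _ _).trans_eq ?_)
    (hRle.trans_eq (by rw [hD]; ring)))
  refine Finset.sum_congr rfl fun j _ => ?_
  rw [abs_mul, abs_of_pos (Real.rpow_pos_of_pos (by norm_num) _)]

/-! ### The maximal inequality. -/

theorem exists_weakType_bandSum (hY : IsHarmonicSystem (n + 1) Y) {ψ : ℝ → ℝ}
    (hψ : ContDiff ℝ ∞ ψ) (hsupp : ∀ w, ψ w ≠ 0 → 1 / 2 ≤ w ∧ w ≤ 2) {p : ℝ} (hp1 : 1 ≤ p)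
    (hp2 : p ≤ 2) : ∃ c : ℝ, 0 < c ∧ ∀ j : ℕ,
      WeakType p (c * ((2 : ℝ) ^ (j * ((n : ℝ) / 2))) ^ (2 - p))
        fun (l : Set.Ici ((4 : ℝ) ^ j)) f x => bandSum Y ψ j l f x := by
  obtain ⟨C₀, hC₀, h₀⟩ := exists_weakType_of_ballMeansLE (n + 1)
  obtain ⟨C₁, hC₁, h₁⟩ := exists_abs_bandSum_le hY hψ hsupp
  obtain ⟨C₂, hC₂, h₂⟩ := exists_weakType_two_bandSum hY hψ hsupp
  set c := max (max (C₀ * C₁) C₂) (C₀ * (C₁ * 2 ^ ((n : ℝ) / 2)) ^ 2) with hc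
  have hc0 : 0 < c := lt_of_lt_of_le hC₂ ((le_max_right _ _).trans (le_max_left _ _))
  refine ⟨6 * c, by positivity, fun j => ?_⟩
  obtain ⟨w1, w2⟩ := h₀ (fun (l : Set.Ici ((4 : ℝ) ^ j)) f x => bandSum Y ψ j l f x)
    (C₁ * (2 : ℝ) ^ (j * ((n : ℝ) / 2))) (by positivity)
    (fun f hf m x hm hx hx' l => h₁ j l l.2 f hf m x hm hx hx')
  refine WeakType.interpolate hc0 (Real.rpow_pos_of_pos (by norm_num) _) (w1.mono ?_) ?_ ?_ hp1 hp2
  · rw [← mul_assoc]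
    gcongr
    exact (le_max_left _ _).trans (le_max_left _ _)
  -- The Sobolev argument needs j ≥ 2. For j = 0, 1 the weak type (2, 2) bound from ball means
  -- serves, its constant being bounded there.
  · rcases le_or_gt 2 j with hj | hj
    · exact (h₂ j hj).mono ((le_max_right _ _).trans (le_max_left _ _))
    · refine w2.mono (le_trans ?_ (le_max_right _ _))
      gcongr
      · norm_num
      · have : (j : ℝ) ≤ 1 := by exact_mod_cast Nat.lt_succ_iff.mp hj
        have h3 : 0 ≤ (n : ℝ) / 2 := by positivity
        nlinarith
  · intro f g hf hg l x
    simp only [bandSum, seriesTerm_add hY hf hg, mul_add, Finset.sum_add_distrib]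

theorem exists_weakType_seriesTerm (hY : IsHarmonicSystem (n + 1) Y) {p : ℝ} (hp1 : 1 ≤ p)
    (hp2 : p ≤ 2) : ∃ c : ℝ, 0 < c ∧ ∀ j : ℕ,
      WeakType p (c * ((2 : ℝ) ^ (j * ((n : ℝ) / 2))) ^ (2 - p))
        fun (k : Fin (2 ^ (j + 1))) f x => seriesTerm Y f (k : ℕ) x := by
  obtain ⟨C₀, hC₀, h₀⟩ := exists_weakType_of_ballMeansLE (n + 1)
  obtain ⟨C₁, hC₁, h₁⟩ := exists_abs_seriesTerm_le hY
  set c := max (C₀ * C₁) 1 with hc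
  have hc0 : 0 < c := lt_of_lt_of_le one_pos (le_max_right _ _)
  refine ⟨6 * c, by positivity, fun j => ?_⟩
  obtain ⟨w1, -⟩ := h₀ (fun (k : Fin (2 ^ (j + 1))) f x => seriesTerm Y f (k : ℕ) x)
    (C₁ * (2 : ℝ) ^ (j * ((n : ℝ) / 2))) (by positivity)
    (fun f hf m x hm hx hx' k => h₁ j k k.2 f hf m x hm hx hx')
  refine WeakType.interpolate hc0 (Real.rpow_pos_of_pos (by norm_num) _) (w1.mono ?_)
    ((weakType_two_seriesTerm hY j).mono (le_max_right _ _)) ?_ hp1 hp2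
  · rw [← mul_assoc]
    gcongr
    exact le_max_left _ _
  · intro f g hf hg k x
    exact seriesTerm_add hY hf hg _ x

/-- The maximal function of the Riesz means is of weak type `(p, p)` above the critical order. -/
theorem exists_weakType_rieszMean (hY : IsHarmonicSystem (n + 1) Y) {p s : ℝ} (hp1 : 1 ≤ p)
    (hp2 : p ≤ 2) (hs : (n : ℝ) * (1 / p - 1 / 2) < s) : ∃ C : ℝ, 0 < C ∧
      WeakType p C fun (l : Set.Ici (1 : ℝ)) f x => rieszMean Y s l f x := by
  have hp0 : 0 < p := by linarith
  set κ := (n : ℝ) * (1 / p - 1 / 2) with hκ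
  have hκ0 : 0 ≤ κ := by
    refine mul_nonneg n.cast_nonneg (sub_nonneg.mpr ?_)
    exact one_div_le_one_div_of_le hp0 hp2
  have hs0 : 0 < s := hκ0.trans_lt hs
  -- The critical order enters here: the weak type constants 2^(jν(2−p)) are 2^(jκp).
  have hκp : κ * p = (n : ℝ) / 2 * (2 - p) := by rw [hκ]; field_simp
  -- Any s' strictly between κ and s would do: s' < s makes the heights 2^(−js) β_j summable (ratio
  -- ρ), and s' > κ makes the exceptional measures summable (ratio θ).
  set s' := (s + κ) / 2 with hs'
  obtain ⟨c₁, hc₁, h₁⟩ := exists_weakType_bandSum hY (contDiff_dyadicBump s)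
    (fun w => dyadicBump_supp s) hp1 hp2
  obtain ⟨c₂, hc₂, h₂⟩ := exists_weakType_seriesTerm hY hp1 hp2
  set ρ : ℝ := 2 ^ (-(s - s')) with hρ
  have hρ0 : 0 < ρ := Real.rpow_pos_of_pos (by norm_num) _
  have hρ1 : ρ < 1 := Real.rpow_lt_one_of_one_lt_of_neg (by norm_num) (by linarith)
  set θ : ℝ := 2 ^ ((n : ℝ) / 2 * (2 - p) - s' * p) with hθ
  have hθ0 : 0 < θ := Real.rpow_pos_of_pos (by norm_num) _
  have hθ1 : θ < 1 := Real.rpow_lt_one_of_one_lt_of_neg (by norm_num) (by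
    rw [← hκp]; nlinarith)
  -- Chosen so that off all exceptional sets the dyadic pieces and the remainder add up to at most
  -- α.
  set M : ℝ := (1 - ρ)⁻¹ + 6 * 2 ^ s with hM
  have h1ρ : 0 < 1 - ρ := by linarith
  have h1θ : 0 < 1 - θ := by linarith
  have hM0 : 0 < M := by positivity
  refine ⟨(c₁ + c₂) * M ^ p * (1 - θ)⁻¹, by positivity, fun f hf α hα => ?_⟩
  set β : ℕ → ℝ := fun j => α / M * 2 ^ (j * s') with hβ
  have hβ0 : ∀ j, 0 < β j := fun j => by positivity
  set E₁ : ℕ → Set (USphere (n + 1)) := fun j =>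
    {x | ∃ l : Set.Ici ((4 : ℝ) ^ j), β j < |bandSum Y (dyadicBump s) j l f x|} with hE₁
  set E₂ : ℕ → Set (USphere (n + 1)) := fun j =>
    {x | ∃ k : Fin (2 ^ (j + 1)), β j < |seriesTerm Y f (k : ℕ) x|} with hE₂
  have hwβ : ∀ j : ℕ, (2 : ℝ) ^ (-(j * s)) * β j = α / M * ρ ^ j := by
    intro j
    have e1 : ρ ^ j = 2 ^ (-(j * s)) * 2 ^ (j * s') := by
      rw [hρ, ← Real.rpow_natCast, ← Real.rpow_mul (by norm_num), ← Real.rpow_add (by norm_num)]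
      congr 1; ring
    rw [e1, hβ]; ring
  have hsub : {x | ∃ l : Set.Ici (1 : ℝ), α < |rieszMean Y s l f x|} ⊆ ⋃ j, (E₁ j ∪ E₂ j) := by
    rintro x ⟨l, hlt⟩
    by_contra hcon
    simp only [Set.mem_iUnion, Set.mem_union, not_exists, not_or, hE₁, hE₂, Set.mem_ofPred_eq,
      not_lt] at hcon
    obtain ⟨J, hJ, hJ'⟩ := exists_nat_pow_near (x := (l : ℝ)) (y := 4) l.2 (by norm_num)
    have hle := abs_rieszMean_le hs0.le hJ hJ' f x (B := β J)
      (fun k hk => (hcon J).2 ⟨k, hk⟩)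
    have hsum : ∑ j ∈ Finset.range J, (2 : ℝ) ^ (-(j * s)) * |bandSum Y (dyadicBump s) j l f x| ≤
        α / M * (1 - ρ)⁻¹ := by
      calc _ ≤ ∑ j ∈ Finset.range J, α / M * ρ ^ j := by
            refine Finset.sum_le_sum fun j hj => ?_
            rw [← hwβ j]
            gcongr
            refine (hcon j).1 ⟨l, le_trans ?_ hJ⟩
            exact pow_le_pow_right₀ (by norm_num) (Finset.mem_range.mp hj).le
        _ ≤ _ := by
            rw [← Finset.mul_sum, ← tsum_geometric_of_lt_one hρ0.le hρ1]
            gcongr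
            exact (summable_geometric_of_lt_one hρ0.le hρ1).sum_le_tsum _ fun j _ => by positivity
    have hrem : 6 * 2 ^ s * (2 : ℝ) ^ (-(J * s)) * β J ≤ 6 * 2 ^ s * (α / M) := by
      rw [mul_assoc, hwβ J]
      gcongr
      exact mul_le_of_le_one_right (by positivity) (pow_le_one₀ hρ0.le hρ1.le)
    have htot : α / M * (1 - ρ)⁻¹ + 6 * 2 ^ s * (α / M) = α := by
      rw [show α / M * (1 - ρ)⁻¹ + 6 * 2 ^ s * (α / M) = α / M * M by rw [hM]; ring,
        div_mul_cancel₀ _ hM0.ne']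
    linarith
  have hcoef : ∀ (c : ℝ) (j : ℕ), 0 ≤ c → c * ((2 : ℝ) ^ (j * ((n : ℝ) / 2))) ^ (2 - p) / β j ^ p =
      c * M ^ p / α ^ p * θ ^ j := by
    intro c j _
    have e1 : θ ^ j = ((2 : ℝ) ^ (j * ((n : ℝ) / 2))) ^ (2 - p) / ((2 : ℝ) ^ (j * s')) ^ p := by
      rw [hθ, ← Real.rpow_natCast, ← Real.rpow_mul (by norm_num), ← Real.rpow_mul (by norm_num),
        ← Real.rpow_mul (by norm_num), ← Real.rpow_sub (by norm_num)]
      congr 1; ring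
    rw [e1, hβ]
    simp only
    rw [Real.mul_rpow (by positivity) (by positivity), Real.div_rpow hα.le hM0.le]
    have : M ^ p ≠ 0 := (Real.rpow_pos_of_pos hM0 _).ne'
    field_simp
  have hE : ∀ j, surfaceMeasure (n + 1) (E₁ j ∪ E₂ j) ≤
      ENNReal.ofReal ((c₁ + c₂) * M ^ p / α ^ p * θ ^ j) *
        ∫⁻ y, ‖f y‖ₑ ^ p ∂surfaceMeasure (n + 1) := by
    intro j
    refine (measure_union_le _ _).trans ((add_le_add (h₁ j f hf (β j) (hβ0 j))
      (h₂ j f hf (β j) (hβ0 j))).trans_eq ?_)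
    rw [← add_mul, hcoef _ _ hc₁.le, hcoef _ _ hc₂.le,
      ← ENNReal.ofReal_add (by positivity) (by positivity)]
    congr 2; ring
  calc _ ≤ ∑' j, surfaceMeasure (n + 1) (E₁ j ∪ E₂ j) := (measure_mono hsub).trans (measure_iUnion_le _)
    _ ≤ ∑' j : ℕ, ENNReal.ofReal ((c₁ + c₂) * M ^ p / α ^ p * θ ^ j) *
        ∫⁻ y, ‖f y‖ₑ ^ p ∂surfaceMeasure (n + 1) := ENNReal.tsum_le_tsum hE
    _ = _ := by
        rw [ENNReal.tsum_mul_right, ← ENNReal.ofReal_tsum_of_nonneg (fun j => by positivity)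
          ((summable_geometric_of_lt_one hθ0.le hθ1).mul_left _), tsum_mul_left,
          tsum_geometric_of_lt_one hθ0.le hθ1]
        congr 2; ring

/-! ### Density and almost everywhere convergence for real functions. -/

theorem rieszMean_add (hY : IsHarmonicSystem (n + 1) Y) (s l : ℝ) {f g : USphere (n + 1) → ℝ}
    (hf : Integrable f (surfaceMeasure (n + 1))) (hg : Integrable g (surfaceMeasure (n + 1)))
    (x : USphere (n + 1)) :
    rieszMean Y s l (f + g) x = rieszMean Y s l f x + rieszMean Y s l g x := by
  simp only [rieszMean_real, seriesTerm_add hY hf hg, mul_add, Finset.sum_add_distrib]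

theorem tendsto_rieszMean_of_mem (hY : IsHarmonicSystem (n + 1) Y) (s : ℝ) {m : ℕ}
    {g : USphere (n + 1) → ℝ} (hg : g ∈ sphericalHarmonics (n + 1) m) (x : USphere (n + 1)) :
    Tendsto (fun l => rieszMean Y s l g x) atTop (𝓝 (g x)) := by
  have h1 : Tendsto (fun l : ℝ => (1 - (m : ℝ) * (m + n) / l) ^ s * g x) atTop (𝓝 (g x)) := by
    have h2 : Tendsto (fun l : ℝ => 1 - (m : ℝ) * (m + n) / l) atTop (𝓝 (1 - 0)) :=
      tendsto_const_nhds.sub (tendsto_const_nhds.div_atTop tendsto_id)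
    rw [sub_zero] at h2
    have h3 := (h2.rpow_const (p := s) (Or.inl one_ne_zero)).mul_const (g x)
    rwa [Real.one_rpow, one_mul] at h3
  refine h1.congr' ?_
  filter_upwards [eventually_gt_atTop 0, eventually_gt_atTop (eigval (n + 1) m)] with l hl hlm
  rw [rieszMean_real]
  simp only [seriesTerm_of_mem hY hg, mul_ite, mul_zero]
  rw [Finset.sum_ite_eq', if_pos ((mem_indicesBelow (by omega) hl).mpr hlm)]

theorem tendsto_rieszMean_sum (hY : IsHarmonicSystem (n + 1) Y) (s : ℝ) (g : USphere (n + 1) → ℝ)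
    (c : ℕ → ℝ) (K : ℕ) (x : USphere (n + 1)) :
    Tendsto (fun l => rieszMean Y s l (fun x => ∑ k ∈ Finset.range K, c k * seriesTerm Y g k x) x)
      atTop (𝓝 (∑ k ∈ Finset.range K, c k * seriesTerm Y g k x)) := by
  have hc := continuous_seriesTerm hY g
  induction K with
  | zero =>
    simp only [Finset.range_zero, Finset.sum_empty]
    exact tendsto_rieszMean_of_mem hY s (sphericalHarmonics (n + 1) 0).zero_mem x
  | succ K ih =>
    have h1 := tendsto_rieszMean_of_mem hY s
      ((sphericalHarmonics (n + 1) K).smul_mem (c K) (seriesTerm_mem hY g K)) x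
    refine ((ih.add h1).congr fun l => ?_).trans_eq ?_
    · rw [← rieszMean_add hY]
      · congr 1
        funext y
        simp [Finset.sum_range_succ]
      · exact integrable_of_continuous (continuous_finsetSum _ fun k _ => continuous_const.mul (hc k))
      · exact integrable_of_continuous (continuous_const.mul (hc K))
    · simp [Finset.sum_range_succ]

theorem exists_abs_seriesTerm_le_of_continuous (hY : IsHarmonicSystem (n + 1) Y)
    {g : USphere (n + 1) → ℝ} (hg : Continuous g) :
    ∃ C : ℝ, ∀ k x, |seriesTerm Y g k x| ≤ C * (k + 1 : ℝ) ^ n := by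
  obtain ⟨A, hA, hz⟩ := zonal_sup_bound n
  obtain ⟨G, hG⟩ := isCompact_univ.exists_bound_of_continuousOn hg.continuousOn
  have hS := sphereArea_pos (n + 1)
  refine ⟨G * A, fun k x => ?_⟩
  rw [seriesTerm_eq_integral hY (integrable_of_continuous hg), abs_mul, abs_of_pos (inv_pos.mpr hS),
    inv_mul_le_iff₀ hS]
  have h1 := norm_integral_le_of_norm_le_const (μ := surfaceMeasure (n + 1))
    (f := fun y => g y * zonal ((n : ℝ) / 2) k (inner ℝ (x : Ambient (n + 1)) y))
    (C := G * (A * (k + 1 : ℝ) ^ n)) (Eventually.of_forall fun y => by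
      rw [norm_mul]
      have h2 := hG y trivial
      exact mul_le_mul h2 (hz k _ (abs_inner_sphere_le x y)) (norm_nonneg _)
        ((norm_nonneg _).trans h2))
  rw [Real.norm_eq_abs] at h1
  refine h1.trans_eq ?_
  rw [sphereArea]; ring

/-- Finite sums of spherical harmonics are uniformly dense in the continuous functions. -/
theorem exists_sum_seriesTerm_close (hY : IsHarmonicSystem (n + 1) Y) {g : USphere (n + 1) → ℝ}
    (hg : Continuous g) {ε : ℝ} (hε : 0 < ε) : ∃ (c : ℕ → ℝ) (K : ℕ), ∀ x,
      |g x - ∑ k ∈ Finset.range K, c k * seriesTerm Y g k x| ≤ ε := by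
  have hS := sphereArea_pos (n + 1)
  obtain ⟨r, hr0, hr1, hclose⟩ := exists_poisson_integral_close n hg
    (show 0 < sphereArea (n + 1) * (ε / 2) by positivity)
  have hra : |r| < 1 := by rw [abs_of_nonneg (by linarith)]; exact hr1
  obtain ⟨C, hC⟩ := exists_abs_seriesTerm_le_of_continuous hY hg
  have hu := tendstoUniformly_tsum_nat (f := fun (k : ℕ) (x : USphere (n + 1)) =>
    r ^ k * seriesTerm Y g k x) ((summable_poly_geometric n hra).mul_left C) (fun k x => by
      rw [norm_mul, norm_pow, Real.norm_eq_abs r, Real.norm_eq_abs (seriesTerm _ _ _ _)]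
      calc |r| ^ k * |seriesTerm Y g k x| ≤ |r| ^ k * (C * (k + 1 : ℝ) ^ n) := by
            gcongr; exact hC k x
        _ = _ := by ring)
  obtain ⟨K, hK⟩ := ((Metric.tendstoUniformly_iff.mp hu) (ε / 2) (by positivity)).exists
  -- The approximants are partial sums of the Poisson series, which converges uniformly for fixed r
  -- < 1.
  refine ⟨fun k => r ^ k, K, fun x => ?_⟩
  have h1 := hK x
  rw [Real.dist_eq] at h1
  have h2 : ∑' k : ℕ, r ^ k * seriesTerm Y g k x = (sphereArea (n + 1))⁻¹ *
      ∫ y, poissonKernel n r (inner ℝ (x : Ambient (n + 1)) y) * g y ∂surfaceMeasure (n + 1) := by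
    refine HasSum.tsum_eq (((hasSum_poisson_integral n hra hg x).mul_left _).congr_fun fun k => ?_)
    rw [seriesTerm_eq_integral hY (integrable_of_continuous hg)]
    simp only [mul_comm (g _)]
    ring
  have h3 := hclose r le_rfl hr1 x
  set I := ∫ y, poissonKernel n r (inner ℝ (x : Ambient (n + 1)) y) * g y ∂surfaceMeasure (n + 1)
  have h4 : |(sphereArea (n + 1))⁻¹ * I - g x| ≤ ε / 2 := by
    have : (sphereArea (n + 1))⁻¹ * I - g x = (sphereArea (n + 1))⁻¹ * (I - sphereArea (n + 1) * g x) := by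
      field_simp
    rw [this, abs_mul, abs_of_pos (inv_pos.mpr hS), inv_mul_le_iff₀ hS]
    exact h3
  rw [h2] at h1
  rw [abs_sub_comm] at h4
  have := abs_add_le (g x - (sphereArea (n + 1))⁻¹ * I)
    ((sphereArea (n + 1))⁻¹ * I - ∑ k ∈ Finset.range K, r ^ k * seriesTerm Y g k x)
  rw [sub_add_sub_cancel] at this
  linarith

theorem weakType_id (N : ℕ) {p : ℝ} (hp : 0 < p) :
    WeakType (N := N) p 1 fun (_ : Unit) f x => f x := by
  intro f hf β hβ
  have hsub : {x | ∃ _ : Unit, β < |f x|} ⊆ {x | ENNReal.ofReal (β ^ p) ≤ ‖f x‖ₑ ^ p} := by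
    rintro x ⟨_, hx⟩
    rw [Set.mem_ofPred_eq, Real.enorm_eq_ofReal_abs,
      ENNReal.ofReal_rpow_of_nonneg (abs_nonneg _) hp.le]
    gcongr
  have hβp : 0 < β ^ p := Real.rpow_pos_of_pos hβ _
  refine (measure_mono hsub).trans ((meas_ge_le_lintegral_div (hf.1.enorm.pow_const p)
    (by simpa using hβp) ENNReal.ofReal_ne_top).trans_eq ?_)
  rw [ENNReal.div_eq_inv_mul, ← ENNReal.ofReal_inv_of_pos hβp, one_div]

/-- Approximation in two stages, first by a continuous function and then uniformly by a finite
harmonic sum, for which the means converge everywhere; the finite total measure turns the uniform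
error into an L_p error. -/
theorem exists_tendsto_rieszMean_eLpNorm_sub_le (hY : IsHarmonicSystem (n + 1) Y) (s : ℝ)
    {p : ENNReal} (hp1 : 1 ≤ p) (hp : p ≠ ⊤) {f : USphere (n + 1) → ℝ}
    (hf : MemLp f p (surfaceMeasure (n + 1))) {ε : ENNReal} (hε : ε ≠ 0) :
    ∃ g : USphere (n + 1) → ℝ, Continuous g ∧
      (∀ x, Tendsto (fun l => rieszMean Y s l g x) atTop (𝓝 (g x))) ∧
      eLpNorm (f - g) p (surfaceMeasure (n + 1)) ≤ ε := by
  have hε2 : ε / 2 ≠ 0 := by simpa using hε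
  obtain ⟨g₀, hg₀, -⟩ := hf.exists_boundedContinuous_eLpNorm_sub_le hp hε2
  set V := surfaceMeasure (n + 1) Set.univ ^ p.toReal⁻¹ with hV
  have hV0 : V ≠ ⊤ := ENNReal.rpow_ne_top_of_nonneg (by positivity) (measure_ne_top _ _)
  obtain ⟨δ, hδ, hδε⟩ : ∃ δ : ℝ, 0 < δ ∧ V * ENNReal.ofReal δ ≤ ε / 2 := by
    have h1 : Tendsto (fun δ : ℝ => V * ENNReal.ofReal δ) (𝓝[>] 0) (𝓝 (V * ENNReal.ofReal 0)) := by
      refine ENNReal.Tendsto.const_mul ?_ (Or.inr hV0)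
      exact (ENNReal.continuous_ofReal.tendsto 0).mono_left nhdsWithin_le_nhds
    rw [ENNReal.ofReal_zero, mul_zero] at h1
    obtain ⟨δ, h2, h3⟩ := ((h1.eventually (ge_mem_nhds (pos_iff_ne_zero.mpr hε2))).and
      self_mem_nhdsWithin).exists
    exact ⟨δ, h3, h2⟩
  obtain ⟨c, K, hK⟩ := exists_sum_seriesTerm_close hY g₀.continuous hδ
  set g : USphere (n + 1) → ℝ := fun x => ∑ k ∈ Finset.range K, c k * seriesTerm Y g₀ k x with hg
  have hgc : Continuous g :=
    continuous_finsetSum _ fun k _ => continuous_const.mul (continuous_seriesTerm hY _ k)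
  refine ⟨g, hgc, tendsto_rieszMean_sum hY s _ c K, ?_⟩
  have h1 : eLpNorm (⇑g₀ - g) p (surfaceMeasure (n + 1)) ≤ ε / 2 :=
    (eLpNorm_le_of_ae_bound (Eventually.of_forall hK)).trans hδε
  have h2 : f - g = (f - ⇑g₀) + (⇑g₀ - g) := (sub_add_sub_cancel _ _ _).symm
  rw [h2, ← ENNReal.add_halves ε]
  exact (eLpNorm_add_le (hf.1.sub g₀.continuous.aestronglyMeasurable)
    (g₀.continuous.sub hgc).aestronglyMeasurable hp1).trans (add_le_add hg₀ h1)

/-- Almost everywhere convergence of the Riesz means of real functions. -/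
theorem ae_tendsto_rieszMean_real (hY : IsHarmonicSystem (n + 1) Y) {p s : ℝ} (hp1 : 1 ≤ p)
    (hp2 : p ≤ 2) (hs : (n : ℝ) * (1 / p - 1 / 2) < s) {f : USphere (n + 1) → ℝ}
    (hf : MemLp f (ENNReal.ofReal p) (surfaceMeasure (n + 1))) :
    ∀ᵐ x ∂surfaceMeasure (n + 1), Tendsto (fun l => rieszMean Y s l f x) atTop (𝓝 (f x)) := by
  have hp0 : 0 < p := by linarith
  have hp1' : 1 ≤ ENNReal.ofReal p := by
    rw [← ENNReal.ofReal_one]; exact ENNReal.ofReal_le_ofReal hp1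
  obtain ⟨C, hC, hW⟩ := exists_weakType_rieszMean hY hp1 hp2 hs
  have hnull : ∀ α : ℝ, 0 < α → surfaceMeasure (n + 1)
      {x | ¬ ∀ᶠ l in atTop, |rieszMean Y s l f x - f x| ≤ 3 * α} = 0 := by
    intro α hα
    set B := {x | ¬ ∀ᶠ l in atTop, |rieszMean Y s l f x - f x| ≤ 3 * α} with hB
    have hle : ∀ ε : ℝ, 0 < ε →
        surfaceMeasure (n + 1) B ≤ ENNReal.ofReal ((C / α ^ p + 1 / α ^ p) * ε ^ p) := by
      intro ε hε
      obtain ⟨g, hgc, hgt, hgε⟩ := exists_tendsto_rieszMean_eLpNorm_sub_le hY s hp1'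
        ENNReal.ofReal_ne_top hf (ε := ENNReal.ofReal ε) (by simpa using hε)
      have hgm : MemLp g (ENNReal.ofReal p) (surfaceMeasure (n + 1)) := by
        obtain ⟨G, hG⟩ := isCompact_univ.exists_bound_of_continuousOn hgc.continuousOn
        exact MemLp.of_bound hgc.aestronglyMeasurable G (Eventually.of_forall fun x => hG x trivial)
      have hh := hf.sub hgm
      have hhi : Integrable (f - g) (surfaceMeasure (n + 1)) := hh.integrable hp1'
      have hgi : Integrable g (surfaceMeasure (n + 1)) := hgm.integrable hp1'
      -- Off this union the error for f is at most the maximal function of f − g, plus the error for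
      -- g, plus |f − g|, each eventually at most α.
      have hsub : B ⊆ {x | ∃ l : Set.Ici (1 : ℝ), α < |rieszMean Y s l (f - g) x|} ∪
          {x | ∃ _ : Unit, α < |(f - g) x|} := by
        intro x hx
        by_contra hcon
        simp only [Set.mem_union, Set.mem_ofPred_eq, not_or, not_exists, not_lt] at hcon
        apply hx
        have hg1 := (Metric.tendsto_nhds.mp (hgt x)) α hα
        filter_upwards [hg1, eventually_ge_atTop 1] with l hl hl1
        rw [Real.dist_eq] at hl
        have h1 := hcon.1 ⟨l, hl1⟩
        have h2 := hcon.2 ()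
        have h3 := rieszMean_add hY s l hhi hgi x
        rw [sub_add_cancel] at h3
        rw [h3]
        rw [Pi.sub_apply] at h2
        have e : rieszMean Y s l (f - g) x + rieszMean Y s l g x - f x =
            rieszMean Y s l (f - g) x + (rieszMean Y s l g x - g x) - (f x - g x) := by ring
        rw [e]
        refine (abs_sub _ _).trans ?_
        linarith [abs_add_le (rieszMean Y s l (f - g) x) (rieszMean Y s l g x - g x)]
      have hint : ∫⁻ y, ‖(f - g) y‖ₑ ^ p ∂surfaceMeasure (n + 1) ≤ ENNReal.ofReal (ε ^ p) := by
        have h1 := eLpNorm_eq_lintegral_rpow_enorm_toReal (f := f - g) (μ := surfaceMeasure (n + 1))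
          (p := ENNReal.ofReal p) (by simpa using hp0) ENNReal.ofReal_ne_top
        rw [ENNReal.toReal_ofReal hp0.le] at h1
        rw [h1] at hgε
        have h2 := ENNReal.rpow_le_rpow hgε hp0.le
        rwa [← ENNReal.rpow_mul, one_div, inv_mul_cancel₀ hp0.ne', ENNReal.rpow_one,
          ENNReal.ofReal_rpow_of_pos hε] at h2
      refine (measure_mono hsub).trans ((measure_union_le _ _).trans ((add_le_add
        (hW _ hh α hα) (weakType_id (n + 1) hp0 _ hh α hα)).trans ?_))
      rw [← add_mul, ← ENNReal.ofReal_add (by positivity) (by positivity),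
        ENNReal.ofReal_mul (by positivity)]
      gcongr
    have hlim : Tendsto (fun ε : ℝ => ENNReal.ofReal ((C / α ^ p + 1 / α ^ p) * ε ^ p)) (𝓝[>] 0)
        (𝓝 0) := by
      have h1 : Tendsto (fun ε : ℝ => ENNReal.ofReal ((C / α ^ p + 1 / α ^ p) * ε ^ p)) (𝓝 0)
          (𝓝 (ENNReal.ofReal ((C / α ^ p + 1 / α ^ p) * 0 ^ p))) :=
        (ENNReal.continuous_ofReal.comp (continuous_const.mul
          (Real.continuous_rpow_const hp0.le))).tendsto 0
      rw [Real.zero_rpow hp0.ne', mul_zero, ENNReal.ofReal_zero] at h1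
      exact h1.mono_left nhdsWithin_le_nhds
    refine le_antisymm (ge_of_tendsto hlim ?_) zero_le
    filter_upwards [self_mem_nhdsWithin] with ε hε
    exact hle ε hε
  have hall : ∀ᵐ x ∂surfaceMeasure (n + 1), ∀ m : ℕ, ∀ᶠ l in atTop,
      |rieszMean Y s l f x - f x| ≤ 3 * (1 / (m + 1 : ℝ)) := by
    rw [ae_all_iff]
    intro m
    exact hnull _ (by positivity)
  filter_upwards [hall] with x hx
  rw [Metric.tendsto_nhds]
  intro ε hε
  obtain ⟨m, hm⟩ := exists_nat_one_div_lt (show 0 < ε / 3 by positivity)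
  filter_upwards [hx m] with l hl
  rw [Real.dist_eq]
  linarith

/-! ### Scalars and the discrete parameter -/

section Scalars

variable {𝕜 : Type*} [RCLike 𝕜]

theorem integrable_mul_ofReal {N : ℕ} {f : USphere N → 𝕜} {g : USphere N → ℝ}
    (hf : Integrable f (surfaceMeasure N)) (hg : Continuous g) :
    Integrable (fun y => f y * (g y : 𝕜)) (surfaceMeasure N) := by
  obtain ⟨G, hG⟩ := isCompact_univ.exists_bound_of_continuousOn hg.continuousOn
  refine hf.mul_bdd (c := G) (RCLike.continuous_ofReal.comp hg).aestronglyMeasurable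
    (Eventually.of_forall fun y => ?_)
  rw [RCLike.norm_ofReal]
  exact hG y trivial

theorem re_rieszMean (hY : IsHarmonicSystem (n + 1) Y) (s l : ℝ) {f : USphere (n + 1) → 𝕜}
    (hf : Integrable f (surfaceMeasure (n + 1))) (x : USphere (n + 1)) :
    RCLike.re (rieszMean Y s l f x) = rieszMean Y s l (fun y => RCLike.re (f y)) x := by
  simp only [rieszMean, seriesTerm, map_sum, RCLike.re_ofReal_mul, RCLike.ofReal_real_eq_id, id]
  refine Finset.sum_congr rfl fun k _ => ?_
  congr 1
  refine Finset.sum_congr rfl fun j _ => ?_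
  rw [← integral_re (integrable_mul_ofReal hf (hY.continuous k j))]
  simp only [RCLike.re_mul_ofReal]

theorem im_rieszMean (hY : IsHarmonicSystem (n + 1) Y) (s l : ℝ) {f : USphere (n + 1) → 𝕜}
    (hf : Integrable f (surfaceMeasure (n + 1))) (x : USphere (n + 1)) :
    RCLike.im (rieszMean Y s l f x) = rieszMean Y s l (fun y => RCLike.im (f y)) x := by
  simp only [rieszMean, seriesTerm, map_sum, RCLike.im_ofReal_mul, RCLike.ofReal_real_eq_id, id]
  refine Finset.sum_congr rfl fun k _ => ?_
  congr 1
  refine Finset.sum_congr rfl fun j _ => ?_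
  rw [← integral_im (integrable_mul_ofReal hf (hY.continuous k j))]
  simp only [RCLike.im_mul_ofReal]

theorem ae_tendsto_rieszMean (hY : IsHarmonicSystem (n + 1) Y) {p s : ℝ} (hp1 : 1 ≤ p)
    (hp2 : p ≤ 2) (hs : (n : ℝ) * (1 / p - 1 / 2) < s) {f : USphere (n + 1) → 𝕜}
    (hf : MemLp f (ENNReal.ofReal p) (surfaceMeasure (n + 1))) :
    ∀ᵐ x ∂surfaceMeasure (n + 1), Tendsto (fun l => rieszMean Y s l f x) atTop (𝓝 (f x)) := by
  have hi : Integrable f (surfaceMeasure (n + 1)) := hf.integrable (by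
    rw [← ENNReal.ofReal_one]; exact ENNReal.ofReal_le_ofReal hp1)
  filter_upwards [ae_tendsto_rieszMean_real hY hp1 hp2 hs hf.re,
    ae_tendsto_rieszMean_real hY hp1 hp2 hs hf.im] with x h1 h2
  simp only [← re_rieszMean hY _ _ hi, ← im_rieszMean hY _ _ hi] at h1 h2
  have h3 := ((RCLike.continuous_ofReal (K := 𝕜)).tendsto _ |>.comp h1).add
    (((RCLike.continuous_ofReal (K := 𝕜)).tendsto _ |>.comp h2).mul_const (RCLike.I : 𝕜))
  rw [RCLike.re_add_im] at h3
  refine h3.congr fun l => ?_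
  simp only [Function.comp, RCLike.re_add_im]

/-- The only extra term, of index m, has coefficient 0^s = 0. This is where s ≠ 0 counts, since 0^0
= 1. -/
theorem rieszMeanNat_eq_rieszMean {N : ℕ} (hN : 1 ≤ N)
    {Y : (k : ℕ) → Fin (harmonicDim N k) → USphere N → ℝ} {s : ℝ} (hs : s ≠ 0) {m : ℕ} (hm : 1 ≤ m)
    (f : USphere N → 𝕜) (x : USphere N) :
    rieszMeanNat Y s m f x = rieszMean Y s (eigval N m) f x := by
  have hpos : 0 < eigval N m := by
    have := eigval_strictMono hN hm
    simpa [eigval] using this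
  have hidx : indicesBelow N (eigval N m) = Finset.range m := by
    ext k
    rw [mem_indicesBelow hN hpos, (eigval_strictMono hN).lt_iff_lt, Finset.mem_range]
  rw [rieszMeanNat, rieszMean, hidx, Finset.sum_range_succ, div_self hpos.ne', sub_self,
    Real.zero_rpow hs]
  simp

theorem tendsto_eigval {N : ℕ} (hN : 1 ≤ N) : Tendsto (eigval N) atTop atTop := by
  refine tendsto_atTop_mono (fun m => ?_) tendsto_natCast_atTop_atTop
  have h1 : (1 : ℝ) ≤ N := mod_cast hN
  unfold eigval
  rcases Nat.eq_zero_or_pos m with rfl | hm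
  · simp
  · have h2 : (1 : ℝ) ≤ m := mod_cast hm
    nlinarith

end Scalars

end FourierLaplace

theorem theorem1 {𝕜 : Type*} [RCLike 𝕜] (N : ℕ) (hN : 1 ≤ N)
    (p s : ℝ) (hp₁ : 1 ≤ p) (hp₂ : p ≤ 2) (hs : ((N : ℝ) - 1) * (1 / p - 1 / 2) < s)
    (Y : (k : ℕ) → Fin (FourierLaplace.harmonicDim N k) → FourierLaplace.USphere N → ℝ)
    (hY : FourierLaplace.IsHarmonicSystem N Y)
    (f : FourierLaplace.USphere N → 𝕜)
    (hf : MemLp f (ENNReal.ofReal p) (FourierLaplace.surfaceMeasure N)) :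
    ∀ᵐ x ∂(FourierLaplace.surfaceMeasure N),
      Tendsto (fun l : ℝ => FourierLaplace.rieszMean Y s l f x) atTop (𝓝 (f x)) ∧
      Tendsto (fun n : ℕ => FourierLaplace.rieszMeanNat Y s n f x) atTop (𝓝 (f x)) := by
  obtain ⟨n, rfl⟩ := Nat.exists_eq_add_of_le' hN
  have hs' : (n : ℝ) * (1 / p - 1 / 2) < s := by
    push_cast at hs
    simpa using hs
  have hs0 : s ≠ 0 := by
    have h1 : 0 ≤ (n : ℝ) * (1 / p - 1 / 2) :=
      mul_nonneg n.cast_nonneg (sub_nonneg.mpr (one_div_le_one_div_of_le (by linarith) hp₂))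
    linarith
  filter_upwards [FourierLaplace.ae_tendsto_rieszMean hY hp₁ hp₂ hs' hf] with x hx
  refine ⟨hx, (hx.comp (FourierLaplace.tendsto_eigval hN)).congr' ?_⟩
  filter_upwards [eventually_ge_atTop 1] with m hm
  exact (FourierLaplace.rieszMeanNat_eq_rieszMean hN hs0 hm f x).symm
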